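/- Write $\mathbf H^2$ for the space of pairs of quaternions with its Euclidean inner product $\langle\cdot,\cdot\rangle$ and left quaternion multiplication, and let $I,J,K$ be left multiplication by $i,j,k$. Let $(M^2,g)$ be a connected smooth flat Riemannian surface (its curvature tensor vanishes), and let $L:M^2\to\mathbf H^2$ be a smooth isometric immersion, with second fundamental form $h$, such that * $L$ is Lagrangian: $I$, $J$ and $K$ map tangent vectors of $L$ to normal vectors; * $L$ is $H$-umbilical: near every point there are a smooth orthonormal frame $e_1,e_2$ and real functions $\lambda_1,\lambda_2,\lambda_3,\mu_1,\mu_2,\mu_3$ with (tangent vectors being identified with their images under $dL$) $$h(e_1,e_1)=\lambda_1Ie_1+\lambda_2Je_1+\lambda_3Ke_1,\quad h(e_1,e_2)=\mu_1Ie_2+\mu_2Je_2+\mu_3Ke_2,\quad h(e_2,e_2)=\mu_1Ie_1+\mu_2Je_1+\mu_3Ke_1;$$ * $L$ has no totally geodesic points: $h\neq0$ at every point of $M$. Call a smooth curve $z$ in the unit sphere $S^7\subset\mathbf H^2$ a Legendre curve if $\langle z',iz\rangle=\langle z',jz\rangle=\langle z',kz\rangle=0$ (stationary points are allowed), and a special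 Legendre curve if moreover it has unit speed and $z''=i\alpha z'+j\beta z'+k\gamma z'-z$ for some real functions $\alpha,\beta,\gamma$. In the following, $(x,y)$ denotes smooth local coordinates on $M$, defined near the point in question and ranging over an open rectangle, and the curves and functions of one variable are smooth. Then at least one of the following holds. 1. Every point of $M$ has a neighbourhood with coordinates $(x,y)$ in which $L(x,y)=D(x)+P(x)y$ for some curve $D$ in $\mathbf H^2$ and some Legendre curve $P$ in $S^7$. Moreover there is an open dense subset $W\subset M$ each of whose points has a neighbourhood with coordinates $(x,y)$ in which (a) or (b) holds: * (a) $L(x,y)=D(x)+cy$ for a curve $D$ in $\mathbf H^2$ and a constant vector $c\in\mathbf H^2$ (a Lagrangian cylinder); * (b) $L(x,y)=D(x)+P(x)y$ for a curve $D$ in $\mathbf H^2$ and a special Legendre curve $P$ in $S^7$. 2. (c) There is a vector $v\in\mathbf H^2$ such that every point of $M$ has a neighbourhood with coordinates $(x,y)$ in which $L(x,y)=f(x)A(y)+v$ for an $\mathbf H$-valued function $f$ and a curve $A$ in $\mathbf H^2$; that is, up to a translation, $L$ is a cone over the curve $A$. -/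

import Mathlib

open Set Bundle
open scoped Manifold ContDiff Quaternion

noncomputable section

namespace QLag

/-- The coordinate plane with its Euclidean norm. -/
abbrev Plane : Type := EuclideanSpace ℝ (Fin 2)

/-- The quaternion Euclidean space `H²`, with real inner product `Re ∑ conj(pₗ) qₗ`; quaternions
act by multiplication from the left on both coordinates. -/
abbrev H2 : Type := EuclideanSpace ℍ[ℝ] (Fin 2)

/-- The imaginary quaternion `a i + b j + c k`. -/
def im (a b c : ℝ) : ℍ[ℝ] := ⟨0, a, b, c⟩

/-- The imaginary unit `i`; the complex structure `I` of `H²` is left multiplication by `i`. -/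
def qi : ℍ[ℝ] := im 1 0 0

/-- The imaginary unit `j`; `J` is left multiplication by `j`. -/
def qj : ℍ[ℝ] := im 0 1 0

/-- The imaginary unit `k`; `K` is left multiplication by `k`. -/
def qk : ℍ[ℝ] := im 0 0 1

/-- `v` is orthogonal to `i w`, `j w` and `k w`. -/
def PerpIJK (v w : H2) : Prop :=
  inner ℝ v (qi • w) = 0 ∧ inner ℝ v (qj • w) = 0 ∧ inner ℝ v (qk • w) = 0

section Surface

variable {M : Type*} [TopologicalSpace M] [ChartedSpace Plane M]

section Metric

variable [IsManifold (𝓡 2) ∞ M]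

/-- Smooth Riemannian metrics on the surface `M`. -/
abbrev SmoothMetric (M : Type*) [TopologicalSpace M] [ChartedSpace Plane M]
    [IsManifold (𝓡 2) ∞ M] : Type _ :=
  ContMDiffRiemannianMetric (𝓡 2) ∞ Plane (fun p : M => TangentSpace (𝓡 2) p)

/-- Partial derivative of a real function in the `i`-th coordinate. -/
def pd (i : Fin 2) (F : Plane → ℝ) (u : Plane) : ℝ :=
  fderiv ℝ F u (EuclideanSpace.single i 1)

/-- The coordinate vector field `∂/∂xᵢ` of the chart `e` at the point with coordinates `u`. -/
def coordVec (e : OpenPartialHomeomorph M Plane) (i : Fin 2) (u : Plane) :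
    TangentSpace (𝓡 2) (e.symm u) :=
  mfderiv 𝓘(ℝ, Plane) (𝓡 2) e.symm u (EuclideanSpace.single i (1 : ℝ) : Plane)

/-- The matrix `g_ij` of the metric in the chart `e`. -/
def metricMatrix (g : SmoothMetric M) (e : OpenPartialHomeomorph M Plane) (u : Plane) :
    Matrix (Fin 2) (Fin 2) ℝ :=
  Matrix.of fun i j => g.inner (e.symm u) (coordVec e i u) (coordVec e j u)

/-- The Christoffel symbol `Γ^k_ij` of the Levi-Civita connection in the chart `e`. -/
def christoffel (g : SmoothMetric M) (e : OpenPartialHomeomorph M Plane) (k i j : Fin 2)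
    (u : Plane) : ℝ :=
  (1 / 2 : ℝ) * ∑ l, (metricMatrix g e u)⁻¹ k l *
    (pd i (fun w => metricMatrix g e w j l) u + pd j (fun w => metricMatrix g e w i l) u
      - pd l (fun w => metricMatrix g e w i j) u)

/-- The component `R^l_kij` of the Riemann curvature tensor in the chart `e`, that is, the
`∂_l`-component of `R(∂_i, ∂_j) ∂_k`. -/
def riemann (g : SmoothMetric M) (e : OpenPartialHomeomorph M Plane) (l k i j : Fin 2)
    (u : Plane) : ℝ :=
  pd i (christoffel g e l j k) u - pd j (christoffel g e l i k) u
    + ∑ m, (christoffel g e l i m u * christoffel g e m j k u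
      - christoffel g e l j m u * christoffel g e m i k u)

/-- The metric is flat: its curvature tensor vanishes. -/
def IsFlat (g : SmoothMetric M) : Prop :=
  ∀ e ∈ IsManifold.maximalAtlas (𝓡 2) ∞ M, ∀ u ∈ e.target, ∀ l k i j : Fin 2,
    riemann g e l k i j u = 0

end Metric

/-- The differential of a map `L : M → H²`. -/
def dL (L : M → H2) (p : M) : TangentSpace (𝓡 2) p →L[ℝ] H2 :=
  mfderiv (𝓡 2) 𝓘(ℝ, H2) L p

/-- `L` is a smooth isometric immersion of `(M, g)` into `H²`. -/
def IsIsometricImmersion [IsManifold (𝓡 2) ∞ M] (g : SmoothMetric M) (L : M → H2) : Prop :=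
  ContMDiff (𝓡 2) 𝓘(ℝ, H2) ∞ L ∧
    ∀ (p : M) (v w : TangentSpace (𝓡 2) p), inner ℝ (dL L p v) (dL L p w) = g.inner p v w

/-- `L` is Lagrangian: `I`, `J` and `K` map tangent vectors to normal vectors. -/
def IsLagrangian (L : M → H2) : Prop :=
  ∀ (p : M) (v w : TangentSpace (𝓡 2) p), PerpIJK (dL L p v) (dL L p w)

/-- The second fundamental form `h(X, Y)` at `p` of the immersion `L`, for vector fields `X` and
`Y` that are smooth near `p`: the normal component of the derivative along `X` of the
`H²`-valued function `dL(Y)` (Gauss' formula). -/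
def sff (L : M → H2) (X Y : ∀ q : M, TangentSpace (𝓡 2) q) (p : M) : H2 :=
  (LinearMap.range (dL L p).toLinearMap)ᗮ.starProjection
    (dL (fun q => dL L q (Y q)) p (X p))

/-- The second fundamental form vanishes at `p`. -/
def IsTotallyGeodesicAt [IsManifold (𝓡 2) ∞ M] (L : M → H2) (p : M) : Prop :=
  ∀ X Y : ∀ q : M, TangentSpace (𝓡 2) q,
    ContMDiffAt (𝓡 2) (𝓡 2).tangent ∞ (fun q => (⟨q, X q⟩ : TangentBundle (𝓡 2) M)) p →
    ContMDiffAt (𝓡 2) (𝓡 2).tangent ∞ (fun q => (⟨q, Y q⟩ : TangentBundle (𝓡 2) M)) p →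
    sff L X Y p = 0

/-- `L` is H-umbilical: near every point there are a smooth orthonormal frame `e₁, e₂` and
real functions `λ₁, λ₂, λ₃, μ₁, μ₂, μ₃` with
`h(e₁, e₁) = λ₁ I e₁ + λ₂ J e₁ + λ₃ K e₁`, `h(e₁, e₂) = μ₁ I e₂ + μ₂ J e₂ + μ₃ K e₂`,
`h(e₂, e₂) = μ₁ I e₁ + μ₂ J e₁ + μ₃ K e₁`. -/
def IsHUmbilical [IsManifold (𝓡 2) ∞ M] (g : SmoothMetric M) (L : M → H2) : Prop :=
  ∀ p : M, ∃ U : Set M, IsOpen U ∧ p ∈ U ∧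
    ∃ e₁ e₂ : ∀ q : M, TangentSpace (𝓡 2) q,
      ContMDiffOn (𝓡 2) (𝓡 2).tangent ∞ (fun q => (⟨q, e₁ q⟩ : TangentBundle (𝓡 2) M)) U ∧
      ContMDiffOn (𝓡 2) (𝓡 2).tangent ∞ (fun q => (⟨q, e₂ q⟩ : TangentBundle (𝓡 2) M)) U ∧
      (∀ q ∈ U, g.inner q (e₁ q) (e₁ q) = 1 ∧ g.inner q (e₂ q) (e₂ q) = 1 ∧
        g.inner q (e₁ q) (e₂ q) = 0) ∧
      ∃ l₁ l₂ l₃ m₁ m₂ m₃ : M → ℝ, ∀ q ∈ U,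
        sff L e₁ e₁ q = l₁ q • qi • dL L q (e₁ q) + l₂ q • qj • dL L q (e₁ q)
          + l₃ q • qk • dL L q (e₁ q) ∧
        sff L e₁ e₂ q = m₁ q • qi • dL L q (e₂ q) + m₂ q • qj • dL L q (e₂ q)
          + m₃ q • qk • dL L q (e₂ q) ∧
        sff L e₂ e₂ q = m₁ q • qi • dL L q (e₁ q) + m₂ q • qj • dL L q (e₁ q)
          + m₃ q • qk • dL L q (e₁ q)

end Surface

/-- A Legendre curve in `S⁷ ⊂ H²`, possibly with stationary points: a smooth curve in the unit
sphere with `⟨z', i z⟩ = ⟨z', j z⟩ = ⟨z', k z⟩ = 0`. -/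
structure IsLegendre (z : ℝ → H2) (S : Set ℝ) : Prop where
  smooth : ContDiffOn ℝ ∞ z S
  mem_sphere : ∀ s ∈ S, ‖z s‖ = 1
  legendre : ∀ s ∈ S, PerpIJK (deriv z s) (z s)

/-- A special Legendre curve in `S⁷ ⊂ H²`: a unit speed Legendre curve with
`z'' = i α z' + j β z' + k γ z' - z` for real functions `α`, `β`, `γ`. (In `H²` the vectors
`z, z'` and their multiples by `i, j, k` span, so no further normal fields enter.) -/
structure IsSpecialLegendre (z : ℝ → H2) (S : Set ℝ) : Prop extends IsLegendre z S where
  unit_speed : ∀ s ∈ S, ‖deriv z s‖ = 1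
  special : ∃ α β γ : ℝ → ℝ, ∀ s ∈ S,
    deriv (deriv z) s = im (α s) (β s) (γ s) • deriv z s - z s

section LocalForms

variable {M : Type*} [TopologicalSpace M] [ChartedSpace Plane M]

/-- `e = (x, y)` is a smooth coordinate system of `M` around `p` whose coordinates range over the
rectangle `(a, b) × (c, d)`. -/
structure IsCoordRect [IsManifold (𝓡 2) ∞ M] (e : OpenPartialHomeomorph M Plane) (p : M)
    (a b c d : ℝ) : Prop where
  mem_atlas : e ∈ IsManifold.maximalAtlas (𝓡 2) ∞ M
  mem_source : p ∈ e.source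
  target_eq : e.target = {u : Plane | u 0 ∈ Ioo a b ∧ u 1 ∈ Ioo c d}

variable [IsManifold (𝓡 2) ∞ M]

/-- Around `p`, `L(x, y) = D(x) + c y` for a curve `D` and a constant vector `c`:
a Lagrangian cylinder (when `L` is Lagrangian). -/
def IsCylinderNear (L : M → H2) (p : M) : Prop :=
  ∃ (e : OpenPartialHomeomorph M Plane) (a b a' b' : ℝ) (D : ℝ → H2) (c : H2),
    IsCoordRect e p a b a' b' ∧ ContDiffOn ℝ ∞ D (Ioo a b) ∧
    ∀ q ∈ e.source, L q = D (e q 0) + (e q 1) • c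

/-- Around `p`, `L(x, y) = D(x) + P(x) y` with a special Legendre curve `P`. -/
def IsSpecialRuledNear (L : M → H2) (p : M) : Prop :=
  ∃ (e : OpenPartialHomeomorph M Plane) (a b a' b' : ℝ) (D P : ℝ → H2),
    IsCoordRect e p a b a' b' ∧ ContDiffOn ℝ ∞ D (Ioo a b) ∧ IsSpecialLegendre P (Ioo a b) ∧
    ∀ q ∈ e.source, L q = D (e q 0) + (e q 1) • P (e q 0)

/-- Around `p`, `L(x, y) = D(x) + P(x) y` with a Legendre curve `P` that may have stationary
points. -/
def IsRuledNear (L : M → H2) (p : M) : Prop :=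
  ∃ (e : OpenPartialHomeomorph M Plane) (a b a' b' : ℝ) (D P : ℝ → H2),
    IsCoordRect e p a b a' b' ∧ ContDiffOn ℝ ∞ D (Ioo a b) ∧ IsLegendre P (Ioo a b) ∧
    ∀ q ∈ e.source, L q = D (e q 0) + (e q 1) • P (e q 0)

/-- Around `p`, and up to the translation by `v`, `L(x, y) = f(x) A(y)` with a
quaternion-valued function `f` and a curve `A` in `H²`: a cone over `A` (with vertex `v`). -/
def IsConeNear (L : M → H2) (v : H2) (p : M) : Prop :=
  ∃ (e : OpenPartialHomeomorph M Plane) (a b a' b' : ℝ) (f : ℝ → ℍ[ℝ]) (A : ℝ → H2),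
    IsCoordRect e p a b a' b' ∧ ContDiffOn ℝ ∞ f (Ioo a b) ∧ ContDiffOn ℝ ∞ A (Ioo a' b') ∧
    ∀ q ∈ e.source, L q = f (e q 0) • A (e q 1) + v

end LocalForms

end QLag

end

open Set Bundle
open scoped Manifold ContDiff Quaternion

noncomputable section

namespace QLag

/-! In an adapted orthonormal frame, with E₁, E₂ the images of the frame vectors under dL, the
second fundamental form is encoded by two imaginary quaternions `lam`, `mu` and the Levi-Civita
connection by two real functions `w₁`, `w₂`. Flatness turns the Gauss equation into ⟨lam, mu⟩ =
|mu|², and the Codazzi equations give X₂ lam = w₁(lam − 2 mu), X₂ mu = 3 w₁ mu and a formula for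
X₁(mu + w₂). Differentiating the Gauss equation along X₂ yields 2 w₁|mu|² = 6 w₁|mu|², so w₁ mu = 0
(`w₁_smul_mu`). Then |mu|² solves a homogeneous linear first order system, and its zero set is open
as well as closed. Whether mu vanishes at a point does not depend on the frame, by comparison of the
cubic forms. Hence on the connected surface mu is identically zero or nowhere zero
(`sff_eq_zero_or_ne_zero`).

If mu = 0, the absence of totally geodesic points forces lam ≠ 0, and then w₂ = 0. So E₂ is constant
along the integral curves of X₂, which L maps to straight segments. Transversally the ruling
direction P = E₂ moves by a real multiple of E₁, so it is Legendre. The form dual to X₁ becomes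
closed after multiplication by k exactly when X₂ k = w₁ k, and each solution k gives coordinates: k
= |lam| always works, k = 1 works where w₁ = 0 and makes P constant, k = −w₁ works where w₁ ≠ 0 and
makes P a unit speed special Legendre curve. The points near which w₁ vanishes identically or has no
zero are dense.

If mu has no zero, then w₁ = 0 and the quaternion σ = mu + w₂ satisfies X₁σ = (lam − σ)σ and X₂σ =
0. These two equations say that L − σ⁻¹E₁ is locally constant: its value is the vertex v
(`eventually_eq_vertex`). The vertex is unique at each point, because the line of e₁ is determined
by the cubic form, so by connectedness one v serves all of M. In suitable coordinates N = L − v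
satisfies ∂N/∂x = σ(x)N, a linear equation whose solution is f(x) N(x₀, y) (`UmbFrame.coneForm`). -/

open Filter Topology

/-! ### The quaternionic Hermitian form of H². -/

section Hermitian

/-- The quaternionic Hermitian form of `H²`, linear in the first variable; its real part is the
Euclidean inner product. -/
def herm (u v : H2) : ℍ[ℝ] := u 0 * star (v 0) + u 1 * star (v 1)

theorem inner_eq_herm_re (u v : H2) : inner ℝ u v = (herm u v).re := by
  simp [herm, PiLp.inner_apply, Quaternion.inner_def]

theorem herm_add_left (u v w : H2) : herm (u + v) w = herm u w + herm v w := by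
  simp [herm, add_mul]; abel

theorem herm_sub_left (u v w : H2) : herm (u - v) w = herm u w - herm v w := by
  simp [herm, sub_mul]; abel

theorem herm_neg_left (u v : H2) : herm (-u) v = -herm u v := by
  simp [herm]; abel

theorem herm_rsmul_left (r : ℝ) (u v : H2) : herm (r • u) v = r • herm u v := by
  simp [herm]

theorem herm_smul_left (q : ℍ[ℝ]) (u v : H2) : herm (q • u) v = q * herm u v := by
  simp [herm, mul_add, mul_assoc]

theorem star_herm (u v : H2) : star (herm u v) = herm v u := by
  simp [herm]

theorem coe_smul_H2 (r : ℝ) (u : H2) : (r : ℍ[ℝ]) • u = r • u := by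
  ext i <;> simp

@[simp] theorem re_im (a b c : ℝ) : (im a b c).re = 0 := rfl
@[simp] theorem imI_im (a b c : ℝ) : (im a b c).imI = a := rfl
@[simp] theorem imJ_im (a b c : ℝ) : (im a b c).imJ = b := rfl
@[simp] theorem imK_im (a b c : ℝ) : (im a b c).imK = c := rfl

/-- The products of u with iv, jv, kv are the three imaginary components of `herm u v`, so the
Lagrangian and Legendre conditions both say that a Hermitian product is real. -/
theorem perpIJK_iff (u v : H2) : PerpIJK u v ↔ (herm u v).im = 0 := by
  have key : ∀ q : ℍ[ℝ], inner ℝ u (q • v) = (herm u v * star q).re := fun q => by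
    rw [inner_eq_herm_re, ← star_herm, herm_smul_left, star_mul, star_herm]
  rw [PerpIJK, key, key, key]
  simp [Quaternion.ext_iff, qi, qj, qk]

/-- Quaternionic conjugation as a continuous real-linear map. -/
def starCLM : ℍ[ℝ] →L[ℝ] ℍ[ℝ] :=
  LinearMap.toContinuousLinearMap
    { toFun := star, map_add' := star_add, map_smul' := fun r q => by simp }

/-- The Hermitian form as a continuous real-linear map in its first variable. -/
def hermCLM (v : H2) : H2 →L[ℝ] ℍ[ℝ] :=
  LinearMap.toContinuousLinearMap
    { toFun := fun u => herm u v
      map_add' := fun _ _ => herm_add_left _ _ _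
      map_smul' := fun _ _ => herm_rsmul_left _ _ _ }

@[simp] theorem hermCLM_apply (u v : H2) : hermCLM v u = herm u v := rfl

theorem contDiffOn_herm {E : Type*} [NormedAddCommGroup E] [NormedSpace ℝ E] {V : Set E}
    {f g : E → H2} (hf : ContDiffOn ℝ ∞ f V)
    (hg : ContDiffOn ℝ ∞ g V) : ContDiffOn ℝ ∞ (fun u => herm (f u) (g u)) V := by
  have hf' := fun i => (contDiffOn_piLp 2).1 hf i
  have hg' := fun i => (contDiffOn_piLp 2).1 hg i
  have hs : ∀ i, ContDiffOn ℝ ∞ (fun u => star (g u i)) V := fun i =>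
    starCLM.contDiff.comp_contDiffOn (hg' i)
  exact ((hf' 0).mul (hs 0)).add ((hf' 1).mul (hs 1))

end Hermitian

/-! ### Derivatives along vector fields of the plane. -/

section DirectionalDerivative

variable {F : Type*} [NormedAddCommGroup F] [NormedSpace ℝ F]

/-- The derivative of `f` along the vector field `X`. -/
def dd (X : Plane → Plane) (f : Plane → F) (u : Plane) : F := fderiv ℝ f u (X u)

variable {X Y : Plane → Plane} {V : Set Plane} {u : Plane}

theorem dd_congr {f g : Plane → F} (hV : IsOpen V) (h : EqOn f g V) (hu : u ∈ V) :
    dd X f u = dd X g u := by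
  rw [dd, dd, (h.eventuallyEq_of_mem (hV.mem_nhds hu)).fderiv_eq]

theorem dd_const (c : F) : dd X (fun _ => c) u = 0 := by simp [dd]

theorem dd_add {f g : Plane → F} (hf : DifferentiableAt ℝ f u) (hg : DifferentiableAt ℝ g u) :
    dd X (fun w => f w + g w) u = dd X f u + dd X g u := by
  simp [dd, fderiv_fun_add hf hg]

theorem dd_sub {f g : Plane → F} (hf : DifferentiableAt ℝ f u) (hg : DifferentiableAt ℝ g u) :
    dd X (fun w => f w - g w) u = dd X f u - dd X g u := by
  simp [dd, fderiv_fun_sub hf hg]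

theorem dd_smul {q : Plane → ℍ[ℝ]} {f : Plane → H2} (hq : DifferentiableAt ℝ q u)
    (hf : DifferentiableAt ℝ f u) :
    dd X (fun w => q w • f w) u = q u • dd X f u + dd X q u • f u := by
  simp [dd, fderiv_fun_smul hq hf]

theorem dd_mul {A : Type*} [NormedRing A] [NormedAlgebra ℝ A] {f g : Plane → A}
    (hf : DifferentiableAt ℝ f u) (hg : DifferentiableAt ℝ g u) :
    dd X (fun w => f w * g w) u = f u * dd X g u + dd X f u * g u := by
  simp [dd, fderiv_fun_mul' hf hg]

theorem dd_clm {G : Type*} [NormedAddCommGroup G] [NormedSpace ℝ G] (T : F →L[ℝ] G)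
    {f : Plane → F} (hf : DifferentiableAt ℝ f u) :
    dd X (fun w => T (f w)) u = T (dd X f u) := by
  have := (T.hasFDerivAt.comp u hf.hasFDerivAt).fderiv
  rw [dd, dd, show (fun w => T (f w)) = T ∘ f from rfl, this]
  rfl

theorem dd_rsmul {r : Plane → ℝ} {f : Plane → F} (hr : DifferentiableAt ℝ r u)
    (hf : DifferentiableAt ℝ f u) :
    dd X (fun w => r w • f w) u = r u • dd X f u + dd X r u • f u := by
  simp [dd, fderiv_fun_smul hr hf]

theorem dd_inner {G : Type*} [NormedAddCommGroup G] [InnerProductSpace ℝ G] {f g : Plane → G}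
    (hf : DifferentiableAt ℝ f u) (hg : DifferentiableAt ℝ g u) :
    dd X (fun w => inner ℝ (f w) (g w)) u =
      inner ℝ (f u) (dd X g u) + inner ℝ (dd X f u) (g u) := by
  simp [dd, fderiv_inner_apply ℝ hf hg]

theorem contDiffOn_dd {f : Plane → F} (hV : IsOpen V) (hX : ContDiffOn ℝ ∞ X V)
    (hf : ContDiffOn ℝ ∞ f V) : ContDiffOn ℝ ∞ (dd X f) V :=
  (hf.fderiv_of_isOpen hV (by simp)).clm_apply hX

theorem ContDiffOn.diffAt {f : Plane → F} (hf : ContDiffOn ℝ ∞ f V) (hV : IsOpen V)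
    (hu : u ∈ V) : DifferentiableAt ℝ f u :=
  (hf.contDiffAt (hV.mem_nhds hu)).differentiableAt (by simp)

theorem dd_dd {f : Plane → F} (hV : IsOpen V) (hY : ContDiffOn ℝ ∞ Y V)
    (hf : ContDiffOn ℝ ∞ f V) (hu : u ∈ V) :
    dd X (dd Y f) u = fderiv ℝ (fderiv ℝ f) u (X u) (Y u) + fderiv ℝ f u (dd X Y u) := by
  have h1 : DifferentiableAt ℝ (fderiv ℝ f) u :=
    ContDiffOn.diffAt (hf.fderiv_of_isOpen hV (by simp)) hV hu
  have h2 := ContDiffOn.diffAt hY hV hu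
  rw [dd, show dd Y f = fun w => fderiv ℝ f w (Y w) from rfl, fderiv_clm_apply h1 h2]
  simp [dd, add_comm]

theorem fderiv_fderiv_symm {f : Plane → F} (hV : IsOpen V) (hf : ContDiffOn ℝ ∞ f V)
    (hu : u ∈ V) (v w : Plane) :
    fderiv ℝ (fderiv ℝ f) u v w = fderiv ℝ (fderiv ℝ f) u w v :=
  ((hf.contDiffAt (hV.mem_nhds hu)).isSymmSndFDerivAt
    (by simp only [minSmoothness_of_isRCLikeNormedField]; exact WithTop.coe_le_coe.2 (le_top : (2 : ℕ∞) ≤ ⊤))).eq v w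

/-- The second derivative of f is symmetric and cancels, leaving the derivative along the Lie
bracket of X and Y. -/
theorem dd_dd_sub {f : Plane → F} (hV : IsOpen V) (hX : ContDiffOn ℝ ∞ X V)
    (hY : ContDiffOn ℝ ∞ Y V) (hf : ContDiffOn ℝ ∞ f V) (hu : u ∈ V) :
    dd X (dd Y f) u - dd Y (dd X f) u = fderiv ℝ f u (dd X Y u - dd Y X u) := by
  rw [dd_dd hV hY hf hu, dd_dd hV hX hf hu, fderiv_fderiv_symm hV hf hu, map_sub]
  abel

end DirectionalDerivative

/-! ### Gauss and Codazzi equations of an adapted frame. -/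

section UmbilicalFrame

variable {F : Type*} [NormedAddCommGroup F] [NormedSpace ℝ F]

/-- An adapted frame `X₁, X₂` over `V` of a flat Lagrangian H-umbilical immersion `L` of a plane
domain, with its structure functions: `lam` and `mu` are the imaginary quaternions of the second
fundamental form, `w₁` and `w₂` the coefficients of the Levi-Civita connection. -/
structure UmbFrame (L : Plane → H2) (X₁ X₂ : Plane → Plane) (V : Set Plane)
    (lam mu : Plane → ℍ[ℝ]) (w₁ w₂ : Plane → ℝ) : Prop where
  isOpen : IsOpen V
  smooth : ContDiffOn ℝ ∞ L V
  smooth₁ : ContDiffOn ℝ ∞ X₁ V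
  smooth₂ : ContDiffOn ℝ ∞ X₂ V
  smooth_lam : ContDiffOn ℝ ∞ lam V
  smooth_mu : ContDiffOn ℝ ∞ mu V
  smooth_w₁ : ContDiffOn ℝ ∞ w₁ V
  smooth_w₂ : ContDiffOn ℝ ∞ w₂ V
  lam_re : ∀ u ∈ V, (lam u).re = 0
  mu_re : ∀ u ∈ V, (mu u).re = 0
  gauss : ∀ u ∈ V, inner ℝ (lam u) (mu u) = inner ℝ (mu u) (mu u)
  herm₁₁ : ∀ u ∈ V, herm (dd X₁ L u) (dd X₁ L u) = 1
  herm₂₂ : ∀ u ∈ V, herm (dd X₂ L u) (dd X₂ L u) = 1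
  herm₁₂ : ∀ u ∈ V, herm (dd X₁ L u) (dd X₂ L u) = 0
  dd₁₁ : ∀ u ∈ V, dd X₁ (dd X₁ L) u = lam u • dd X₁ L u + w₁ u • dd X₂ L u
  dd₂₁ : ∀ u ∈ V, dd X₂ (dd X₁ L) u = mu u • dd X₂ L u + w₂ u • dd X₂ L u
  dd₁₂ : ∀ u ∈ V, dd X₁ (dd X₂ L) u = mu u • dd X₂ L u - w₁ u • dd X₁ L u
  dd₂₂ : ∀ u ∈ V, dd X₂ (dd X₂ L) u = mu u • dd X₁ L u - w₂ u • dd X₁ L u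
  bracket : ∀ u ∈ V, dd X₁ X₂ u - dd X₂ X₁ u = -(w₁ u • X₁ u) - w₂ u • X₂ u
  span : ∀ u ∈ V, ∀ v : Plane, ∃ a b : ℝ, v = a • X₁ u + b • X₂ u

namespace UmbFrame

variable {L : Plane → H2} {X₁ X₂ : Plane → Plane} {V : Set Plane}
  {lam mu : Plane → ℍ[ℝ]} {w₁ w₂ : Plane → ℝ} (h : UmbFrame L X₁ X₂ V lam mu w₁ w₂)
  {u : Plane} (hu : u ∈ V)
include h hu

theorem herm₂₁ : herm (dd X₂ L u) (dd X₁ L u) = 0 := by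
  rw [← star_herm, h.herm₁₂ u hu, star_zero]

theorem dd_dd_comm {f : Plane → F} (hf : ContDiffOn ℝ ∞ f V) :
    dd X₁ (dd X₂ f) u - dd X₂ (dd X₁ f) u = -(w₁ u • dd X₁ f u) - w₂ u • dd X₂ f u := by
  rw [dd_dd_sub h.isOpen h.smooth₁ h.smooth₂ hf hu, h.bracket u hu]
  simp [dd]

/-- This is the integrability condition for E₁ = `dd X₁ L`: the bracket identity applied to E₁,
expanded by the structure equations. Its components along E₁ and E₂ are extracted below with the
left-linear form `herm`. -/
theorem codazzi_one :
    mu u • (dd X₁ (dd X₂ L) u) + dd X₁ mu u • dd X₂ L u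
      + (w₂ u • dd X₁ (dd X₂ L) u + dd X₁ w₂ u • dd X₂ L u)
      - (lam u • dd X₂ (dd X₁ L) u + dd X₂ lam u • dd X₁ L u
        + (w₁ u • dd X₂ (dd X₂ L) u + dd X₂ w₁ u • dd X₂ L u))
      = -(w₁ u • dd X₁ (dd X₁ L) u) - w₂ u • dd X₂ (dd X₁ L) u := by
  have hE₁ := contDiffOn_dd h.isOpen h.smooth₁ h.smooth
  have hE₂ := contDiffOn_dd h.isOpen h.smooth₂ h.smooth
  have dE₁ := ContDiffOn.diffAt hE₁ h.isOpen hu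
  have dE₂ := ContDiffOn.diffAt hE₂ h.isOpen hu
  have dl := ContDiffOn.diffAt h.smooth_lam h.isOpen hu
  have dm := ContDiffOn.diffAt h.smooth_mu h.isOpen hu
  have d1 := ContDiffOn.diffAt h.smooth_w₁ h.isOpen hu
  have d2 := ContDiffOn.diffAt h.smooth_w₂ h.isOpen hu
  rw [← h.dd_dd_comm hu hE₁, dd_congr h.isOpen (fun w hw => h.dd₂₁ w hw) hu,
    dd_congr (f := dd X₁ (dd X₁ L)) h.isOpen (fun w hw => h.dd₁₁ w hw) hu,
    dd_add (dm.fun_smul dE₂) (d2.fun_smul dE₂), dd_add (dl.fun_smul dE₁) (d1.fun_smul dE₂),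
    dd_smul dm dE₂, dd_smul dl dE₁, dd_rsmul d2 dE₂, dd_rsmul d1 dE₂]

theorem codazzi_two :
    mu u • (dd X₁ (dd X₁ L) u) + dd X₁ mu u • dd X₁ L u
      - (w₂ u • dd X₁ (dd X₁ L) u + dd X₁ w₂ u • dd X₁ L u)
      - (mu u • dd X₂ (dd X₂ L) u + dd X₂ mu u • dd X₂ L u
        - (w₁ u • dd X₂ (dd X₁ L) u + dd X₂ w₁ u • dd X₁ L u))
      = -(w₁ u • dd X₁ (dd X₂ L) u) - w₂ u • dd X₂ (dd X₂ L) u := by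
  have hE₁ := contDiffOn_dd h.isOpen h.smooth₁ h.smooth
  have hE₂ := contDiffOn_dd h.isOpen h.smooth₂ h.smooth
  have dE₁ := ContDiffOn.diffAt hE₁ h.isOpen hu
  have dE₂ := ContDiffOn.diffAt hE₂ h.isOpen hu
  have dm := ContDiffOn.diffAt h.smooth_mu h.isOpen hu
  have d1 := ContDiffOn.diffAt h.smooth_w₁ h.isOpen hu
  have d2 := ContDiffOn.diffAt h.smooth_w₂ h.isOpen hu
  rw [← h.dd_dd_comm hu hE₂, dd_congr h.isOpen (fun w hw => h.dd₂₂ w hw) hu,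
    dd_congr (f := dd X₁ (dd X₂ L)) h.isOpen (fun w hw => h.dd₁₂ w hw) hu,
    dd_sub (dm.fun_smul dE₁) (d2.fun_smul dE₁), dd_sub (dm.fun_smul dE₂) (d1.fun_smul dE₁),
    dd_smul dm dE₂, dd_smul dm dE₁, dd_rsmul d2 dE₁, dd_rsmul d1 dE₁]

/-- The E₁-component of `codazzi_one`. -/
theorem dd₂_lam : dd X₂ lam u = w₁ u • (lam u - mu u - mu u) := by
  have := congrArg (fun z => herm z (dd X₁ L u)) (h.codazzi_one hu)
  simp only [h.dd₁₁ u hu, h.dd₂₁ u hu, h.dd₁₂ u hu, h.dd₂₂ u hu, herm_add_left, herm_sub_left,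
    herm_smul_left, herm_rsmul_left, h.herm₁₁ u hu, h.herm₂₁ hu, smul_add, smul_sub,
    herm_neg_left] at this
  rw [Quaternion.ext_iff] at this ⊢
  simp at this ⊢
  obtain ⟨h0, h1, h2, h3⟩ := this
  refine ⟨?_, ?_, ?_, ?_⟩ <;> linarith

/-- The E₂-component of `codazzi_two`. The derivative turns out to be zero once `w₁_smul_mu` is
known. -/
theorem dd₂_mu_aux : dd X₂ mu u = (3 * w₁ u) • mu u := by
  have := congrArg (fun z => herm z (dd X₂ L u)) (h.codazzi_two hu)
  simp only [h.dd₁₁ u hu, h.dd₂₁ u hu, h.dd₁₂ u hu, h.dd₂₂ u hu, herm_add_left, herm_sub_left,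
    herm_smul_left, herm_rsmul_left, h.herm₂₂ u hu, h.herm₁₂ u hu, smul_add, smul_sub,
    herm_neg_left] at this
  rw [Quaternion.ext_iff] at this ⊢
  simp at this ⊢
  obtain ⟨h0, h1, h2, h3⟩ := this
  refine ⟨?_, ?_, ?_, ?_⟩ <;> linarith

/-- The E₂-component of `codazzi_one`. Joining the imaginary mu and the real w₂ into one quaternion
gives the equation a Riccati shape; its real part carries the curvature equation and its imaginary
part a Codazzi equation. -/
theorem dd₁_mu_add_w₂ : dd X₁ mu u + ((dd X₁ w₂ u : ℝ) : ℍ[ℝ]) =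
    lam u * (mu u + (w₂ u : ℍ[ℝ])) - (mu u + (w₂ u : ℍ[ℝ])) * (mu u + (w₂ u : ℍ[ℝ]))
      + ((dd X₂ w₁ u - w₁ u * w₁ u : ℝ) : ℍ[ℝ]) := by
  have := congrArg (fun z => herm z (dd X₂ L u)) (h.codazzi_one hu)
  simp only [h.dd₁₁ u hu, h.dd₂₁ u hu, h.dd₁₂ u hu, h.dd₂₂ u hu, herm_add_left, herm_sub_left,
    herm_smul_left, herm_rsmul_left, h.herm₂₂ u hu, h.herm₁₂ u hu, smul_add, smul_sub,
    herm_neg_left] at this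
  rw [Quaternion.ext_iff] at this ⊢
  simp [mul_add, add_mul] at this ⊢
  obtain ⟨h0, h1, h2, h3⟩ := this
  refine ⟨?_, ?_, ?_, ?_⟩ <;> linarith

/-- Differentiating ⟨lam, mu⟩ = |mu|² along X₂ gives 2 w₁|mu|² on the left and 6 w₁|mu|² on the
right. -/
theorem w₁_smul_mu : w₁ u • mu u = 0 := by
  have dl := ContDiffOn.diffAt h.smooth_lam h.isOpen hu
  have dm := ContDiffOn.diffAt h.smooth_mu h.isOpen hu
  have := dd_congr (X := X₂) h.isOpen (fun w hw => h.gauss w hw) hu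
  rw [dd_inner dl dm, dd_inner dm dm, h.dd₂_lam hu, h.dd₂_mu_aux hu] at this
  have hg := h.gauss u hu
  simp only [inner_smul_left, inner_smul_right, inner_sub_left, hg] at this
  simp at this
  have : w₁ u * ‖mu u‖ ^ 2 = 0 := by linarith
  rcases mul_eq_zero.1 this with h0 | h0
  · simp [h0]
  · simp [norm_eq_zero.1 (pow_eq_zero_iff (two_ne_zero) |>.1 h0)]

theorem dd₂_mu : dd X₂ mu u = 0 := by
  rw [h.dd₂_mu_aux hu, mul_smul, h.w₁_smul_mu hu, smul_zero]

theorem dd₂_normSq_mu : dd X₂ (fun w => inner ℝ (mu w) (mu w)) u = 0 := by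
  have dm := ContDiffOn.diffAt h.smooth_mu h.isOpen hu
  rw [dd_inner dm dm, h.dd₂_mu hu]; simp

theorem dd₁_mu_re : (dd X₁ mu u).re = 0 := by
  have dm := ContDiffOn.diffAt h.smooth_mu h.isOpen hu
  have h1 := dd_inner (X := X₁) (differentiableAt_const (x := u) (1 : ℍ[ℝ])) dm
  rw [dd_congr (g := fun _ => (0 : ℝ)) h.isOpen
    (fun w hw => by simp [Quaternion.inner_def, h.mu_re w hw]) hu] at h1
  simpa [dd_const, Quaternion.inner_def] using h1.symm

/-- In the product of mu with `dd₁_mu_add_w₂` the quaternionic products drop out because lam and mu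
are imaginary. The rest is w₂⟨lam, mu⟩ − 2 w₂|mu|², which the Gauss equation reduces to −w₂|mu|². -/
theorem dd₁_normSq_mu : dd X₁ (fun w => inner ℝ (mu w) (mu w)) u =
    -2 * w₂ u * inner ℝ (mu u) (mu u) := by
  have dm := ContDiffOn.diffAt h.smooth_mu h.isOpen hu
  have hr := h.dd₁_mu_re hu
  have hm := h.mu_re u hu
  have hl := h.lam_re u hu
  have hg := h.gauss u hu
  have := h.dd₁_mu_add_w₂ hu
  rw [Quaternion.ext_iff] at this
  rw [dd_inner dm dm]
  have hn : ‖mu u‖ ^ 2 = (mu u).imI * (mu u).imI + (mu u).imJ * (mu u).imJ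
      + (mu u).imK * (mu u).imK := by
    rw [← real_inner_self_eq_norm_sq, Quaternion.inner_def]; simp [hm]
  simp [Quaternion.inner_def, hr, hm, hl, hn] at this hg ⊢
  obtain ⟨h0, h1, h2, h3⟩ := this
  rw [h1, h2, h3]
  linear_combination (2 * w₂ u) * hg

end UmbFrame

end UmbilicalFrame

/-! ### The alternative mu = 0 or mu ≠ 0 and its consequences for the structure functions. -/

section UmbilicalFrame

variable {F : Type*} [NormedAddCommGroup F] [NormedSpace ℝ F]

theorem norm_mul_dd_norm {X : Plane → Plane} {q : Plane → ℍ[ℝ]} {u : Plane}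
    (hq : DifferentiableAt ℝ q u) (h0 : q u ≠ 0) :
    ‖q u‖ * dd X (fun w => ‖q w‖) u = inner ℝ (q u) (dd X q u) := by
  have hn := hq.norm ℝ h0
  have h1 := dd_inner (X := X) hq hq
  have h2 := dd_mul (X := X) hn hn
  have : (fun w => inner ℝ (q w) (q w)) = fun w => ‖q w‖ * ‖q w‖ := by
    ext w; rw [real_inner_self_eq_norm_mul_norm]
  rw [this, h2, real_inner_comm (q u)] at h1
  linarith

namespace UmbFrame

variable {L : Plane → H2} {X₁ X₂ : Plane → Plane} {V : Set Plane}
  {lam mu : Plane → ℍ[ℝ]} {w₁ w₂ : Plane → ℝ} (h : UmbFrame L X₁ X₂ V lam mu w₁ w₂)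
  {u : Plane} (hu : u ∈ V)
include h

theorem mono {V' : Set Plane} (hV' : IsOpen V') (hs : V' ⊆ V) :
    UmbFrame L X₁ X₂ V' lam mu w₁ w₂ where
  isOpen := hV'
  smooth := h.smooth.mono hs
  smooth₁ := h.smooth₁.mono hs
  smooth₂ := h.smooth₂.mono hs
  smooth_lam := h.smooth_lam.mono hs
  smooth_mu := h.smooth_mu.mono hs
  smooth_w₁ := h.smooth_w₁.mono hs
  smooth_w₂ := h.smooth_w₂.mono hs
  lam_re u hu := h.lam_re u (hs hu)
  mu_re u hu := h.mu_re u (hs hu)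
  gauss u hu := h.gauss u (hs hu)
  herm₁₁ u hu := h.herm₁₁ u (hs hu)
  herm₂₂ u hu := h.herm₂₂ u (hs hu)
  herm₁₂ u hu := h.herm₁₂ u (hs hu)
  dd₁₁ u hu := h.dd₁₁ u (hs hu)
  dd₂₁ u hu := h.dd₂₁ u (hs hu)
  dd₁₂ u hu := h.dd₁₂ u (hs hu)
  dd₂₂ u hu := h.dd₂₂ u (hs hu)
  bracket u hu := h.bracket u (hs hu)
  span u hu := h.span u (hs hu)

theorem smooth_dd₁ : ContDiffOn ℝ ∞ (dd X₁ L) V := contDiffOn_dd h.isOpen h.smooth₁ h.smooth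

theorem smooth_dd₂ : ContDiffOn ℝ ∞ (dd X₂ L) V := contDiffOn_dd h.isOpen h.smooth₂ h.smooth

include hu

theorem inner₁₁ : inner ℝ (dd X₁ L u) (dd X₁ L u) = (1 : ℝ) := by
  rw [inner_eq_herm_re, h.herm₁₁ u hu]; rfl

theorem inner₂₂ : inner ℝ (dd X₂ L u) (dd X₂ L u) = (1 : ℝ) := by
  rw [inner_eq_herm_re, h.herm₂₂ u hu]; rfl

theorem inner₁₂ : inner ℝ (dd X₁ L u) (dd X₂ L u) = (0 : ℝ) := by
  rw [inner_eq_herm_re, h.herm₁₂ u hu]; rfl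

/-- The images of X₁, X₂ under dL are orthonormal, so the coefficients of v can be read off in H².
-/
theorem eq_combination (v : Plane) :
    v = (inner ℝ (dd X₁ L u) (fderiv ℝ L u v) : ℝ) • X₁ u
      + (inner ℝ (dd X₂ L u) (fderiv ℝ L u v) : ℝ) • X₂ u := by
  obtain ⟨a, b, rfl⟩ := h.span u hu v
  have e1 : fderiv ℝ L u (a • X₁ u + b • X₂ u) = a • dd X₁ L u + b • dd X₂ L u := by simp [dd]
  have h21 := h.inner₁₂ hu
  rw [real_inner_comm] at h21
  rw [e1]
  simp only [inner_add_right, inner_smul_right, h.inner₁₁ hu, h.inner₂₂ hu, h.inner₁₂ hu, h21]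
  simp

theorem fderiv_eq (f : Plane → F) (v : Plane) :
    fderiv ℝ f u v = (inner ℝ (dd X₁ L u) (fderiv ℝ L u v) : ℝ) • dd X₁ f u
      + (inner ℝ (dd X₂ L u) (fderiv ℝ L u v) : ℝ) • dd X₂ f u := by
  conv_lhs => rw [h.eq_combination hu v]
  simp [dd]

theorem fderiv_eq_zero {f : Plane → F} (h1 : dd X₁ f u = 0) (h2 : dd X₂ f u = 0) :
    fderiv ℝ f u = 0 := by
  ext1 v; rw [h.fderiv_eq hu, h1, h2]; simp

/-- Along each segment issuing from u the function |mu|² satisfies m' = K m with K continuous, hence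
bounded, so a zero initial value propagates by Grönwall. -/
theorem eventually_mu_eq_zero (h0 : mu u = 0) : ∀ᶠ w in 𝓝 u, mu w = 0 := by
  obtain ⟨r, hr, hball⟩ := Metric.isOpen_iff.1 h.isOpen u hu
  filter_upwards [Metric.ball_mem_nhds u hr] with w hw
  set m : Plane → ℝ := fun w => inner ℝ (mu w) (mu w) with hm
  have hmem : ∀ t ∈ Icc (0 : ℝ) 1, u + t • (w - u) ∈ V := fun t ht =>
    hball ((convex_ball u r).add_smul_sub_mem (Metric.mem_ball_self hr) hw ht)
  -- Only the X₁-part of the direction w − u contributes, since |mu|² is constant along X₂.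
  set K : ℝ → ℝ := fun t => -2 * w₂ (u + t • (w - u)) *
    inner ℝ (dd X₁ L (u + t • (w - u))) (fderiv ℝ L (u + t • (w - u)) (w - u)) with hK
  have hγ : Continuous fun t : ℝ => u + t • (w - u) := by fun_prop
  have hKc : ContinuousOn K (Icc 0 1) := by
    have c1 := h.smooth_w₂.continuousOn.comp hγ.continuousOn hmem
    have c2 := h.smooth_dd₁.continuousOn.comp hγ.continuousOn hmem
    have c3 := (h.smooth.fderiv_of_isOpen h.isOpen (m := ∞) (by simp)).continuousOn.comp
      hγ.continuousOn hmem
    exact (continuousOn_const.mul c1).mul (c2.inner (c3.clm_apply continuousOn_const))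
  obtain ⟨C, hC⟩ := isCompact_Icc.exists_bound_of_continuousOn hKc
  have hder : ∀ t ∈ Icc (0 : ℝ) 1,
      HasDerivAt (fun t : ℝ => m (u + t • (w - u))) (K t * m (u + t • (w - u))) t := by
    intro t ht
    have dm := ContDiffOn.diffAt h.smooth_mu h.isOpen (hmem t ht)
    have h1 : HasDerivAt (fun t : ℝ => u + t • (w - u)) (w - u) t := by
      simpa using ((hasDerivAt_id t).smul_const (w - u)).const_add u
    have h2 := (dm.inner ℝ dm).hasFDerivAt.comp_hasDerivAt t h1
    rw [h.fderiv_eq (hmem t ht), h.dd₁_normSq_mu (hmem t ht), h.dd₂_normSq_mu (hmem t ht)] at h2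
    refine h2.congr_deriv ?_
    simp [hK, hm]; ring
  have key := eq_zero_of_abs_deriv_le_mul_abs_self_of_eq_zero_right (K := C)
    (f := fun t : ℝ => m (u + t • (w - u))) (a := 0) (b := 1)
    (fun t ht => (hder t ht).continuousAt.continuousWithinAt)
    (fun t ht => (hder t ⟨ht.1, ht.2.le⟩).hasDerivWithinAt) (by simp [hm, h0])
    (fun t ht => by
      rw [norm_mul]
      exact mul_le_mul_of_nonneg_right (hC t ⟨ht.1, ht.2.le⟩) (norm_nonneg _)) 1 (by simp)
  simpa [hm] using key

theorem dd₂_norm_lam (h0 : ∀ w ∈ V, mu w = 0) (hl : lam u ≠ 0) :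
    dd X₂ (fun w => ‖lam w‖) u = w₁ u * ‖lam u‖ := by
  have h1 := norm_mul_dd_norm (X := X₂) (ContDiffOn.diffAt h.smooth_lam h.isOpen hu) hl
  rw [h.dd₂_lam hu, h0 u hu, sub_zero, sub_zero, inner_smul_right,
    real_inner_self_eq_norm_mul_norm] at h1
  have : ‖lam u‖ ≠ 0 := norm_ne_zero_iff.2 hl
  apply mul_left_cancel₀ this
  linarith

/-- With mu = 0 the imaginary part of `dd₁_mu_add_w₂` reads w₂ lam = 0. -/
theorem w₂_eq_zero (h0 : ∀ w ∈ V, mu w = 0) (hl : lam u ≠ 0) : w₂ u = 0 := by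
  have h1 := h.dd₁_mu_add_w₂ hu
  rw [dd_congr (g := fun _ => 0) h.isOpen (fun w hw => h0 w hw) hu, dd_const, h0 u hu] at h1
  rw [Quaternion.ext_iff] at h1
  simp at h1
  obtain ⟨-, h1, h2, h3⟩ := h1
  by_contra hw
  exact hl (Quaternion.ext_iff.2 ⟨h.lam_re u hu, h1.resolve_right hw, h2.resolve_right hw,
    h3.resolve_right hw⟩)

/-- The real part of `dd₁_mu_add_w₂` once mu and w₂ vanish. It makes −w₁ an admissible factor k in
X₂ k = w₁ k. -/
theorem dd₂_w₁ (h0 : ∀ w ∈ V, mu w = 0) (hl : ∀ w ∈ V, lam w ≠ 0) :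
    dd X₂ w₁ u = w₁ u * w₁ u := by
  have h1 := h.dd₁_mu_add_w₂ hu
  rw [dd_congr (g := fun _ => 0) h.isOpen (fun w hw => h0 w hw) hu, dd_const, h0 u hu,
    dd_congr (g := fun _ => 0) h.isOpen (fun w hw => h.w₂_eq_zero hw h0 (hl w hw)) hu, dd_const,
    h.w₂_eq_zero hu h0 (hl u hu)] at h1
  have := congrArg (fun q : ℍ[ℝ] => q.re) h1
  simp at this
  linarith

theorem w₁_eq_zero (h0 : mu u ≠ 0) : w₁ u = 0 :=
  (smul_eq_zero.1 (h.w₁_smul_mu hu)).resolve_right h0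

theorem dd₁_norm_mu (h0 : mu u ≠ 0) : dd X₁ (fun w => ‖mu w‖) u = -(w₂ u * ‖mu u‖) := by
  have dm := ContDiffOn.diffAt h.smooth_mu h.isOpen hu
  have h1 := norm_mul_dd_norm (X := X₁) dm h0
  have h2 := h.dd₁_normSq_mu hu
  rw [dd_inner dm dm, real_inner_comm (mu u), real_inner_self_eq_norm_mul_norm] at h2
  have : ‖mu u‖ ≠ 0 := norm_ne_zero_iff.2 h0
  apply mul_left_cancel₀ this
  linarith

theorem dd₂_norm_mu (h0 : mu u ≠ 0) : dd X₂ (fun w => ‖mu w‖) u = 0 := by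
  have dm := ContDiffOn.diffAt h.smooth_mu h.isOpen hu
  have h1 := norm_mul_dd_norm (X := X₂) dm h0
  rw [h.dd₂_mu hu, inner_zero_right] at h1
  exact (mul_eq_zero.1 h1).resolve_left (norm_ne_zero_iff.2 h0)

/-- The bracket identity for |mu| is used: X₂|mu| = 0 and w₁ = 0 leave X₂(w₂|mu|) = 0. -/
theorem dd₂_w₂ (h0 : ∀ w ∈ V, mu w ≠ 0) : dd X₂ w₂ u = 0 := by
  have hn : ContDiffOn ℝ ∞ (fun w => ‖mu w‖) V := h.smooth_mu.norm ℝ h0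
  have h1 := h.dd_dd_comm hu hn
  have dn := ContDiffOn.diffAt hn h.isOpen hu
  have dw := ContDiffOn.diffAt h.smooth_w₂ h.isOpen hu
  rw [dd_congr (g := fun _ => 0) h.isOpen (fun w hw => h.dd₂_norm_mu hw (h0 w hw)) hu,
    h.w₁_eq_zero hu (h0 u hu), dd_const, h.dd₂_norm_mu hu (h0 u hu),
    dd_congr (f := dd X₁ _) (g := fun w => (-w₂ w) * ‖mu w‖) h.isOpen
      (fun w hw => by rw [h.dd₁_norm_mu hw (h0 w hw)]; ring) hu,
    dd_mul dw.fun_neg dn, h.dd₂_norm_mu hu (h0 u hu)] at h1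
  have h2 : dd X₂ (fun w => -w₂ w) u = -dd X₂ w₂ u := by simp [dd]
  rw [h2] at h1
  have : ‖mu u‖ ≠ 0 := norm_ne_zero_iff.2 (h0 u hu)
  simpa [h0 u hu] using h1

end UmbFrame

/-- The reciprocal of the (quaternionic) distance to the vertex of a cone. -/
def coneCoeff (mu : Plane → ℍ[ℝ]) (w₂ : Plane → ℝ) (u : Plane) : ℍ[ℝ] := mu u + (w₂ u : ℍ[ℝ])

theorem dd_coe {X : Plane → Plane} {r : Plane → ℝ} {u : Plane} (hr : DifferentiableAt ℝ r u) :
    dd X (fun w => (r w : ℍ[ℝ])) u = ((dd X r u : ℝ) : ℍ[ℝ]) :=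
  dd_clm (X := X) (Algebra.linearMap ℝ ℍ[ℝ]).toContinuousLinearMap hr

namespace UmbFrame

variable {L : Plane → H2} {X₁ X₂ : Plane → Plane} {V : Set Plane}
  {lam mu : Plane → ℍ[ℝ]} {w₁ w₂ : Plane → ℝ} (h : UmbFrame L X₁ X₂ V lam mu w₁ w₂)
  (h0 : ∀ w ∈ V, mu w ≠ 0) {u : Plane} (hu : u ∈ V)
include h

theorem smooth_coneCoeff : ContDiffOn ℝ ∞ (coneCoeff mu w₂) V :=
  h.smooth_mu.add
    ((Algebra.linearMap ℝ ℍ[ℝ]).toContinuousLinearMap.contDiff.comp_contDiffOn h.smooth_w₂)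

include h0 hu

theorem coneCoeff_ne_zero : coneCoeff mu w₂ u ≠ 0 := by
  intro hc
  apply h0 u hu
  rw [coneCoeff, Quaternion.ext_iff] at hc
  simp at hc
  exact Quaternion.ext_iff.2 ⟨h.mu_re u hu, hc.2⟩

theorem dd₁_coneCoeff : dd X₁ (coneCoeff mu w₂) u =
    lam u * coneCoeff mu w₂ u - coneCoeff mu w₂ u * coneCoeff mu w₂ u := by
  have dm := ContDiffOn.diffAt h.smooth_mu h.isOpen hu
  have dw := ContDiffOn.diffAt h.smooth_w₂ h.isOpen hu
  have dc : DifferentiableAt ℝ (fun w => (w₂ w : ℍ[ℝ])) u :=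
    (Algebra.linearMap ℝ ℍ[ℝ]).toContinuousLinearMap.differentiableAt.comp u dw
  have := h.dd₁_mu_add_w₂ hu
  rw [dd_congr (f := w₁) (g := fun _ => 0) h.isOpen (fun w hw => h.w₁_eq_zero hw (h0 w hw)) hu,
    dd_const, h.w₁_eq_zero hu (h0 u hu)] at this
  rw [show coneCoeff mu w₂ = fun w => mu w + (w₂ w : ℍ[ℝ]) from rfl, dd_add dm dc, dd_coe dw, this]
  simp

theorem dd₂_coneCoeff : dd X₂ (coneCoeff mu w₂) u = 0 := by
  have dm := ContDiffOn.diffAt h.smooth_mu h.isOpen hu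
  have dw := ContDiffOn.diffAt h.smooth_w₂ h.isOpen hu
  have dc : DifferentiableAt ℝ (fun w => (w₂ w : ℍ[ℝ])) u :=
    (Algebra.linearMap ℝ ℍ[ℝ]).toContinuousLinearMap.differentiableAt.comp u dw
  rw [show coneCoeff mu w₂ = fun w => mu w + (w₂ w : ℍ[ℝ]) from rfl, dd_add dm dc, dd_coe dw,
    h.dd₂_mu hu, h.dd₂_w₂ hu h0]
  simp

end UmbFrame

end UmbilicalFrame

/-! ### The vertex, and the comparison of two adapted frames through the cubic form. -/

theorem bilin_combination {E F : Type*} [NormedAddCommGroup E] [NormedSpace ℝ E]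
    [NormedAddCommGroup F] [NormedSpace ℝ F] (B : E →L[ℝ] E →L[ℝ] F) (x y : E)
    (v₁ v₂ w₁ w₂ : ℝ) :
    B (v₁ • x + v₂ • y) (w₁ • x + w₂ • y) = (v₁ * w₁) • B x x + (v₁ * w₂) • B x y
      + (v₂ * w₁) • B y x + (v₂ * w₂) • B y y := by
  simp only [map_add, map_smul, add_apply, smul_apply, smul_add, smul_smul]
  abel_nf
  module

namespace UmbFrame

variable {L : Plane → H2} {X₁ X₂ : Plane → Plane} {V : Set Plane}
  {lam mu : Plane → ℍ[ℝ]} {w₁ w₂ : Plane → ℝ} (h : UmbFrame L X₁ X₂ V lam mu w₁ w₂)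
include h

/-- For σ = `coneCoeff mu w₂` both frame derivatives of L − σ⁻¹E₁ vanish: along X₁ by the Riccati
equation for σ, along X₂ because σ is constant there and X₂E₁ = σE₂. On a ball the difference is
therefore constant. -/
theorem eventually_eq_vertex (h0 : ∀ w ∈ V, mu w ≠ 0) {u : Plane} (hu : u ∈ V) :
    ∃ v : H2, ∀ᶠ w in 𝓝 u, L w - v = (coneCoeff mu w₂ w)⁻¹ • dd X₁ L w := by
  obtain ⟨r, hr, hball⟩ := Metric.isOpen_iff.1 h.isOpen u hu
  have dσ : ∀ w ∈ V, DifferentiableAt ℝ (coneCoeff mu w₂) w := fun w hw =>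
    ContDiffOn.diffAt h.smooth_coneCoeff h.isOpen hw
  have ds : ∀ w ∈ V, DifferentiableAt ℝ (fun w => (coneCoeff mu w₂ w)⁻¹) w := fun w hw =>
    (dσ w hw).fun_inv (h.coneCoeff_ne_zero h0 hw)
  have dE : ∀ w ∈ V, DifferentiableAt ℝ (dd X₁ L) w := fun w hw =>
    ContDiffOn.diffAt h.smooth_dd₁ h.isOpen hw
  have dL' : ∀ w ∈ V, DifferentiableAt ℝ L w := fun w hw =>
    ContDiffOn.diffAt h.smooth h.isOpen hw
  have hinv : ∀ w ∈ V, ∀ X : Plane → Plane, dd X (fun w => (coneCoeff mu w₂ w)⁻¹) w =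
      -((coneCoeff mu w₂ w)⁻¹ * dd X (coneCoeff mu w₂) w * (coneCoeff mu w₂ w)⁻¹) := by
    intro w hw X
    have h1 := dd_mul (X := X) (ds w hw) (dσ w hw)
    rw [dd_congr (g := fun _ => 1) h.isOpen
      (fun w hw => inv_mul_cancel₀ (h.coneCoeff_ne_zero h0 hw)) hw, dd_const] at h1
    rw [← neg_mul, eq_mul_inv_iff_mul_eq₀ (h.coneCoeff_ne_zero h0 hw)]
    exact eq_neg_of_add_eq_zero_right h1.symm
  obtain ⟨v, hv⟩ := Metric.isOpen_ball.exists_is_const_of_fderiv_eq_zero (𝕜 := ℝ)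
    (f := fun w => L w - (coneCoeff mu w₂ w)⁻¹ • dd X₁ L w) (convex_ball u r).isPreconnected
    (fun w hw => ((dL' w (hball hw)).fun_sub
      ((ds w (hball hw)).fun_smul (dE w (hball hw)))).differentiableWithinAt)
    (fun w hw => by
      have hw' := hball hw
      have hσ := h.coneCoeff_ne_zero h0 hw'
      apply h.fderiv_eq_zero hw'
      · rw [dd_sub (dL' w hw') ((ds w hw').fun_smul (dE w hw')), dd_smul (ds w hw') (dE w hw'),
          hinv w hw', h.dd₁_coneCoeff h0 hw', h.dd₁₁ w hw', h.w₁_eq_zero hw' (h0 w hw'), smul_add,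
          smul_smul, zero_smul, smul_zero, add_zero, ← add_smul, mul_sub, sub_mul]
        rw [← mul_assoc, ← mul_assoc, inv_mul_cancel₀ hσ, mul_inv_cancel_right₀ hσ, one_mul,
          mul_inv_cancel₀ hσ, neg_sub, add_sub_cancel, one_smul, sub_self]
      · rw [dd_sub (dL' w hw') ((ds w hw').fun_smul (dE w hw')), dd_smul (ds w hw') (dE w hw'),
          hinv w hw', h.dd₂_coneCoeff h0 hw', h.dd₂₁ w hw', ← coe_smul_H2, ← add_smul, smul_smul,
          mul_zero, zero_mul, neg_zero, zero_smul, add_zero]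
        rw [show mu w + (w₂ w : ℍ[ℝ]) = coneCoeff mu w₂ w from rfl, inv_mul_cancel₀ hσ, one_smul,
          sub_self])
  refine ⟨v, ?_⟩
  filter_upwards [Metric.ball_mem_nhds u hr] with w hw
  rw [← hv w hw]; abel

/-- This is the uniqueness of the vertex, c being the difference of two candidates. If c = tE₁, the
E₂-component of the X₂-derivative is tσ = 0, with σ invertible. -/
theorem eq_zero_of_eventually_smul_dd₁ (h0 : ∀ w ∈ V, mu w ≠ 0) {u : Plane} (hu : u ∈ V) {c : H2}
    (hc : ∀ᶠ w in 𝓝 u, ∃ t : ℍ[ℝ], c = t • dd X₁ L w) : c = 0 := by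
  set t : Plane → ℍ[ℝ] := fun w => herm c (dd X₁ L w) with ht
  obtain ⟨V', hV', hV'o, huV'⟩ := eventually_nhds_iff.1 (hc.and (h.isOpen.mem_nhds hu))
  have h' := h.mono hV'o (fun w hw => (hV' w hw).2)
  have hct : ∀ w ∈ V', c = t w • dd X₁ L w := by
    intro w hw
    obtain ⟨s, hs⟩ := (hV' w hw).1
    rw [ht]
    dsimp only
    conv_rhs => rw [hs, herm_smul_left, h'.herm₁₁ w hw, mul_one]
    exact hs
  have dt := ContDiffOn.diffAt (contDiffOn_herm contDiffOn_const h'.smooth_dd₁ (f := fun _ => c))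
    hV'o huV'
  have dE := ContDiffOn.diffAt h'.smooth_dd₁ hV'o huV'
  have h1 := dd_congr (X := X₂) hV'o (f := fun _ => c) hct huV'
  rw [dd_const, dd_smul dt dE, h.dd₂₁ u hu, ← coe_smul_H2, ← add_smul, smul_smul] at h1
  have h2 := congrArg (fun z => herm z (dd X₂ L u)) h1
  simp only [herm_add_left, herm_smul_left, h.herm₂₂ u hu, h.herm₁₂ u hu, mul_zero, add_zero,
    mul_one] at h2
  rw [show herm 0 (dd X₂ L u) = 0 by simp [herm]] at h2
  have h3 := (mul_eq_zero.1 h2.symm).resolve_right (h.coneCoeff_ne_zero h0 hu)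
  rw [hct u huV', show t u = 0 from h3, zero_smul]

/-- The imaginary part of the Hermitian product of the second derivative of `L` with the
differential of `L` in an adapted frame: the cubic form of the Lagrangian immersion. -/
theorem cubicForm_eq {u : Plane} (hu : u ∈ V) (v₁ v₂ w₁' w₂' z₁ z₂ : ℝ) :
    (herm (fderiv ℝ (fderiv ℝ L) u (v₁ • X₁ u + v₂ • X₂ u) (w₁' • X₁ u + w₂' • X₂ u))
      (fderiv ℝ L u (z₁ • X₁ u + z₂ • X₂ u))).im =
      (v₁ * w₁' * z₁) • lam u + (v₁ * w₂' * z₂ + v₂ * w₁' * z₂ + v₂ * w₂' * z₁) • mu u := by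
  have hD : ∀ x y z : Plane, ∀ a b : ℝ, a • X₁ u + b • X₂ u = z →
      herm (fderiv ℝ (fderiv ℝ L) u x y) (fderiv ℝ L u z) =
      a • herm (fderiv ℝ (fderiv ℝ L) u x y) (dd X₁ L u) +
      b • herm (fderiv ℝ (fderiv ℝ L) u x y) (dd X₂ L u) := by
    rintro x y z a b rfl
    simp [herm, dd, mul_add]
    abel
  have hreal : ∀ z : Plane, (herm (fderiv ℝ L u z) (dd X₁ L u)).im = 0 ∧
      (herm (fderiv ℝ L u z) (dd X₂ L u)).im = 0 := by
    intro z
    obtain ⟨a, b, rfl⟩ := h.span u hu z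
    have : fderiv ℝ L u (a • X₁ u + b • X₂ u) = a • dd X₁ L u + b • dd X₂ L u := by simp [dd]
    rw [this]
    simp [herm_add_left, herm_rsmul_left, h.herm₁₁ u hu, h.herm₂₂ u hu, h.herm₁₂ u hu, h.herm₂₁ hu]
  have him : ∀ q : ℍ[ℝ], q.re = 0 → q.im = q := fun q hq => by
    conv_rhs => rw [← Quaternion.re_add_im q, hq]
    simp
  have hl := him _ (h.lam_re u hu)
  have hm := him _ (h.mu_re u hu)
  have e11 := dd_dd (X := X₁) h.isOpen h.smooth₁ h.smooth hu
  have e12 := dd_dd (X := X₁) h.isOpen h.smooth₂ h.smooth hu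
  have e21 := dd_dd (X := X₂) h.isOpen h.smooth₁ h.smooth hu
  have e22 := dd_dd (X := X₂) h.isOpen h.smooth₂ h.smooth hu
  rw [h.dd₁₁ u hu, ← sub_eq_iff_eq_add] at e11
  rw [h.dd₁₂ u hu, ← sub_eq_iff_eq_add] at e12
  rw [h.dd₂₁ u hu, ← sub_eq_iff_eq_add] at e21
  rw [h.dd₂₂ u hu, ← sub_eq_iff_eq_add] at e22
  rw [hD _ _ _ z₁ z₂ rfl, bilin_combination]
  simp only [← e11, ← e12, ← e21, ← e22, herm_add_left, herm_sub_left, herm_rsmul_left, herm_smul_left,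
    h.herm₁₁ u hu, h.herm₂₂ u hu, h.herm₁₂ u hu, h.herm₂₁ hu, Quaternion.im_add, Quaternion.im_sub,
    Quaternion.im_smul, (hreal _).1, (hreal _).2, mul_one, mul_zero, smul_zero, hl, hm,
    Quaternion.im_zero, Quaternion.im_one]
  module

variable {X₁' X₂' : Plane → Plane} {V' : Set Plane} {lam' mu' : Plane → ℍ[ℝ]} {w₁' w₂' : Plane → ℝ}
  (h' : UmbFrame L X₁' X₂' V' lam' mu' w₁' w₂') {u : Plane} (hu : u ∈ V) (hu' : u ∈ V')
include h' hu hu'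

/-- With mu = 0 the cubic form is lam times the cube of the first coordinate. It vanishes on (e₂',
e₂', e₂'), so lam = 0 or e₂' has no X₁-part; either way its value mu' on (e₁', e₂', e₂') is zero. -/
theorem mu_eq_zero_of_mu_eq_zero (h0 : mu u = 0) : mu' u = 0 := by
  obtain ⟨a, b, hab⟩ := h.span u hu (X₁' u)
  obtain ⟨c, d, hcd⟩ := h.span u hu (X₂' u)
  have e1 := h'.cubicForm_eq hu' 1 0 0 1 0 1
  have e2 := h'.cubicForm_eq hu' 0 1 0 1 0 1
  simp only [zero_smul, one_smul, zero_add, add_zero, mul_zero, mul_one] at e1 e2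
  rw [hab, hcd, h.cubicForm_eq hu, h0, smul_zero, add_zero] at e1
  rw [hcd, h.cubicForm_eq hu, h0, smul_zero, add_zero] at e2
  rcases smul_eq_zero.1 e2 with hc | hl
  · rw [← e1, show c = 0 by simpa using hc]; simp
  · rw [← e1, hl, smul_zero]

/-- For X₂' = cX₁ + dX₂ the vanishing of the cubic form on X₂', paired with mu, gives c(c² +
3d²)|mu|² = 0 by the Gauss equation. So c = 0, and orthogonality makes X₁' a multiple of X₁. -/
theorem exists_dd₁_eq_smul (h0 : mu u ≠ 0) : ∃ a : ℝ, dd X₁' L u = a • dd X₁ L u := by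
  obtain ⟨a, b, hab⟩ := h.span u hu (X₁' u)
  obtain ⟨c, d, hcd⟩ := h.span u hu (X₂' u)
  have e2 := h'.cubicForm_eq hu' 0 1 0 1 0 1
  simp only [zero_smul, one_smul, zero_add, add_zero, mul_zero, mul_one] at e2
  rw [hcd, h.cubicForm_eq hu] at e2
  have e3 := congrArg (fun q => inner ℝ q (mu u)) e2
  have hn : inner ℝ (mu u) (mu u) ≠ (0 : ℝ) := inner_self_ne_zero.2 h0
  simp only [inner_add_left, inner_smul_left, h.gauss u hu, inner_zero_left, ← add_mul] at e3
  have e4 := (mul_eq_zero.1 e3).resolve_right hn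
  simp at e4
  have hE₁ : dd X₁' L u = a • dd X₁ L u + b • dd X₂ L u := by simp [dd, hab]
  have hE₂ : dd X₂' L u = c • dd X₁ L u + d • dd X₂ L u := by simp [dd, hcd]
  have h21 := h.inner₁₂ hu
  rw [real_inner_comm] at h21
  have n2 := h'.inner₂₂ hu'
  have n12 := h'.inner₁₂ hu'
  rw [hE₂] at n2
  rw [hE₁, hE₂] at n12
  simp only [inner_add_left, inner_add_right, inner_smul_left, inner_smul_right, h.inner₁₁ hu,
    h.inner₂₂ hu, h.inner₁₂ hu, h21] at n2 n12
  simp at n2 n12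
  have hc : c = 0 := by
    have : c * (c * c + 3 * (d * d)) = 0 := by linarith
    rcases mul_eq_zero.1 this with h1 | h1
    · exact h1
    · nlinarith [mul_self_nonneg c, mul_self_nonneg d]
  have hb : b = 0 := by
    rw [hc] at n2 n12
    have hd : d ≠ 0 := by rintro rfl; simp at n2
    simpa [hd] using n12
  exact ⟨a, by rw [hE₁, hb]; simp⟩

end UmbFrame

/-! ### Coordinates adapted to a rescaled frame. -/

section Coordinates

/-- `φ` is a coordinate system on a part of `V` with rectangular range, whose coordinate vector
fields are `k₁⁻¹ X₁` and `k₂⁻¹ X₂`. -/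
structure FrameCoords (X₁ X₂ : Plane → Plane) (k₁ k₂ : Plane → ℝ) (V : Set Plane)
    (φ : OpenPartialHomeomorph Plane Plane) (a b c d : ℝ) : Prop where
  source_subset : φ.source ⊆ V
  smooth : ContDiffOn ℝ ∞ φ φ.source
  smooth_symm : ContDiffOn ℝ ∞ φ.symm φ.target
  target_eq : φ.target = {u : Plane | u 0 ∈ Ioo a b ∧ u 1 ∈ Ioo c d}
  partial₁ : ∀ r ∈ φ.target, fderiv ℝ φ.symm r (EuclideanSpace.single 0 1) =
    (k₁ (φ.symm r))⁻¹ • X₁ (φ.symm r)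
  partial₂ : ∀ r ∈ φ.target, fderiv ℝ φ.symm r (EuclideanSpace.single 1 1) =
    (k₂ (φ.symm r))⁻¹ • X₂ (φ.symm r)

theorem dd_clm_apply {X Y : Plane → Plane} {u : Plane}
    {α : Plane → Plane →L[ℝ] ℝ} (hα : DifferentiableAt ℝ α u) (hY : DifferentiableAt ℝ Y u) :
    dd X (fun w => α w (Y w)) u = fderiv ℝ α u (X u) (Y u) + α u (dd X Y u) := by
  rw [dd, fderiv_clm_apply hα hY]
  simp [dd, add_comm]

/-- A one-form `α` on an open set is closed as soon as `dα(X₁, X₂) = 0`. -/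
theorem UmbFrame.fderiv_symmetric {L : Plane → H2} {X₁ X₂ : Plane → Plane} {V : Set Plane}
    {lam mu : Plane → ℍ[ℝ]} {w₁ w₂ : Plane → ℝ} (h : UmbFrame L X₁ X₂ V lam mu w₁ w₂)
    {α : Plane → Plane →L[ℝ] ℝ} (hα : ContDiffOn ℝ ∞ α V) {p q : Plane → ℝ}
    (hp : ∀ w ∈ V, α w (X₁ w) = p w) (hq : ∀ w ∈ V, α w (X₂ w) = q w)
    (hpq : ∀ w ∈ V, dd X₁ q w - dd X₂ p w = -(w₁ w * p w) - w₂ w * q w)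
    {u : Plane} (hu : u ∈ V) (x y : Plane) : fderiv ℝ α u x y = fderiv ℝ α u y x := by
  have dα := ContDiffOn.diffAt hα h.isOpen hu
  have d1 := ContDiffOn.diffAt h.smooth₁ h.isOpen hu
  have d2 := ContDiffOn.diffAt h.smooth₂ h.isOpen hu
  have e1 := dd_clm_apply (X := X₁) dα d2
  have e2 := dd_clm_apply (X := X₂) dα d1
  rw [dd_congr h.isOpen hq hu] at e1
  rw [dd_congr h.isOpen hp hu] at e2
  have e3 := congrArg (α u) (h.bracket u hu)
  simp only [map_sub, map_neg, map_smul, hp u hu, hq u hu, smul_eq_mul] at e3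
  have key : fderiv ℝ α u (X₁ u) (X₂ u) = fderiv ℝ α u (X₂ u) (X₁ u) := by
    linarith [hpq u hu]
  obtain ⟨a, b, rfl⟩ := h.span u hu x
  obtain ⟨c, d, rfl⟩ := h.span u hu y
  simp only [map_add, map_smul, add_apply, smul_apply, key, smul_eq_mul]
  ring

/-- The hypotheses on k₁ and k₂ say exactly that k₁ and k₂ times the dual coframe are closed forms.
Their primitives on a ball, given by the Poincaré lemma, are the coordinates, and the inverse
function theorem makes them a local diffeomorphism. -/
theorem UmbFrame.exists_coords {L : Plane → H2} {X₁ X₂ : Plane → Plane} {V : Set Plane}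
    {lam mu : Plane → ℍ[ℝ]} {w₁ w₂ : Plane → ℝ} (h : UmbFrame L X₁ X₂ V lam mu w₁ w₂)
    {k₁ k₂ : Plane → ℝ} (hk₁ : ContDiffOn ℝ ∞ k₁ V) (hk₂ : ContDiffOn ℝ ∞ k₂ V)
    (h₁ : ∀ w ∈ V, k₁ w ≠ 0) (h₂ : ∀ w ∈ V, k₂ w ≠ 0)
    (hd₁ : ∀ w ∈ V, dd X₂ k₁ w = w₁ w * k₁ w) (hd₂ : ∀ w ∈ V, dd X₁ k₂ w = -(w₂ w * k₂ w))
    {u : Plane} (hu : u ∈ V) :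
    ∃ (φ : OpenPartialHomeomorph Plane Plane) (a b c d : ℝ),
      u ∈ φ.source ∧ FrameCoords X₁ X₂ k₁ k₂ V φ a b c d := by
  obtain ⟨r, hr, hball⟩ := Metric.isOpen_iff.1 h.isOpen u hu
  have hfL : ContDiffOn ℝ ∞ (fderiv ℝ L) V := h.smooth.fderiv_of_isOpen h.isOpen (by simp)
  -- the closed coframe
  have hform : ∀ (E : Plane → H2) (k : Plane → ℝ), ContDiffOn ℝ ∞ E V → ContDiffOn ℝ ∞ k V →
      ContDiffOn ℝ ∞ (fun w => k w • (innerSL ℝ (E w)).comp (fderiv ℝ L w)) V := by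
    intro E k hE hk
    exact hk.smul (((innerSL ℝ).contDiff.comp_contDiffOn hE).clm_comp hfL)
  set α : Plane → Plane →L[ℝ] ℝ := fun w => k₁ w • (innerSL ℝ (dd X₁ L w)).comp (fderiv ℝ L w)
    with hα
  set β : Plane → Plane →L[ℝ] ℝ := fun w => k₂ w • (innerSL ℝ (dd X₂ L w)).comp (fderiv ℝ L w)
    with hβ
  have sα : ContDiffOn ℝ ∞ α V := hform _ _ h.smooth_dd₁ hk₁
  have sβ : ContDiffOn ℝ ∞ β V := hform _ _ h.smooth_dd₂ hk₂
  have α1 : ∀ w ∈ V, α w (X₁ w) = k₁ w := fun w hw => by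
    have : α w (X₁ w) = k₁ w * inner ℝ (dd X₁ L w) (dd X₁ L w) := rfl
    rw [this, h.inner₁₁ hw, mul_one]
  have α2 : ∀ w ∈ V, α w (X₂ w) = 0 := fun w hw => by
    have : α w (X₂ w) = k₁ w * inner ℝ (dd X₁ L w) (dd X₂ L w) := rfl
    rw [this, h.inner₁₂ hw, mul_zero]
  have β1 : ∀ w ∈ V, β w (X₁ w) = 0 := fun w hw => by
    have : β w (X₁ w) = k₂ w * inner ℝ (dd X₂ L w) (dd X₁ L w) := rfl
    rw [this, real_inner_comm, h.inner₁₂ hw, mul_zero]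
  have β2 : ∀ w ∈ V, β w (X₂ w) = k₂ w := fun w hw => by
    have : β w (X₂ w) = k₂ w * inner ℝ (dd X₂ L w) (dd X₂ L w) := rfl
    rw [this, h.inner₂₂ hw, mul_one]
  have clα : ∀ w ∈ Metric.ball u r, ∀ x y, fderiv ℝ α w x y = fderiv ℝ α w y x := fun w hw =>
    h.fderiv_symmetric sα α1 α2 (fun w hw => by rw [hd₁ w hw, dd_const]; ring) (hball hw)
  have clβ : ∀ w ∈ Metric.ball u r, ∀ x y, fderiv ℝ β w x y = fderiv ℝ β w y x := fun w hw =>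
    h.fderiv_symmetric sβ β1 β2 (fun w hw => by rw [hd₂ w hw, dd_const]; ring) (hball hw)
  -- primitives
  have prim : ∀ γ : Plane → Plane →L[ℝ] ℝ, ContDiffOn ℝ ∞ γ V →
      (∀ w ∈ Metric.ball u r, ∀ x y, fderiv ℝ γ w x y = fderiv ℝ γ w y x) →
      ∃ f : Plane → ℝ, (∀ w ∈ Metric.ball u r, HasFDerivAt f (γ w) w) ∧
        ContDiffOn ℝ ∞ f (Metric.ball u r) := by
    intro γ hγ hcl
    obtain ⟨f, hf⟩ := (convex_ball u r).exists_forall_hasFDerivAt_of_fderiv_symmetric (𝕜 := ℝ)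
      Metric.isOpen_ball ((hγ.mono hball).differentiableOn (by simp)) hcl
    refine ⟨f, hf, (contDiffOn_infty_iff_fderiv_of_isOpen Metric.isOpen_ball).2
      ⟨fun w hw => (hf w hw).differentiableAt.differentiableWithinAt, ?_⟩⟩
    exact (hγ.mono hball).congr fun w hw => (hf w hw).fderiv
  obtain ⟨f, hf, sf⟩ := prim α sα clα
  obtain ⟨g, hg, sg⟩ := prim β sβ clβ
  set Φ : Plane → Plane := fun w => !₂[f w, g w] with hΦ
  have sΦ : ContDiffOn ℝ ∞ Φ (Metric.ball u r) := by
    rw [contDiffOn_piLp]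
    intro i
    fin_cases i
    · exact sf
    · exact sg
  have hΦd : ∀ w ∈ Metric.ball u r, DifferentiableAt ℝ Φ w := fun w hw =>
    ContDiffOn.diffAt sΦ Metric.isOpen_ball hw
  have hΦ0 : ∀ w ∈ Metric.ball u r, ∀ x, fderiv ℝ Φ w x 0 = α w x := by
    intro w hw x
    have h1 := ((EuclideanSpace.proj (𝕜 := ℝ) (0 : Fin 2)).hasFDerivAt.comp w
      (hΦd w hw).hasFDerivAt).unique (hf w hw)
    exact congrArg (fun T : Plane →L[ℝ] ℝ => T x) h1
  have hΦ1 : ∀ w ∈ Metric.ball u r, ∀ x, fderiv ℝ Φ w x 1 = β w x := by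
    intro w hw x
    have h1 := ((EuclideanSpace.proj (𝕜 := ℝ) (1 : Fin 2)).hasFDerivAt.comp w
      (hΦd w hw).hasFDerivAt).unique (hg w hw)
    exact congrArg (fun T : Plane →L[ℝ] ℝ => T x) h1
  have hΦX₁ : ∀ w ∈ Metric.ball u r,
      fderiv ℝ Φ w ((k₁ w)⁻¹ • X₁ w) = EuclideanSpace.single 0 1 := by
    intro w hw
    ext i
    fin_cases i
    · simp [hΦ0 w hw, α1 w (hball hw), h₁ w (hball hw)]
    · simp [hΦ1 w hw, β1 w (hball hw)]
  have hΦX₂ : ∀ w ∈ Metric.ball u r,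
      fderiv ℝ Φ w ((k₂ w)⁻¹ • X₂ w) = EuclideanSpace.single 1 1 := by
    intro w hw
    ext i
    fin_cases i
    · simp [hΦ0 w hw, α2 w (hball hw)]
    · simp [hΦ1 w hw, β2 w (hball hw), h₂ w (hball hw)]
  have hequiv : ∀ w ∈ Metric.ball u r, ∃ T : Plane ≃L[ℝ] Plane,
      HasFDerivAt Φ (T : Plane →L[ℝ] Plane) w := by
    intro w hw
    have hinj : Function.Injective (fderiv ℝ Φ w).toLinearMap := by
      rw [← LinearMap.ker_eq_bot, LinearMap.ker_eq_bot']
      intro x hx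
      obtain ⟨a, b, rfl⟩ := h.span w (hball hw) x
      have e0 := hΦ0 w hw (a • X₁ w + b • X₂ w)
      have e1 := hΦ1 w hw (a • X₁ w + b • X₂ w)
      rw [show fderiv ℝ Φ w (a • X₁ w + b • X₂ w) = 0 from hx] at e0 e1
      simp only [map_add, map_smul, α1 w (hball hw), α2 w (hball hw), β1 w (hball hw),
        β2 w (hball hw)] at e0 e1
      simp [h₁ w (hball hw), h₂ w (hball hw)] at e0 e1
      simp [e0, e1]
    refine ⟨(LinearEquiv.ofInjectiveEndo _ hinj).toContinuousLinearEquiv, ?_⟩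
    convert! (hΦd w hw).hasFDerivAt using 1
  have hub : u ∈ Metric.ball u r := Metric.mem_ball_self hr
  obtain ⟨T, hT⟩ := hequiv u hub
  have cu : ContDiffAt ℝ ∞ Φ u := sΦ.contDiffAt (Metric.isOpen_ball.mem_nhds hub)
  set φ₀ := (cu.toOpenPartialHomeomorph Φ hT (by simp)) with hφ₀
  have hφ₀c : (φ₀ : Plane → Plane) = Φ := rfl
  have hu₀ : u ∈ φ₀.source := cu.mem_toOpenPartialHomeomorph_source hT (by simp)
  set φ₁ := φ₀.restrOpen (Metric.ball u r) Metric.isOpen_ball with hφ₁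
  have hs₁ : φ₁.source = φ₀.source ∩ Metric.ball u r := φ₀.restrOpen_source _ Metric.isOpen_ball
  have hu₁ : u ∈ φ₁.source := by rw [hs₁]; exact ⟨hu₀, hub⟩
  -- a rectangle around the image of the base point
  obtain ⟨δ, hδ, hrect⟩ : ∃ δ > 0, {z : Plane | z 0 ∈ Ioo (f u - δ) (f u + δ) ∧
      z 1 ∈ Ioo (g u - δ) (g u + δ)} ⊆ φ₁.target := by
    have hmem : φ₁.target ∈ 𝓝 (Φ u) := φ₁.open_target.mem_nhds (φ₁.map_source hu₁)
    have hpre : (WithLp.toLp 2 : (Fin 2 → ℝ) → Plane) ⁻¹' φ₁.target ∈ 𝓝 ![f u, g u] :=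
      (PiLp.continuous_toLp 2 _).continuousAt.preimage_mem_nhds hmem
    obtain ⟨δ, hδ, hb⟩ := Metric.mem_nhds_iff.1 hpre
    refine ⟨δ, hδ, fun z hz => ?_⟩
    have : z.ofLp ∈ Metric.ball ![f u, g u] δ := by
      rw [Metric.mem_ball, dist_pi_lt_iff hδ]
      intro i
      fin_cases i
      · have := hz.1
        simp [Real.dist_eq, abs_lt]; constructor <;> linarith [this.1, this.2]
      · have := hz.2
        simp [Real.dist_eq, abs_lt]; constructor <;> linarith [this.1, this.2]
    exact hb this
  set R : Set Plane := {z : Plane | z 0 ∈ Ioo (f u - δ) (f u + δ) ∧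
      z 1 ∈ Ioo (g u - δ) (g u + δ)} with hR
  have hRo : IsOpen R := by
    have c0 : Continuous fun z : Plane => z 0 := by fun_prop
    have c1 : Continuous fun z : Plane => z 1 := by fun_prop
    exact (isOpen_Ioo.preimage c0).inter (isOpen_Ioo.preimage c1)
  -- Restricting the inverse to R makes the range of the coordinates exactly the rectangle.
  set φ := (φ₁.symm.restrOpen R hRo).symm with hφ
  have htφ : φ.target = R := by
    have : φ.target = φ₁.target ∩ R := φ₁.symm.restrOpen_source R hRo
    rw [this, inter_eq_right.2 hrect]
  have hφc : (φ : Plane → Plane) = Φ := rfl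
  have hsub : ∀ z ∈ φ.source, z ∈ Metric.ball u r := by
    intro z hz
    have h1 : φ z ∈ φ₁.target := hrect (htφ ▸ φ.map_source hz)
    have h2 : φ₁.symm (φ z) = z := φ.left_inv hz
    have h3 := φ₁.map_target h1
    rw [h2, hs₁] at h3
    exact h3.2
  have hsymm : ∀ z ∈ φ.target, φ.symm z ∈ Metric.ball u r := fun z hz => hsub _ (φ.map_target hz)
  have hsm : ContDiffOn ℝ ∞ φ.symm φ.target := by
    intro z hz
    obtain ⟨T', hT'⟩ := hequiv _ (hsymm z hz)
    exact (φ.contDiffAt_symm hz hT'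
      (sΦ.contDiffAt (Metric.isOpen_ball.mem_nhds (hsymm z hz)))).contDiffWithinAt
  have hpart : ∀ z ∈ φ.target, ∀ x, fderiv ℝ φ.symm z (fderiv ℝ Φ (φ.symm z) x) = x := by
    intro z hz x
    have h1 : HasFDerivAt φ.symm (fderiv ℝ φ.symm z) (Φ (φ.symm z)) := by
      rw [← hφc, φ.right_inv hz]
      exact (ContDiffOn.diffAt hsm φ.open_target hz).hasFDerivAt
    have h2 := h1.comp _ (hΦd _ (hsymm z hz)).hasFDerivAt
    have h3 : (φ.symm ∘ Φ) =ᶠ[𝓝 (φ.symm z)] id := by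
      filter_upwards [φ.open_source.mem_nhds (φ.map_target hz)] with w hw
      exact φ.left_inv hw
    have h4 := h2.unique ((hasFDerivAt_id _).congr_of_eventuallyEq h3)
    exact congrArg (fun T : Plane →L[ℝ] Plane => T x) h4
  refine ⟨φ, _, _, _, _, ?_, ⟨fun z hz => hball (hsub z hz), sΦ.mono hsub, hsm, htφ, ?_, ?_⟩⟩
  · have h1 : Φ u ∈ φ.target := by
      rw [htφ, hR]
      simp [hΦ, hδ]
    have h2 := φ.map_target h1
    have h3 : φ.symm (Φ u) = u := φ₁.left_inv hu₁
    rwa [h3] at h2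
  · intro z hz
    rw [← hΦX₁ _ (hsymm z hz), hpart z hz]
  · intro z hz
    rw [← hΦX₂ _ (hsymm z hz), hpart z hz]

end Coordinates

/-! ### The case mu = 0: ruled local forms. -/

section LocalForm

theorem eq_of_hasDerivAt_zero {F : Type*} [NormedAddCommGroup F] [NormedSpace ℝ F] {f : ℝ → F}
    {a b : ℝ} (hf : ∀ t ∈ Ioo a b, HasDerivAt f 0 t) {s t : ℝ} (hs : s ∈ Ioo a b)
    (ht : t ∈ Ioo a b) : f s = f t :=
  isOpen_Ioo.is_const_of_deriv_eq_zero isPreconnected_Ioo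
    (fun x hx => (hf x hx).differentiableAt.differentiableWithinAt) (fun x hx => (hf x hx).deriv)
    hs ht

/-- The point of the plane with coordinates `x` and `y`. -/
def pt (x y : ℝ) : Plane := !₂[x, y]

@[simp] theorem pt_zero (x y : ℝ) : pt x y 0 = x := rfl
@[simp] theorem pt_one (x y : ℝ) : pt x y 1 = y := rfl

theorem pt_eta (u : Plane) : pt (u 0) (u 1) = u := by
  ext i; fin_cases i <;> rfl

theorem hasDerivAt_pt_left (x y : ℝ) :
    HasDerivAt (fun t => pt t y) (EuclideanSpace.single 0 1) x := by
  have h1 : HasDerivAt (fun t : ℝ => pt 0 y + t • (EuclideanSpace.single 0 1 : Plane))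
      (EuclideanSpace.single 0 1) x := by
    simpa using ((hasDerivAt_id x).smul_const (EuclideanSpace.single 0 1 : Plane)).const_add (pt 0 y)
  convert! h1 using 1
  ext t i; fin_cases i <;> simp [pt]

theorem hasDerivAt_pt_right (x y : ℝ) :
    HasDerivAt (fun t => pt x t) (EuclideanSpace.single 1 1) y := by
  have h1 : HasDerivAt (fun t : ℝ => pt x 0 + t • (EuclideanSpace.single 1 1 : Plane))
      (EuclideanSpace.single 1 1) y := by
    simpa using ((hasDerivAt_id y).smul_const (EuclideanSpace.single 1 1 : Plane)).const_add (pt x 0)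
  convert! h1 using 1
  ext t i; fin_cases i <;> simp [pt]

theorem contDiff_pt_left (y : ℝ) : ContDiff ℝ ∞ (fun t => pt t y) := by
  rw [contDiff_piLp]; intro i; fin_cases i
  · exact contDiff_id
  · exact contDiff_const

theorem contDiff_pt_right (x : ℝ) : ContDiff ℝ ∞ (fun t => pt x t) := by
  rw [contDiff_piLp]; intro i; fin_cases i
  · exact contDiff_const
  · exact contDiff_id

namespace FrameCoords

variable {X₁ X₂ : Plane → Plane} {k₁ k₂ : Plane → ℝ} {V : Set Plane}
  {φ : OpenPartialHomeomorph Plane Plane} {a b c d : ℝ}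
  (hφ : FrameCoords X₁ X₂ k₁ k₂ V φ a b c d) {x y : ℝ}
  {F : Type*} [NormedAddCommGroup F] [NormedSpace ℝ F] {f : Plane → F}
include hφ

theorem mem_rect {u : Plane} (hu : u ∈ φ.source) : φ u 0 ∈ Ioo a b ∧ φ u 1 ∈ Ioo c d := by
  have := φ.map_source hu
  rwa [hφ.target_eq] at this

theorem contDiffOn_left (hf : ContDiffOn ℝ ∞ f V) (hy : y ∈ Ioo c d) :
    ContDiffOn ℝ ∞ (fun t => f (φ.symm (pt t y))) (Ioo a b) := by
  have hm : ∀ t ∈ Ioo a b, pt t y ∈ φ.target := fun t ht => by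
    rw [hφ.target_eq]; exact ⟨ht, hy⟩
  exact hf.comp (hφ.smooth_symm.comp (contDiff_pt_left y).contDiffOn hm)
    (fun t ht => hφ.source_subset (φ.map_target (hm t ht)))

theorem contDiffOn_right (hf : ContDiffOn ℝ ∞ f V) (hx : x ∈ Ioo a b) :
    ContDiffOn ℝ ∞ (fun t => f (φ.symm (pt x t))) (Ioo c d) := by
  have hm : ∀ t ∈ Ioo c d, pt x t ∈ φ.target := fun t ht => by
    rw [hφ.target_eq]; exact ⟨hx, ht⟩
  exact hf.comp (hφ.smooth_symm.comp (contDiff_pt_right x).contDiffOn hm)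
    (fun t ht => hφ.source_subset (φ.map_target (hm t ht)))

variable (hx : x ∈ Ioo a b) (hy : y ∈ Ioo c d)
include hx hy

theorem mem_target : pt x y ∈ φ.target := by
  rw [hφ.target_eq]; exact ⟨hx, hy⟩

theorem mem_domain : φ.symm (pt x y) ∈ V :=
  hφ.source_subset (φ.map_target (hφ.mem_target hx hy))

theorem hasDerivAt_left (hf : DifferentiableAt ℝ f (φ.symm (pt x y))) :
    HasDerivAt (fun t => f (φ.symm (pt t y)))
      ((k₁ (φ.symm (pt x y)))⁻¹ • dd X₁ f (φ.symm (pt x y))) x := by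
  have h1 := ContDiffOn.diffAt hφ.smooth_symm φ.open_target (hφ.mem_target hx hy)
  have h2 := (hf.hasFDerivAt.comp _ h1.hasFDerivAt).comp_hasDerivAt x (hasDerivAt_pt_left x y)
  refine h2.congr_deriv ?_
  rw [ContinuousLinearMap.comp_apply, hφ.partial₁ _ (hφ.mem_target hx hy), map_smul]
  rfl

theorem hasDerivAt_right (hf : DifferentiableAt ℝ f (φ.symm (pt x y))) :
    HasDerivAt (fun t => f (φ.symm (pt x t)))
      ((k₂ (φ.symm (pt x y)))⁻¹ • dd X₂ f (φ.symm (pt x y))) y := by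
  have h1 := ContDiffOn.diffAt hφ.smooth_symm φ.open_target (hφ.mem_target hx hy)
  have h2 := (hf.hasFDerivAt.comp _ h1.hasFDerivAt).comp_hasDerivAt y (hasDerivAt_pt_right x y)
  refine h2.congr_deriv ?_
  rw [ContinuousLinearMap.comp_apply, hφ.partial₂ _ (hφ.mem_target hx hy), map_smul]
  rfl

end FrameCoords

/-- `L` has, on a neighbourhood of `u` inside `V`, the form `D(x) + y P(x)` in coordinates `φ`
ranging over a rectangle, where `P` satisfies `Q P S` on its domain `S`. -/
def RuledForm (L : Plane → H2) (V : Set Plane) (u : Plane)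
    (Q : (ℝ → H2) → Set ℝ → Prop) : Prop :=
  ∃ (φ : OpenPartialHomeomorph Plane Plane) (a b c d : ℝ) (D P : ℝ → H2),
    u ∈ φ.source ∧ φ.source ⊆ V ∧ ContDiffOn ℝ ∞ φ φ.source ∧ ContDiffOn ℝ ∞ φ.symm φ.target ∧
    φ.target = {u : Plane | u 0 ∈ Ioo a b ∧ u 1 ∈ Ioo c d} ∧
    ContDiffOn ℝ ∞ D (Ioo a b) ∧ Q P (Ioo a b) ∧
    ∀ w ∈ φ.source, L w = D (φ w 0) + (φ w 1) • P (φ w 0)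

namespace UmbFrame

variable {L : Plane → H2} {X₁ X₂ : Plane → Plane} {V : Set Plane}
  {lam mu : Plane → ℍ[ℝ]} {w₁ w₂ : Plane → ℝ} (h : UmbFrame L X₁ X₂ V lam mu w₁ w₂)
include h

section Ruled

variable (h0 : ∀ w ∈ V, mu w = 0) (hl : ∀ w ∈ V, lam w ≠ 0) {k : Plane → ℝ}
  {φ : OpenPartialHomeomorph Plane Plane} {a b c d : ℝ}
  (hφ : FrameCoords X₁ X₂ k (fun _ => 1) V φ a b c d) {y₀ : ℝ} (hy₀ : y₀ ∈ Ioo c d)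
include h0 hl hφ hy₀

/-- A Lagrangian H-umbilical immersion with `mu = 0` is ruled by the integral curves of `X₂`. -/
theorem eq_ruled {u : Plane} (hu : u ∈ φ.source) :
    L u = (L (φ.symm (pt (φ u 0) y₀)) - y₀ • dd X₂ L (φ.symm (pt (φ u 0) y₀)))
      + (φ u 1) • dd X₂ L (φ.symm (pt (φ u 0) y₀)) := by
  obtain ⟨hx, hy⟩ := hφ.mem_rect hu
  -- E₂ is parallel along the X₂-curves, since X₂E₂ = (mu − w₂)E₁ = 0.
  have hEc : ∀ t ∈ Ioo c d, dd X₂ L (φ.symm (pt (φ u 0) t)) =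
      dd X₂ L (φ.symm (pt (φ u 0) y₀)) := by
    intro t ht
    refine eq_of_hasDerivAt_zero (f := fun t => dd X₂ L (φ.symm (pt (φ u 0) t)))
      (fun s hs => ?_) ht hy₀
    have hm := hφ.mem_domain hx hs
    refine (hφ.hasDerivAt_right hx hs (ContDiffOn.diffAt h.smooth_dd₂ h.isOpen hm)).congr_deriv ?_
    rw [h.dd₂₂ _ hm, h0 _ hm, h.w₂_eq_zero hm h0 (hl _ hm)]
    simp
  have hLc := eq_of_hasDerivAt_zero (f := fun t => L (φ.symm (pt (φ u 0) t))
      - t • dd X₂ L (φ.symm (pt (φ u 0) y₀))) (fun s hs => by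
    have hm := hφ.mem_domain hx hs
    refine ((hφ.hasDerivAt_right hx hs (ContDiffOn.diffAt h.smooth h.isOpen hm)).sub
      ((hasDerivAt_id s).smul_const (dd X₂ L (φ.symm (pt (φ u 0) y₀))))).congr_deriv ?_
    rw [hEc s hs]
    simp) hy hy₀
  simp only [pt_eta, φ.left_inv hu] at hLc
  rw [← hLc]; abel

omit hl in
theorem hasDerivAt_ruling {x : ℝ} (hx : x ∈ Ioo a b) :
    HasDerivAt (fun t => dd X₂ L (φ.symm (pt t y₀)))
      (-((k (φ.symm (pt x y₀)))⁻¹ * w₁ (φ.symm (pt x y₀))) • dd X₁ L (φ.symm (pt x y₀))) x := by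
  have hm := hφ.mem_domain hx hy₀
  refine (hφ.hasDerivAt_left hx hy₀ (ContDiffOn.diffAt h.smooth_dd₂ h.isOpen hm)).congr_deriv ?_
  rw [h.dd₁₂ _ hm, h0 _ hm]
  simp [smul_smul]

omit hl in
theorem isLegendre_ruling : IsLegendre (fun t => dd X₂ L (φ.symm (pt t y₀))) (Ioo a b) where
  smooth := hφ.contDiffOn_left h.smooth_dd₂ hy₀
  mem_sphere x hx := by
    have := h.inner₂₂ (hφ.mem_domain hx hy₀)
    rw [real_inner_self_eq_norm_sq] at this
    exact (pow_eq_one_iff_of_nonneg (norm_nonneg _) two_ne_zero).1 this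
  legendre x hx := by
    rw [(h.hasDerivAt_ruling h0 hφ hy₀ hx).deriv, perpIJK_iff, herm_rsmul_left,
      h.herm₁₂ _ (hφ.mem_domain hx hy₀)]
    simp

end Ruled

/-- The factor k fixes only the parametrization in x, and hence the speed of the ruling curve; the
three uses below differ in k. For the second coordinate the factor 1 is admissible because w₂ = 0.
-/
theorem ruledForm_of (h0 : ∀ w ∈ V, mu w = 0) (hl : ∀ w ∈ V, lam w ≠ 0) {k : Plane → ℝ}
    {Q : (ℝ → H2) → Set ℝ → Prop} {u : Plane} (hu : u ∈ V)
    (hk : ContDiffOn ℝ ∞ k V) (hk0 : ∀ w ∈ V, k w ≠ 0) (hkd : ∀ w ∈ V, dd X₂ k w = w₁ w * k w)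
    (hQ : ∀ (φ : OpenPartialHomeomorph Plane Plane) (a b c d y₀ : ℝ),
      FrameCoords X₁ X₂ k (fun _ => 1) V φ a b c d → y₀ ∈ Ioo c d →
      Q (fun t => dd X₂ L (φ.symm (pt t y₀))) (Ioo a b)) : RuledForm L V u Q := by
  obtain ⟨φ, a, b, c, d, huφ, hφ⟩ := h.exists_coords hk contDiffOn_const hk0
    (fun _ _ => one_ne_zero) hkd (fun w hw => by
      rw [dd_const, h.w₂_eq_zero hw h0 (hl w hw)]; simp) hu
  have hy₀ := (hφ.mem_rect huφ).2
  exact ⟨φ, a, b, c, d, fun t => L (φ.symm (pt t (φ u 1))) - (φ u 1) •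
    dd X₂ L (φ.symm (pt t (φ u 1))), _, huφ, hφ.source_subset, hφ.smooth, hφ.smooth_symm,
    hφ.target_eq, (hφ.contDiffOn_left h.smooth hy₀).sub
      (contDiffOn_const.fun_smul (hφ.contDiffOn_left h.smooth_dd₂ hy₀)),
    hQ φ a b c d _ hφ hy₀, fun w hw => h.eq_ruled h0 hl hφ hy₀ hw⟩

/-- The choice k = |lam| is insensitive to the zeros of w₁, so it works at every point. -/
theorem ruledForm_isLegendre (h0 : ∀ w ∈ V, mu w = 0) (hl : ∀ w ∈ V, lam w ≠ 0) {u : Plane}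
    (hu : u ∈ V) : RuledForm L V u IsLegendre :=
  h.ruledForm_of h0 hl hu (h.smooth_lam.norm ℝ hl) (fun w hw => norm_ne_zero_iff.2 (hl w hw))
    (fun _ hw => h.dd₂_norm_lam hw h0 (hl _ hw))
    (fun _ _ _ _ _ _ hφ hy₀ => h.isLegendre_ruling h0 hφ hy₀)

theorem ruledForm_const (h0 : ∀ w ∈ V, mu w = 0) (hl : ∀ w ∈ V, lam w ≠ 0)
    (hw : ∀ w ∈ V, w₁ w = 0) {u : Plane} (hu : u ∈ V) :
    RuledForm L V u (fun P S => ∃ c : H2, ∀ t ∈ S, P t = c) :=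
  h.ruledForm_of h0 hl hu contDiffOn_const (fun _ _ => one_ne_zero) (k := fun _ => 1)
    (fun w hw' => by rw [dd_const, hw w hw']; simp)
    (fun φ a b c d y₀ hφ hy₀ => by
      by_cases hab : (Ioo a b).Nonempty
      · obtain ⟨x₀, hx₀⟩ := hab
        refine ⟨dd X₂ L (φ.symm (pt x₀ y₀)), fun t ht => eq_of_hasDerivAt_zero
          (f := fun t => dd X₂ L (φ.symm (pt t y₀))) (fun s hs => ?_) ht hx₀⟩
        refine (h.hasDerivAt_ruling h0 hφ hy₀ hs).congr_deriv ?_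
        rw [hw _ (hφ.mem_domain hs hy₀)]; simp
      · exact ⟨0, fun t ht => (hab ⟨t, ht⟩).elim⟩)

/-- With k = −w₁ the ruling curve P = E₂ satisfies P' = E₁. Dividing the structure equation for X₁E₁
by −w₁ then gives P'' = −w₁⁻¹ lam P' − P. -/
theorem ruledForm_isSpecialLegendre (h0 : ∀ w ∈ V, mu w = 0) (hl : ∀ w ∈ V, lam w ≠ 0)
    (hw : ∀ w ∈ V, w₁ w ≠ 0) {u : Plane} (hu : u ∈ V) : RuledForm L V u IsSpecialLegendre := by
  refine h.ruledForm_of h0 hl hu (k := fun w => -w₁ w) h.smooth_w₁.neg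
    (fun w hw' => neg_ne_zero.2 (hw w hw')) (fun w hw' => ?_) (fun φ a b c d y₀ hφ hy₀ => ?_)
  · have : dd X₂ (fun w => -w₁ w) w = -dd X₂ w₁ w := by simp [dd]
    rw [this, h.dd₂_w₁ hw' h0 hl]; ring
  · have hP : ∀ x ∈ Ioo a b, HasDerivAt (fun t => dd X₂ L (φ.symm (pt t y₀)))
        (dd X₁ L (φ.symm (pt x y₀))) x := fun x hx => by
      refine (h.hasDerivAt_ruling h0 hφ hy₀ hx).congr_deriv ?_
      simp [hw _ (hφ.mem_domain hx hy₀)]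
    refine ⟨h.isLegendre_ruling h0 hφ hy₀, fun x hx => ?_,
      fun x => -((w₁ (φ.symm (pt x y₀)))⁻¹ * (lam (φ.symm (pt x y₀))).imI),
      fun x => -((w₁ (φ.symm (pt x y₀)))⁻¹ * (lam (φ.symm (pt x y₀))).imJ),
      fun x => -((w₁ (φ.symm (pt x y₀)))⁻¹ * (lam (φ.symm (pt x y₀))).imK), fun x hx => ?_⟩
    · rw [(hP x hx).deriv]
      have := h.inner₁₁ (hφ.mem_domain hx hy₀)
      rw [real_inner_self_eq_norm_sq] at this
      exact (pow_eq_one_iff_of_nonneg (norm_nonneg _) two_ne_zero).1 this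
    · have hm := hφ.mem_domain hx hy₀
      have heq : deriv (fun t => dd X₂ L (φ.symm (pt t y₀))) =ᶠ[𝓝 x]
          fun t => dd X₁ L (φ.symm (pt t y₀)) := by
        filter_upwards [isOpen_Ioo.mem_nhds hx] with t ht using (hP t ht).deriv
      rw [heq.deriv_eq, (hφ.hasDerivAt_left hx hy₀
        (ContDiffOn.diffAt h.smooth_dd₁ h.isOpen hm)).deriv, (hP x hx).deriv, h.dd₁₁ _ hm]
      have hq : im (-((w₁ (φ.symm (pt x y₀)))⁻¹ * (lam (φ.symm (pt x y₀))).imI))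
          (-((w₁ (φ.symm (pt x y₀)))⁻¹ * (lam (φ.symm (pt x y₀))).imJ))
          (-((w₁ (φ.symm (pt x y₀)))⁻¹ * (lam (φ.symm (pt x y₀))).imK)) =
          (-w₁ (φ.symm (pt x y₀)))⁻¹ • lam (φ.symm (pt x y₀)) := by
        rw [Quaternion.ext_iff]
        simp [h.lam_re _ hm]
      rw [hq, smul_add, smul_smul, inv_neg, neg_mul, inv_mul_cancel₀ (hw _ hm), smul_assoc]
      simp [sub_eq_add_neg]

end UmbFrame

end LocalForm

/-! ### The case mu ≠ 0: the cone form. -/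

section Cone

/-- `L` has, on a neighbourhood of `u` inside `V`, the form `f(x) A(y) + v` in coordinates `φ`
ranging over a rectangle. -/
def ConeForm (L : Plane → H2) (V : Set Plane) (u : Plane) (v : H2) : Prop :=
  ∃ (φ : OpenPartialHomeomorph Plane Plane) (a b c d : ℝ) (f : ℝ → ℍ[ℝ]) (A : ℝ → H2),
    u ∈ φ.source ∧ φ.source ⊆ V ∧ ContDiffOn ℝ ∞ φ φ.source ∧ ContDiffOn ℝ ∞ φ.symm φ.target ∧
    φ.target = {u : Plane | u 0 ∈ Ioo a b ∧ u 1 ∈ Ioo c d} ∧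
    ContDiffOn ℝ ∞ f (Ioo a b) ∧ ContDiffOn ℝ ∞ A (Ioo c d) ∧
    ∀ w ∈ φ.source, L w = f (φ w 0) • A (φ w 1) + v

theorem herm_self (z : H2) : herm z z = ((‖z‖ ^ 2 : ℝ) : ℍ[ℝ]) := by
  have h1 : star (herm z z) = herm z z := star_herm z z
  have h2 : (herm z z).re = ‖z‖ ^ 2 := by rw [← inner_eq_herm_re, real_inner_self_eq_norm_sq]
  have h3 : herm z z = ((herm z z).re : ℍ[ℝ]) := Quaternion.star_eq_self.1 h1
  rw [h3, h2]

theorem inner_smul_self (q : ℍ[ℝ]) (z : H2) : inner ℝ z (q • z) = q.re * ‖z‖ ^ 2 := by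
  rw [real_inner_comm, inner_eq_herm_re, herm_smul_left, herm_self, ← Quaternion.coe_commutes,
    Quaternion.coe_mul_eq_smul]
  simp [mul_comm]

/-- Uniqueness for the linear equation `z' = σ z` with a quaternionic coefficient: solutions that
are left proportional at one point stay so, with zero remainder, along a nowhere zero solution. -/
theorem eq_zero_of_hasDerivAt_smul {a b : ℝ} {σ : ℝ → ℍ[ℝ]} {Q N : ℝ → H2}
    (hQ : ∀ t ∈ Ioo a b, HasDerivAt Q (σ t • Q t) t)
    (hN : ∀ t ∈ Ioo a b, HasDerivAt N (σ t • N t) t) (hN0 : ∀ t ∈ Ioo a b, N t ≠ 0)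
    {x₀ x : ℝ} (hx₀ : x₀ ∈ Ioo a b) (hx : x ∈ Ioo a b) (h0 : Q x₀ = 0) : Q x = 0 := by
  have hsq : ∀ (Z : ℝ → H2), (∀ t ∈ Ioo a b, HasDerivAt Z (σ t • Z t) t) → ∀ t ∈ Ioo a b,
      HasDerivAt (fun t => ‖Z t‖ ^ 2) (2 * (σ t).re * ‖Z t‖ ^ 2) t := by
    intro Z hZ t ht
    refine ((hZ t ht).norm_sq).congr_deriv ?_
    rw [inner_smul_self]; ring
  have hn : ∀ t ∈ Ioo a b, ‖N t‖ ^ 2 ≠ 0 := fun t ht => by simpa using hN0 t ht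
  -- Both squared norms solve the scalar equation m' = 2 Re(σ) m, so their quotient is constant.
  have := eq_of_hasDerivAt_zero (f := fun t => ‖Q t‖ ^ 2 / ‖N t‖ ^ 2) (fun t ht => by
    refine ((hsq Q hQ t ht).div (hsq N hN t ht) (hn t ht)).congr_deriv ?_
    rw [div_eq_zero_iff]; left; ring) hx hx₀
  have hz : ‖Q x‖ ^ 2 / ‖N x‖ ^ 2 = 0 := by rw [this, h0]; simp
  simpa [hn x hx, hN0 x hx] using hz

/-- With factors 1 and |mu| there are coordinates in which N = L − v satisfies ∂N/∂x = σN. As σ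
depends on x alone, the quaternionic solution f of f' = σf with f(x₀) = 1 gives N(x, y) = f(x) N(x₀,
y). -/
theorem UmbFrame.coneForm {L : Plane → H2} {X₁ X₂ : Plane → Plane} {V : Set Plane}
    {lam mu : Plane → ℍ[ℝ]} {w₁ w₂ : Plane → ℝ} (h : UmbFrame L X₁ X₂ V lam mu w₁ w₂)
    (h0 : ∀ w ∈ V, mu w ≠ 0) {v : H2}
    (hv : ∀ w ∈ V, L w - v = (coneCoeff mu w₂ w)⁻¹ • dd X₁ L w) {u : Plane} (hu : u ∈ V) :
    ConeForm L V u v := by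
  obtain ⟨φ, a, b, c, d, huφ, hφ⟩ := h.exists_coords contDiffOn_const (k₁ := fun _ => 1)
    (h.smooth_mu.norm ℝ h0) (fun _ _ => one_ne_zero) (fun w hw => norm_ne_zero_iff.2 (h0 w hw))
    (fun w hw => by rw [dd_const, h.w₁_eq_zero hw (h0 w hw)]; simp)
    (fun w hw => h.dd₁_norm_mu hw (h0 w hw)) hu
  obtain ⟨hx₀, hy₀⟩ := hφ.mem_rect huφ
  set x₀ := φ u 0
  set y₀ := φ u 1
  set N : ℝ → ℝ → H2 := fun x y => L (φ.symm (pt x y)) - v with hN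
  set σ : ℝ → ℍ[ℝ] := fun x => coneCoeff mu w₂ (φ.symm (pt x y₀)) with hσ
  have hσy : ∀ x ∈ Ioo a b, ∀ y ∈ Ioo c d, coneCoeff mu w₂ (φ.symm (pt x y)) = σ x := by
    intro x hx y hy
    refine eq_of_hasDerivAt_zero (f := fun y => coneCoeff mu w₂ (φ.symm (pt x y)))
      (fun t ht => ?_) hy hy₀
    have hm := hφ.mem_domain hx ht
    refine (hφ.hasDerivAt_right hx ht
      (ContDiffOn.diffAt h.smooth_coneCoeff h.isOpen hm)).congr_deriv ?_
    rw [h.dd₂_coneCoeff h0 hm, smul_zero]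
  have hNd : ∀ y ∈ Ioo c d, ∀ x ∈ Ioo a b, HasDerivAt (fun t => N t y) (σ x • N x y) x := by
    intro y hy x hx
    have hm := hφ.mem_domain hx hy
    refine ((hφ.hasDerivAt_left hx hy
      (ContDiffOn.diffAt h.smooth h.isOpen hm)).sub_const v).congr_deriv ?_
    have hs := h.coneCoeff_ne_zero h0 hm
    rw [hN]
    dsimp only
    rw [hv _ hm, ← hσy x hx y hy, smul_smul, mul_inv_cancel₀ hs]
    simp
  have hN0 : ∀ y ∈ Ioo c d, ∀ x ∈ Ioo a b, N x y ≠ 0 := by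
    intro y hy x hx hz
    have hm := hφ.mem_domain hx hy
    have h1 : (coneCoeff mu w₂ (φ.symm (pt x y)))⁻¹ • dd X₁ L (φ.symm (pt x y)) = 0 :=
      (hv _ hm).symm.trans hz
    have h2 := congrArg (fun z => herm z (dd X₁ L (φ.symm (pt x y)))) h1
    simp only [herm_smul_left, h.herm₁₁ _ hm, mul_one] at h2
    rw [show herm 0 (dd X₁ L (φ.symm (pt x y))) = 0 by simp [herm]] at h2
    exact h.coneCoeff_ne_zero h0 hm (inv_eq_zero.1 h2)
  -- Instead of solving f' = σf, f is taken to be the coefficient of N(x, y₀) along N(x₀, y₀); it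
  -- inherits the equation because `herm` is left-linear.
  set n₀ : ℍ[ℝ] := (herm (N x₀ y₀) (N x₀ y₀))⁻¹ with hn₀
  set f : ℝ → ℍ[ℝ] := fun x => herm (N x y₀) (N x₀ y₀) * n₀ with hf
  have hfd : ∀ x ∈ Ioo a b, HasDerivAt f (σ x * f x) x := by
    intro x hx
    have h1 := ((hermCLM (N x₀ y₀)).hasFDerivAt.comp_hasDerivAt x (hNd y₀ hy₀ x hx)).mul_const n₀
    refine h1.congr_deriv ?_
    rw [hermCLM_apply, herm_smul_left, mul_assoc]
  have hf0 : f x₀ = 1 := by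
    have : herm (N x₀ y₀) (N x₀ y₀) ≠ 0 := by
      rw [herm_self]
      rw [Ne, ← Quaternion.coe_zero, Quaternion.coe_inj]
      exact pow_ne_zero 2 (norm_ne_zero_iff.2 (hN0 y₀ hy₀ x₀ hx₀))
    exact mul_inv_cancel₀ this
  have hNy : ContDiffOn ℝ ∞ (fun t => N t y₀) (Ioo a b) :=
    (hφ.contDiffOn_left h.smooth hy₀).sub contDiffOn_const
  refine ⟨φ, a, b, c, d, f, fun y => N x₀ y, huφ, hφ.source_subset, hφ.smooth, hφ.smooth_symm,
    hφ.target_eq, (contDiffOn_herm hNy contDiffOn_const).mul contDiffOn_const,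
    (hφ.contDiffOn_right h.smooth hx₀).sub contDiffOn_const, fun w hw => ?_⟩
  obtain ⟨hx, hy⟩ := hφ.mem_rect hw
  have key := eq_zero_of_hasDerivAt_smul (σ := σ)
    (Q := fun t => N t (φ w 1) - f t • N x₀ (φ w 1)) (N := fun t => N t (φ w 1))
    (fun t ht => by
      refine ((hNd _ hy t ht).sub ((hfd t ht).smul_const (N x₀ (φ w 1)))).congr_deriv ?_
      exact ((smul_sub _ _ _).trans (by rw [smul_smul])).symm)
    (hNd _ hy) (hN0 _ hy) hx₀ hx (by simp [hf0])
  have hL : N (φ w 0) (φ w 1) = L w - v := by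
    rw [hN]
    dsimp only
    rw [pt_eta, φ.left_inv hw]
  rw [sub_eq_zero, hL] at key
  rw [← key]; abel

end Cone

/-! ### Construction of the adapted frame data from the geometric hypotheses. -/

section Construction

theorem exists_eq_combination {x y : Plane}
    (hxy : ∀ a b : ℝ, a • x + b • y = 0 → a = 0 ∧ b = 0) (v : Plane) :
    ∃ a b : ℝ, v = a • x + b • y := by
  have hli : LinearIndependent ℝ ![x, y] := LinearIndependent.pair_iff.2 hxy
  have htop := hli.span_eq_top_of_card_eq_finrank' (by simp)
  have hv : v ∈ Submodule.span ℝ (Set.range ![x, y]) := by rw [htop]; trivial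
  rw [Matrix.range_cons, Matrix.range_cons, Matrix.range_empty, Set.union_empty,
    Set.singleton_union, Submodule.mem_span_pair] at hv
  obtain ⟨a, b, hab⟩ := hv
  exact ⟨a, b, hab.symm⟩

theorem eq_of_sub_mem_of_orthogonal {T : Plane →L[ℝ] H2} {x y : H2}
    (hx : ∀ v, inner ℝ x (T v) = (0 : ℝ)) (hy : ∀ v, inner ℝ y (T v) = (0 : ℝ))
    (hxy : ∃ v, x - y = T v) : x = y := by
  obtain ⟨v, hv⟩ := hxy
  have : inner ℝ (x - y) (x - y) = (0 : ℝ) := by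
    conv_lhs => rw [hv, ← hv, inner_sub_left]
    rw [hv, hx, hy, sub_zero]
  exact sub_eq_zero.1 (inner_self_eq_zero.1 this)

/-- The Gauss equation of a flat immersion at `u`: the normal parts of the second partial
derivatives satisfy `⟨h₀₀, h₁₁⟩ = |h₀₁|²`. -/
def FlatGaussAt (L : Plane → H2) (u : Plane) : Prop :=
  ∃ A B C : H2,
    (∀ v, inner ℝ A (fderiv ℝ L u v) = (0 : ℝ)) ∧ (∀ v, inner ℝ B (fderiv ℝ L u v) = (0 : ℝ)) ∧
    (∀ v, inner ℝ C (fderiv ℝ L u v) = (0 : ℝ)) ∧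
    (∃ v, fderiv ℝ (fderiv ℝ L) u (EuclideanSpace.single 0 1) (EuclideanSpace.single 0 1) - A =
      fderiv ℝ L u v) ∧
    (∃ v, fderiv ℝ (fderiv ℝ L) u (EuclideanSpace.single 0 1) (EuclideanSpace.single 1 1) - B =
      fderiv ℝ L u v) ∧
    (∃ v, fderiv ℝ (fderiv ℝ L) u (EuclideanSpace.single 1 1) (EuclideanSpace.single 1 1) - C =
      fderiv ℝ L u v) ∧
    inner ℝ A C = (inner ℝ B B : ℝ)

theorem plane_eq_combination (v : Plane) :
    v = v 0 • (EuclideanSpace.single 0 1 : Plane) + v 1 • (EuclideanSpace.single 1 1 : Plane) := by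
  ext i; fin_cases i <;> simp

/-- The Gauss equation for arbitrary tangent vectors `v, w`. -/
theorem FlatGaussAt.inner_eq {L : Plane → H2} {u : Plane} (h : FlatGaussAt L u)
    (hsymm : ∀ v w, fderiv ℝ (fderiv ℝ L) u v w = fderiv ℝ (fderiv ℝ L) u w v)
    {v w : Plane} {x y z : H2} (hx : ∀ v, inner ℝ x (fderiv ℝ L u v) = (0 : ℝ))
    (hy : ∀ v, inner ℝ y (fderiv ℝ L u v) = (0 : ℝ))
    (hz : ∀ v, inner ℝ z (fderiv ℝ L u v) = (0 : ℝ))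
    (hvv : ∃ t, fderiv ℝ (fderiv ℝ L) u v v - x = fderiv ℝ L u t)
    (hvw : ∃ t, fderiv ℝ (fderiv ℝ L) u v w - y = fderiv ℝ L u t)
    (hww : ∃ t, fderiv ℝ (fderiv ℝ L) u w w - z = fderiv ℝ L u t) :
    inner ℝ x z = (inner ℝ y y : ℝ) := by
  obtain ⟨A, B, C, hA, hB, hC, ⟨tA, htA⟩, ⟨tB, htB⟩, ⟨tC, htC⟩, hABC⟩ := h
  have key : ∀ (v w : Plane) (n : H2), (∀ v, inner ℝ n (fderiv ℝ L u v) = (0 : ℝ)) →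
      (∃ t, fderiv ℝ (fderiv ℝ L) u v w - n = fderiv ℝ L u t) →
      n = (v 0 * w 0) • A + (v 0 * w 1 + v 1 * w 0) • B + (v 1 * w 1) • C := by
    rintro v w n hn ⟨t, ht⟩
    refine eq_of_sub_mem_of_orthogonal hn (fun t => ?_) ⟨(v 0 * w 0) • tA
      + (v 0 * w 1 + v 1 * w 0) • tB + (v 1 * w 1) • tC - t, ?_⟩
    · simp only [inner_add_left, inner_smul_left, hA, hB, hC]; simp
    · have e := bilin_combination (fderiv ℝ (fderiv ℝ L) u) (EuclideanSpace.single 0 1)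
        (EuclideanSpace.single 1 1) (v 0) (v 1) (w 0) (w 1)
      rw [← plane_eq_combination, ← plane_eq_combination,
        hsymm (EuclideanSpace.single 1 1) (EuclideanSpace.single 0 1)] at e
      rw [map_sub, map_add, map_add, map_smul, map_smul, map_smul, ← htA, ← htB, ← htC, ← ht, e]
      module
  rw [key v v x hx hvv, key v w y hy hvw, key w w z hz hww]
  have hBA := real_inner_comm A B
  have hCA := real_inner_comm A C
  have hCB := real_inner_comm B C
  simp only [inner_add_left, inner_add_right, inner_smul_left, inner_smul_right, hBA, hCA, hCB]
  simp only [conj_trivial]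
  -- Under a change of tangent vectors the Gauss expression is multiplied by the squared
  -- determinant.
  linear_combination ((v 0 * w 1 - v 1 * w 0) ^ 2) * hABC

variable {L : Plane → H2} {X₁ X₂ : Plane → Plane} {V : Set Plane}

theorem inner_smul_fderiv_eq_zero {u v w : Plane}
    (h : PerpIJK (fderiv ℝ L u v) (fderiv ℝ L u w)) {q : ℍ[ℝ]} (hq : q.re = 0) :
    inner ℝ (q • fderiv ℝ L u v) (fderiv ℝ L u w) = (0 : ℝ) := by
  rw [inner_eq_herm_re, herm_smul_left, ← Quaternion.re_add_im (herm _ _), (perpIJK_iff _ _).1 h]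
  simp [hq]

/-- The normal parts of the second derivatives are prescribed by l and m, except that of X₂E₁, which
follows from X₁E₂ and the bracket. Differentiated orthonormality relations reduce the tangential
parts to two real functions. -/
theorem exists_umbFrame (hV : IsOpen V) (hL : ContDiffOn ℝ ∞ L V) (h₁ : ContDiffOn ℝ ∞ X₁ V)
    (h₂ : ContDiffOn ℝ ∞ X₂ V)
    (hlag : ∀ u ∈ V, ∀ v w, PerpIJK (fderiv ℝ L u v) (fderiv ℝ L u w))
    (hn₁ : ∀ u ∈ V, inner ℝ (dd X₁ L u) (dd X₁ L u) = (1 : ℝ))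
    (hn₂ : ∀ u ∈ V, inner ℝ (dd X₂ L u) (dd X₂ L u) = (1 : ℝ))
    (hn₁₂ : ∀ u ∈ V, inner ℝ (dd X₁ L u) (dd X₂ L u) = (0 : ℝ))
    (hflat : ∀ u ∈ V, FlatGaussAt L u)
    (humb : ∀ u ∈ V, ∃ l m : ℍ[ℝ], l.re = 0 ∧ m.re = 0 ∧
      (∃ t, dd X₁ (dd X₁ L) u - l • dd X₁ L u = fderiv ℝ L u t) ∧
      (∃ t, dd X₁ (dd X₂ L) u - m • dd X₂ L u = fderiv ℝ L u t) ∧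
      (∃ t, dd X₂ (dd X₂ L) u - m • dd X₁ L u = fderiv ℝ L u t)) :
    ∃ (lam mu : Plane → ℍ[ℝ]) (w₁ w₂ : Plane → ℝ), UmbFrame L X₁ X₂ V lam mu w₁ w₂ := by
  have hE₁ := contDiffOn_dd hV h₁ hL
  have hE₂ := contDiffOn_dd hV h₂ hL
  have hE₁₁ := contDiffOn_dd hV h₁ hE₁
  have hE₁₂ := contDiffOn_dd hV h₁ hE₂
  have hE₂₁ := contDiffOn_dd hV h₂ hE₁
  have hn₂₁ : ∀ u ∈ V, inner ℝ (dd X₂ L u) (dd X₁ L u) = (0 : ℝ) := fun u hu => by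
    rw [real_inner_comm, hn₁₂ u hu]
  have hherm : ∀ u ∈ V, ∀ v w, herm (fderiv ℝ L u v) (fderiv ℝ L u w) =
      ((inner ℝ (fderiv ℝ L u v) (fderiv ℝ L u w) : ℝ) : ℍ[ℝ]) := fun u hu v w => by
    rw [inner_eq_herm_re]
    conv_lhs => rw [← Quaternion.re_add_im (herm _ _), (perpIJK_iff _ _).1 (hlag u hu v w),
      add_zero]
  have H₁₁ : ∀ u ∈ V, herm (dd X₁ L u) (dd X₁ L u) = 1 := fun u hu => by
    rw [dd, hherm u hu, ← dd, hn₁ u hu]; rfl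
  have H₂₂ : ∀ u ∈ V, herm (dd X₂ L u) (dd X₂ L u) = 1 := fun u hu => by
    rw [dd, hherm u hu, ← dd, hn₂ u hu]; rfl
  have H₁₂ : ∀ u ∈ V, herm (dd X₁ L u) (dd X₂ L u) = 0 := fun u hu => by
    rw [dd, dd, hherm u hu, ← dd, ← dd, hn₁₂ u hu]; rfl
  have H₂₁ : ∀ u ∈ V, herm (dd X₂ L u) (dd X₁ L u) = 0 := fun u hu => by
    rw [← star_herm, H₁₂ u hu, star_zero]
  have hspan : ∀ u ∈ V, ∀ v : Plane, ∃ a b : ℝ, v = a • X₁ u + b • X₂ u := fun u hu =>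
    exists_eq_combination fun a b hab => by
      have h0 : a • dd X₁ L u + b • dd X₂ L u = 0 := by
        have := congrArg (fderiv ℝ L u) hab
        simpa [dd] using this
      constructor
      · simpa [inner_add_left, inner_smul_left, hn₁ u hu, hn₂₁ u hu, -inner_self_eq_norm_sq_to_K]
          using congrArg (fun z => (inner ℝ z (dd X₁ L u) : ℝ)) h0
      · simpa [inner_add_left, inner_smul_left, hn₂ u hu, hn₁₂ u hu, -inner_self_eq_norm_sq_to_K]
          using congrArg (fun z => (inner ℝ z (dd X₂ L u) : ℝ)) h0
  have htan : ∀ u ∈ V, ∀ z : H2, (∃ t, z = fderiv ℝ L u t) →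
      ∃ a b : ℝ, z = a • dd X₁ L u + b • dd X₂ L u := by
    rintro u hu z ⟨t, rfl⟩
    obtain ⟨a, b, rfl⟩ := hspan u hu t
    exact ⟨a, b, by simp [dd]⟩
  have der : ∀ u ∈ V, ∀ (X : Plane → Plane) (f g : Plane → H2) (c : ℝ), ContDiffOn ℝ ∞ f V →
      ContDiffOn ℝ ∞ g V → (∀ w ∈ V, inner ℝ (f w) (g w) = c) →
      inner ℝ (f u) (dd X g u) + inner ℝ (dd X f u) (g u) = (0 : ℝ) := by
    intro u hu X f g c hf hg hc
    rw [← dd_inner (ContDiffOn.diffAt hf hV hu) (ContDiffOn.diffAt hg hV hu),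
      dd_congr hV hc hu, dd_const]
  have main : ∀ u ∈ V, ∃ l m : ℍ[ℝ], l.re = 0 ∧ m.re = 0 ∧
      inner ℝ l m = (inner ℝ m m : ℝ) ∧
      ∃ a b : ℝ, dd X₁ (dd X₁ L) u = l • dd X₁ L u + a • dd X₂ L u ∧
        dd X₂ (dd X₁ L) u = m • dd X₂ L u + b • dd X₂ L u ∧
        dd X₁ (dd X₂ L) u = m • dd X₂ L u - a • dd X₁ L u ∧
        dd X₂ (dd X₂ L) u = m • dd X₁ L u - b • dd X₁ L u ∧
        dd X₁ X₂ u - dd X₂ X₁ u = -(a • X₁ u) - b • X₂ u := by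
    intro u hu
    obtain ⟨l, m, hl, hm, T₁₁, T₁₂, T₂₂⟩ := humb u hu
    have d₁₁ := der u hu X₁ _ _ _ hE₁ hE₁ hn₁
    have d₁₂ := der u hu X₁ _ _ _ hE₁ hE₂ hn₁₂
    have d₂₂ := der u hu X₁ _ _ _ hE₂ hE₂ hn₂
    have d₁₁' := der u hu X₂ _ _ _ hE₁ hE₁ hn₁
    have d₁₂' := der u hu X₂ _ _ _ hE₁ hE₂ hn₁₂
    have d₂₂' := der u hu X₂ _ _ _ hE₂ hE₂ hn₂
    rw [real_inner_comm] at d₁₁ d₁₁' d₂₂ d₂₂'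
    have iq : ∀ q : ℍ[ℝ], q.re = 0 → ∀ v w, inner ℝ (q • fderiv ℝ L u v) (fderiv ℝ L u w) =
        (0 : ℝ) := fun q hq v w => inner_smul_fderiv_eq_zero (hlag u hu v w) hq
    obtain ⟨a, a', ha⟩ := htan u hu _ T₁₁
    obtain ⟨b, b', hb⟩ := htan u hu _ T₁₂
    obtain ⟨c, c', hc⟩ := htan u hu _ T₂₂
    obtain ⟨s, s', hs⟩ := hspan u hu (dd X₁ X₂ u - dd X₂ X₁ u)
    rw [sub_eq_iff_eq_add] at ha hb hc
    have hbr := dd_dd_sub (X := X₁) (Y := X₂) hV h₁ h₂ hL hu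
    -- This expresses X₂E₁ as X₁E₂ minus the image of the bracket.
    rw [hs, map_add, map_smul, map_smul, ← dd, ← dd, hb, sub_eq_iff_eq_add, ← sub_eq_iff_eq_add']
      at hbr
    have iE : ∀ q : ℍ[ℝ], q.re = 0 → inner ℝ (q • dd X₁ L u) (dd X₁ L u) = (0 : ℝ) ∧
        inner ℝ (q • dd X₁ L u) (dd X₂ L u) = (0 : ℝ) ∧
        inner ℝ (q • dd X₂ L u) (dd X₁ L u) = (0 : ℝ) ∧
        inner ℝ (q • dd X₂ L u) (dd X₂ L u) = (0 : ℝ) := fun q hq =>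
      ⟨iq q hq _ _, iq q hq _ _, iq q hq _ _, iq q hq _ _⟩
    have il := iE l hl
    have im' := iE m hm
    have iEr : ∀ z w : H2, inner ℝ z w = (inner ℝ w z : ℝ) := fun z w => real_inner_comm w z
    rw [iEr (dd X₁ L u) (dd X₁ (dd X₂ L) u)] at d₁₂
    rw [iEr (dd X₁ L u) (dd X₂ (dd X₂ L) u)] at d₁₂'
    rw [ha] at d₁₁ d₁₂
    rw [hb] at d₁₂ d₂₂
    rw [hc] at d₁₂' d₂₂'
    rw [← hbr] at d₁₁' d₁₂'
    simp only [inner_add_left, inner_sub_left, inner_smul_left, conj_trivial, hn₁ u hu, hn₂ u hu,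
      hn₁₂ u hu, hn₂₁ u hu, il.1, il.2.1, im'.1, im'.2.1, im'.2.2.1, im'.2.2.2]
      at d₁₁ d₁₂ d₂₂ d₁₁' d₁₂' d₂₂'
    have ea : a = 0 := by linarith
    have eb' : b' = 0 := by linarith
    have eb : b = -a' := by linarith
    have ec' : c' = 0 := by linarith
    have es : s = -a' := by linarith
    have es' : s' = c := by linarith
    subst ea eb' eb ec' es es'
    have hsymm := fderiv_fderiv_symm hV hL hu
    have tan : ∀ (X Y : Plane → Plane) (n : H2), ContDiffOn ℝ ∞ Y V →
        (∃ t, dd X (dd Y L) u - n = fderiv ℝ L u t) →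
        ∃ t, fderiv ℝ (fderiv ℝ L) u (X u) (Y u) - n = fderiv ℝ L u t := by
      rintro X Y n hY ⟨t, ht⟩
      refine ⟨t - dd X Y u, ?_⟩
      rw [map_sub, ← ht, dd_dd hV hY hL hu]; abel
    have hg := (hflat u hu).inner_eq hsymm (fun v => iq l hl _ v) (fun v => iq m hm _ v)
      (fun v => iq m hm _ v) (tan X₁ X₁ _ h₁ T₁₁) (tan X₁ X₂ _ h₂ T₁₂) (tan X₂ X₂ _ h₂ T₂₂)
    refine ⟨l, m, hl, hm, ?_, a', -s', ?_, ?_, ?_, ?_, ?_⟩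
    · have h1 : ∀ q r : ℍ[ℝ], ∀ E : H2, herm E E = 1 →
          inner ℝ (q • E) (r • E) = (inner ℝ q r : ℝ) := fun q r E hE => by
        rw [inner_eq_herm_re, herm_smul_left, ← star_herm, herm_smul_left, hE, Quaternion.inner_def]
        simp
      rwa [← dd, ← dd, h1 _ _ _ (H₁₁ u hu), h1 _ _ _ (H₂₂ u hu)] at hg
    · rw [ha]; generalize l • dd X₁ L u = z; module
    · rw [← hbr]; generalize m • dd X₂ L u = z; module
    · rw [hb]; generalize m • dd X₂ L u = z; module
    · rw [hc]; generalize m • dd X₁ L u = z; module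
    · rw [hs]; module
  have hiE : ∀ u ∈ V, ∀ q : ℍ[ℝ], q.re = 0 →
      inner ℝ (q • dd X₁ L u) (dd X₂ L u) = (0 : ℝ) ∧
      inner ℝ (q • dd X₂ L u) (dd X₂ L u) = (0 : ℝ) := fun u hu q hq =>
    ⟨inner_smul_fderiv_eq_zero (hlag u hu _ _) hq, inner_smul_fderiv_eq_zero (hlag u hu _ _) hq⟩
  -- The given l and m exist only pointwise; recovering them as Hermitian products makes them smooth
  -- in u.
  set lam : Plane → ℍ[ℝ] := fun u => herm (dd X₁ (dd X₁ L) u) (dd X₁ L u) with hlam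
  set mu : Plane → ℍ[ℝ] := fun u => herm (dd X₁ (dd X₂ L) u) (dd X₂ L u) with hmu
  set w₁ : Plane → ℝ := fun u => inner ℝ (dd X₁ (dd X₁ L) u) (dd X₂ L u) with hw₁
  set w₂ : Plane → ℝ := fun u => inner ℝ (dd X₂ (dd X₁ L) u) (dd X₂ L u) with hw₂
  have main' : ∀ u ∈ V, (lam u).re = 0 ∧ (mu u).re = 0 ∧
      inner ℝ (lam u) (mu u) = (inner ℝ (mu u) (mu u) : ℝ) ∧
      dd X₁ (dd X₁ L) u = lam u • dd X₁ L u + w₁ u • dd X₂ L u ∧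
        dd X₂ (dd X₁ L) u = mu u • dd X₂ L u + w₂ u • dd X₂ L u ∧
        dd X₁ (dd X₂ L) u = mu u • dd X₂ L u - w₁ u • dd X₁ L u ∧
        dd X₂ (dd X₂ L) u = mu u • dd X₁ L u - w₂ u • dd X₁ L u ∧
        dd X₁ X₂ u - dd X₂ X₁ u = -(w₁ u • X₁ u) - w₂ u • X₂ u := by
    intro u hu
    obtain ⟨l, m, hl, hm, hg, a, b, e₁₁, e₂₁, e₁₂, e₂₂, hbr⟩ := main u hu
    have e1 : lam u = l := by
      rw [hlam]; dsimp only
      rw [e₁₁, herm_add_left, herm_smul_left, herm_rsmul_left, H₁₁ u hu, H₂₁ u hu]; simp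
    have e2 : mu u = m := by
      rw [hmu]; dsimp only
      rw [e₁₂, herm_sub_left, herm_smul_left, herm_rsmul_left, H₂₂ u hu, H₁₂ u hu]; simp
    have e3 : w₁ u = a := by
      rw [hw₁]; dsimp only
      rw [e₁₁, inner_add_left, inner_smul_left, (hiE u hu l hl).1, hn₂ u hu]; simp
    have e4 : w₂ u = b := by
      rw [hw₂]; dsimp only
      rw [e₂₁, inner_add_left, inner_smul_left, (hiE u hu m hm).2, hn₂ u hu]; simp
    rw [e1, e2, e3, e4]
    exact ⟨hl, hm, hg, e₁₁, e₂₁, e₁₂, e₂₂, hbr⟩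
  exact ⟨lam, mu, w₁, w₂,
    { isOpen := hV
      smooth := hL
      smooth₁ := h₁
      smooth₂ := h₂
      smooth_lam := contDiffOn_herm hE₁₁ hE₁
      smooth_mu := contDiffOn_herm hE₁₂ hE₂
      smooth_w₁ := hE₁₁.inner ℝ hE₂
      smooth_w₂ := hE₂₁.inner ℝ hE₂
      lam_re := fun u hu => (main' u hu).1
      mu_re := fun u hu => (main' u hu).2.1
      gauss := fun u hu => (main' u hu).2.2.1
      herm₁₁ := H₁₁
      herm₂₂ := H₂₂
      herm₁₂ := H₁₂
      dd₁₁ := fun u hu => (main' u hu).2.2.2.1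
      dd₂₁ := fun u hu => (main' u hu).2.2.2.2.1
      dd₁₂ := fun u hu => (main' u hu).2.2.2.2.2.1
      dd₂₂ := fun u hu => (main' u hu).2.2.2.2.2.2.1
      bracket := fun u hu => (main' u hu).2.2.2.2.2.2.2
      span := hspan }⟩

end Construction

/-! ### From vanishing intrinsic curvature to the extrinsic Gauss equation. -/

section GaussEquation

variable {M : Type*} [TopologicalSpace M] [ChartedSpace Plane M] [IsManifold (𝓡 2) ∞ M]
  {g : SmoothMetric M} {L : M → H2} {e : OpenPartialHomeomorph M Plane}

/-- The constant coordinate vector field of the plane. -/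
def coordField (i : Fin 2) : Plane → Plane := fun _ => EuclideanSpace.single i 1

theorem pd_eq_dd (i : Fin 2) (F : Plane → ℝ) (u : Plane) : pd i F u = dd (coordField i) F u := rfl

theorem dd_coordField_comm {F : Type*} [NormedAddCommGroup F] [NormedSpace ℝ F] {f : Plane → F}
    {V : Set Plane} (hV : IsOpen V) (hf : ContDiffOn ℝ ∞ f V) {u : Plane} (hu : u ∈ V)
    (i j : Fin 2) :
    dd (coordField i) (dd (coordField j) f) u = dd (coordField j) (dd (coordField i) f) u := by
  rw [← sub_eq_zero, dd_dd_sub (X := coordField i) (Y := coordField j) hV contDiffOn_const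
    contDiffOn_const hf hu, show dd (coordField i) (coordField j) u = 0 from dd_const _,
    show dd (coordField j) (coordField i) u = 0 from dd_const _, sub_zero, map_zero]

section Chart

variable (he : e ∈ IsManifold.maximalAtlas (𝓡 2) ∞ M) (hL : ContMDiff (𝓡 2) 𝓘(ℝ, H2) ∞ L)
include he

omit [IsManifold (𝓡 2) ∞ M] in
theorem mdifferentiable_of_mem_maximalAtlas : e.MDifferentiable (𝓡 2) (𝓡 2) :=
  ⟨fun _ hx => ((contMDiffOn_of_mem_maximalAtlas he).mdifferentiableOn (by simp)) _ hx,
    fun _ hx => ((contMDiffOn_symm_of_mem_maximalAtlas he).mdifferentiableOn (by simp)) _ hx⟩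

include hL

omit [IsManifold (𝓡 2) ∞ M] in
theorem contDiffOn_comp_symm : ContDiffOn ℝ ∞ (L ∘ e.symm) e.target :=
  (hL.comp_contMDiffOn (contMDiffOn_symm_of_mem_maximalAtlas he)).contDiffOn

omit [IsManifold (𝓡 2) ∞ M] in
theorem dL_mfderiv_symm {u : Plane} (hu : u ∈ e.target) (v : Plane) :
    dL L (e.symm u) (mfderiv 𝓘(ℝ, Plane) (𝓡 2) e.symm u v) = fderiv ℝ (L ∘ e.symm) u v := by
  have h1 : MDifferentiableAt 𝓘(ℝ, Plane) (𝓡 2) e.symm u :=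
    (mdifferentiable_of_mem_maximalAtlas he).mdifferentiableAt_symm hu
  have h2 := mfderiv_comp u (hL.mdifferentiableAt (by simp)) h1
  rw [← mfderiv_eq_fderiv, h2]
  rfl

theorem fderiv_comp_symm_injective (hiso : IsIsometricImmersion g L) {u : Plane}
    (hu : u ∈ e.target) {v : Plane} (hv : fderiv ℝ (L ∘ e.symm) u v = 0) : v = 0 := by
  rw [← dL_mfderiv_symm he hL hu] at hv
  have h1 := hiso.2 (e.symm u) (mfderiv 𝓘(ℝ, Plane) (𝓡 2) e.symm u v)
    (mfderiv 𝓘(ℝ, Plane) (𝓡 2) e.symm u v)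
  rw [hv, inner_zero_left] at h1
  have h2 : mfderiv 𝓘(ℝ, Plane) (𝓡 2) e.symm u v = 0 := by
    by_contra hne
    exact (g.pos _ _ hne).ne h1
  have hinj := (mdifferentiable_of_mem_maximalAtlas he).symm.mfderiv_injective (x := u) hu
  exact hinj (h2.trans (map_zero _).symm)

theorem metricMatrix_eq (hiso : IsIsometricImmersion g L) {u : Plane} (hu : u ∈ e.target)
    (i j : Fin 2) : metricMatrix g e u i j =
      inner ℝ (dd (coordField i) (L ∘ e.symm) u) (dd (coordField j) (L ∘ e.symm) u) := by
  have h1 := hiso.2 (e.symm u) (coordVec e i u) (coordVec e j u)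
  have h2 : ∀ i, dL L (e.symm u) (coordVec e i u) = dd (coordField i) (L ∘ e.symm) u := fun i =>
    dL_mfderiv_symm he hL hu _
  rw [h2, h2] at h1
  exact h1.symm

theorem isUnit_det_metricMatrix (hiso : IsIsometricImmersion g L) {u : Plane}
    (hu : u ∈ e.target) : IsUnit (metricMatrix g e u).det := by
  rw [isUnit_iff_ne_zero]
  intro hdet
  obtain ⟨v, hv0, hv⟩ := Matrix.exists_mulVec_eq_zero_iff.2 hdet
  have h0 := congrFun hv 0
  have h1 := congrFun hv 1
  simp only [Matrix.mulVec, dotProduct, Fin.sum_univ_two, metricMatrix_eq he hL hiso hu,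
    Pi.zero_apply] at h0 h1
  set w : Plane := WithLp.toLp 2 v with hw
  have hd : fderiv ℝ (L ∘ e.symm) u w = v 0 • dd (coordField 0) (L ∘ e.symm) u
      + v 1 • dd (coordField 1) (L ∘ e.symm) u := by
    conv_lhs => rw [plane_eq_combination w]
    simp [dd, coordField, hw]
  have hz : inner ℝ (fderiv ℝ (L ∘ e.symm) u w) (fderiv ℝ (L ∘ e.symm) u w) = (0 : ℝ) := by
    rw [hd]
    simp only [inner_add_left, inner_add_right, inner_smul_left, inner_smul_right, conj_trivial]
    linear_combination v 0 * h0 + v 1 * h1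
  have hw0 := fderiv_comp_symm_injective he hL hiso hu (inner_self_eq_zero.1 hz)
  apply hv0
  exact congrArg WithLp.ofLp hw0

/-- The metric is the Gram matrix of the coordinate derivatives of L; in its three partial
derivatives the mixed terms cancel and one product survives twice. -/
theorem christoffel_eq (hiso : IsIsometricImmersion g L) {u : Plane} (hu : u ∈ e.target)
    (k i j : Fin 2) : christoffel g e k i j u = ∑ l, (metricMatrix g e u)⁻¹ k l *
      inner ℝ (dd (coordField i) (dd (coordField j) (L ∘ e.symm)) u)
        (dd (coordField l) (L ∘ e.symm) u) := by
  have sL := contDiffOn_comp_symm he hL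
  have hd : ∀ i, DifferentiableAt ℝ (dd (coordField i) (L ∘ e.symm)) u := fun i =>
    ContDiffOn.diffAt (contDiffOn_dd e.open_target contDiffOn_const sL) e.open_target hu
  have hpd : ∀ k i j, pd k (fun w => metricMatrix g e w i j) u =
      inner ℝ (dd (coordField i) (L ∘ e.symm) u)
        (dd (coordField k) (dd (coordField j) (L ∘ e.symm)) u) +
      inner ℝ (dd (coordField k) (dd (coordField i) (L ∘ e.symm)) u)
        (dd (coordField j) (L ∘ e.symm) u) := fun k i j => by
    rw [pd_eq_dd, dd_congr e.open_target (fun w hw => metricMatrix_eq he hL hiso hw i j) hu,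
      dd_inner (hd i) (hd j)]
  rw [christoffel, Finset.mul_sum]
  refine Finset.sum_congr rfl fun l _ => ?_
  rw [hpd, hpd, hpd, dd_coordField_comm e.open_target sL hu l i,
    dd_coordField_comm e.open_target sL hu l j, dd_coordField_comm e.open_target sL hu j i,
    real_inner_comm _ (dd (coordField j) (L ∘ e.symm) u),
    real_inner_comm _ (dd (coordField i) (L ∘ e.symm) u)]
  ring

/-- The form of the previous identity with the index lowered can be differentiated without
differentiating the inverse matrix. -/
theorem sum_metricMatrix_mul_christoffel (hiso : IsIsometricImmersion g L) {u : Plane}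
    (hu : u ∈ e.target) (n i j : Fin 2) :
    ∑ k, metricMatrix g e u n k * christoffel g e k i j u =
      inner ℝ (dd (coordField i) (dd (coordField j) (L ∘ e.symm)) u)
        (dd (coordField n) (L ∘ e.symm) u) := by
  set c : Fin 2 → ℝ := fun l => inner ℝ (dd (coordField i) (dd (coordField j) (L ∘ e.symm)) u)
        (dd (coordField l) (L ∘ e.symm) u) with hc
  have h1 : (fun k => christoffel g e k i j u) = (metricMatrix g e u)⁻¹.mulVec c := by
    ext k; rw [christoffel_eq he hL hiso hu]; rfl
  have h2 : (metricMatrix g e u).mulVec (fun k => christoffel g e k i j u) = c := by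
    rw [h1, Matrix.mulVec_mulVec, Matrix.mul_nonsing_inv _ (isUnit_det_metricMatrix he hL hiso hu),
      Matrix.one_mulVec]
  exact congrFun h2 n

theorem contDiffOn_metricMatrix (hiso : IsIsometricImmersion g L) (i j : Fin 2) :
    ContDiffOn ℝ ∞ (fun u => metricMatrix g e u i j) e.target := by
  have sL := contDiffOn_comp_symm he hL
  refine ContDiffOn.congr ?_ (fun u hu => metricMatrix_eq he hL hiso hu i j)
  exact (contDiffOn_dd e.open_target contDiffOn_const sL).inner ℝ
    (contDiffOn_dd e.open_target contDiffOn_const sL)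

theorem contDiffOn_christoffel (hiso : IsIsometricImmersion g L) (k i j : Fin 2) :
    ContDiffOn ℝ ∞ (christoffel g e k i j) e.target := by
  have sL := contDiffOn_comp_symm he hL
  have hm := contDiffOn_metricMatrix he hL hiso
  refine ContDiffOn.congr ?_ (fun u hu => christoffel_eq he hL hiso hu k i j)
  refine ContDiffOn.sum fun l _ => ContDiffOn.mul ?_ ((contDiffOn_dd e.open_target
    contDiffOn_const (contDiffOn_dd e.open_target contDiffOn_const sL)).inner ℝ
    (contDiffOn_dd e.open_target contDiffOn_const sL))
  have hdet : ContDiffOn ℝ ∞ (fun u => ((metricMatrix g e u).det)⁻¹) e.target := by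
    refine ContDiffOn.inv ?_ (fun u hu => (isUnit_det_metricMatrix he hL hiso hu).ne_zero)
    simp only [Matrix.det_fin_two]
    exact ((hm 0 0).mul (hm 1 1)).sub ((hm 0 1).mul (hm 1 0))
  simp only [Matrix.inv_def, Ring.inverse_eq_inv', Matrix.smul_apply, smul_eq_mul]
  refine hdet.mul ?_
  simp only [Matrix.adjugate_fin_two]
  fin_cases k <;> fin_cases l
  · exact hm 1 1
  · exact (hm 0 1).neg
  · exact (hm 1 0).neg
  · exact hm 0 0

/-- Two derivatives of the lowered Christoffel identity contain the same third derivative of L.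
Subtracting them leaves products of second derivatives and derivatives of the Christoffel symbols,
and vanishing curvature converts this into the relation between normal parts. -/
theorem flatGaussAt (hiso : IsIsometricImmersion g L) (hflat : IsFlat g) {u : Plane}
    (hu : u ∈ e.target) : FlatGaussAt (L ∘ e.symm) u := by
  have sL := contDiffOn_comp_symm he hL
  set F := L ∘ e.symm with hF
  have s1 : ∀ i, ContDiffOn ℝ ∞ (dd (coordField i) F) e.target := fun i =>
    contDiffOn_dd e.open_target contDiffOn_const sL
  have s2 : ∀ i j, ContDiffOn ℝ ∞ (dd (coordField i) (dd (coordField j) F)) e.target := fun i j =>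
    contDiffOn_dd e.open_target contDiffOn_const (s1 j)
  have d1 : ∀ i, DifferentiableAt ℝ (dd (coordField i) F) u := fun i =>
    ContDiffOn.diffAt (s1 i) e.open_target hu
  have d2 : ∀ i j, DifferentiableAt ℝ (dd (coordField i) (dd (coordField j) F)) u := fun i j =>
    ContDiffOn.diffAt (s2 i j) e.open_target hu
  have hs : ∀ i j w, w ∈ e.target → dd (coordField i) (dd (coordField j) F) w =
      dd (coordField j) (dd (coordField i) F) w := fun i j w hw =>
    dd_coordField_comm e.open_target sL hw i j
  have dΓ : ∀ k i j, DifferentiableAt ℝ (christoffel g e k i j) u := fun k i j =>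
    ContDiffOn.diffAt (contDiffOn_christoffel he hL hiso k i j) e.open_target hu
  have dG : ∀ i j, DifferentiableAt ℝ (fun w => metricMatrix g e w i j) u := fun i j =>
    ContDiffOn.diffAt (contDiffOn_metricMatrix he hL hiso i j) e.open_target hu
  have hG : ∀ i j, metricMatrix g e u i j =
      inner ℝ (dd (coordField i) F u) (dd (coordField j) F u) := metricMatrix_eq he hL hiso hu
  have hGd : ∀ k i j, dd (coordField k) (fun w => metricMatrix g e w i j) u =
      inner ℝ (dd (coordField k) (dd (coordField j) F) u) (dd (coordField i) F u) +
      inner ℝ (dd (coordField k) (dd (coordField i) F) u) (dd (coordField j) F u) :=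
    fun k i j => by
      rw [dd_congr e.open_target (fun w hw => metricMatrix_eq he hL hiso hw i j) hu,
        dd_inner (d1 i) (d1 j), real_inner_comm _ (dd (coordField i) F u)]
  have hΓ : ∀ n i j, metricMatrix g e u n 0 * christoffel g e 0 i j u +
      metricMatrix g e u n 1 * christoffel g e 1 i j u =
      inner ℝ (dd (coordField i) (dd (coordField j) F) u) (dd (coordField n) F u) :=
    fun n i j => by
      rw [← sum_metricMatrix_mul_christoffel he hL hiso hu, Fin.sum_univ_two]
  have hΓs : ∀ k i j, christoffel g e k i j u = christoffel g e k j i u := fun k i j => by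
    rw [christoffel_eq he hL hiso hu, christoffel_eq he hL hiso hu, ← hF, hs i j u hu]
  have hΓd : ∀ m i j, (metricMatrix g e u 0 0 * dd (coordField m) (christoffel g e 0 i j) u +
      dd (coordField m) (fun w => metricMatrix g e w 0 0) u * christoffel g e 0 i j u) +
      (metricMatrix g e u 0 1 * dd (coordField m) (christoffel g e 1 i j) u +
      dd (coordField m) (fun w => metricMatrix g e w 0 1) u * christoffel g e 1 i j u) =
      inner ℝ (dd (coordField i) (dd (coordField j) F) u)
        (dd (coordField m) (dd (coordField 0) F) u) +
      inner ℝ (dd (coordField m) (dd (coordField i) (dd (coordField j) F)) u)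
        (dd (coordField 0) F u) := fun m i j => by
    rw [← dd_inner (d2 i j) (d1 0), ← dd_mul (dG 0 0) (dΓ 0 i j), ← dd_mul (dG 0 1) (dΓ 1 i j),
      ← dd_add ((dG 0 0).fun_mul (dΓ 0 i j)) ((dG 0 1).fun_mul (dΓ 1 i j))]
    refine dd_congr e.open_target (fun w hw => ?_) hu
    rw [← sum_metricMatrix_mul_christoffel he hL hiso hw, Fin.sum_univ_two]
  have hR : ∀ l, riemann g e l 1 0 1 u = 0 := fun l => hflat e he u hu l 1 0 1
  have R0 := hR 0
  have R1 := hR 1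
  simp only [riemann, pd_eq_dd, Fin.sum_univ_two] at R0 R1
  have E1 := hΓd 0 1 1
  have E2 := hΓd 1 0 1
  have hthird : dd (coordField 0) (dd (coordField 1) (dd (coordField 1) F)) u =
      dd (coordField 1) (dd (coordField 0) (dd (coordField 1) F)) u :=
    dd_coordField_comm e.open_target (s1 1) hu 0 1
  rw [hthird] at E1
  rw [hs 1 0 u hu] at E2
  rw [hGd, hGd] at E1 E2
  rw [hs 1 0 u hu, ← hΓ, ← hΓ, ← hΓ] at E2
  rw [← hΓ, ← hΓ, ← hΓ] at E1
  rw [hΓs 0 1 0] at R0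
  rw [hΓs 1 1 0] at R1
  have hGs : metricMatrix g e u 1 0 = metricMatrix g e u 0 1 := by
    rw [hG, hG, real_inner_comm]
  -- the normal components of the second derivatives
  set N : Fin 2 → Fin 2 → H2 := fun i j => dd (coordField i) (dd (coordField j) F) u
    - (christoffel g e 0 i j u • dd (coordField 0) F u
      + christoffel g e 1 i j u • dd (coordField 1) F u) with hN
  have hNF : ∀ i j n, inner ℝ (N i j) (dd (coordField n) F u) = (0 : ℝ) := fun i j n => by
    rw [hN]
    simp only [inner_sub_left, inner_add_left, inner_smul_left, conj_trivial]
    rw [← hΓ n i j, hG, hG, real_inner_comm (dd (coordField n) F u),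
      real_inner_comm (dd (coordField n) F u)]
    ring
  have hNt : ∀ i j v, inner ℝ (N i j) (fderiv ℝ F u v) = (0 : ℝ) := fun i j v => by
    have : fderiv ℝ F u v = v 0 • dd (coordField 0) F u + v 1 • dd (coordField 1) F u := by
      conv_lhs => rw [plane_eq_combination v]
      simp [dd, coordField]
    rw [this, inner_add_right, inner_smul_right, inner_smul_right, hNF, hNF]
    simp
  have hND : ∀ i j, ∃ v, fderiv ℝ (fderiv ℝ F) u (EuclideanSpace.single i 1)
      (EuclideanSpace.single j 1) - N i j = fderiv ℝ F u v := fun i j => by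
    refine ⟨christoffel g e 0 i j u • EuclideanSpace.single 0 1
      + christoffel g e 1 i j u • EuclideanSpace.single 1 1, ?_⟩
    have h1 := dd_dd (X := coordField i) (Y := coordField j) e.open_target contDiffOn_const sL hu
    have h2 : dd (coordField i) (coordField j) u = 0 := dd_const _
    rw [h2, map_zero, add_zero] at h1
    rw [hN]
    dsimp only
    rw [h1, map_add, map_smul, map_smul]
    simp [dd, coordField]
  refine ⟨N 0 0, N 0 1, N 1 1, hNt 0 0, hNt 0 1, hNt 1 1, hND 0 0, hND 0 1, hND 1 1, ?_⟩
  have hX : ∀ (i j : Fin 2) (x : H2), inner ℝ x (N i j) =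
      inner ℝ x (dd (coordField i) (dd (coordField j) F) u)
      - (christoffel g e 0 i j u * inner ℝ x (dd (coordField 0) F u)
        + christoffel g e 1 i j u * inner ℝ x (dd (coordField 1) F u)) := fun i j x => by
    simp only [hN, inner_sub_right, inner_add_right, inner_smul_right]
  rw [hX 1 1, hX 0 1 (N 0 1), hNF, hNF, hNF, hNF, real_inner_comm _ (N 0 0),
    real_inner_comm _ (N 0 1), hX 0 0, hX 0 1, real_inner_comm _ (dd (coordField 0) _ u),
    ← hΓ, ← hΓ, ← hΓ, ← hΓ]
  rw [hGs] at E1 E2 ⊢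
  -- The last two terms are the curvature component with its upper index lowered to 0.
  linear_combination E2 - E1 + metricMatrix g e u 0 0 * R0 + metricMatrix g e u 0 1 * R1

end Chart

end GaussEquation

/-! ### Passage between the manifold and a chart. -/

section Transfer

variable {M : Type*} [TopologicalSpace M] [ChartedSpace Plane M] [IsManifold (𝓡 2) ∞ M]
  {g : SmoothMetric M} {L : M → H2} {e : OpenPartialHomeomorph M Plane}

/-- The coordinate expression of a vector field in the chart `e`. -/
def pullField (e : OpenPartialHomeomorph M Plane) (X : ∀ q : M, TangentSpace (𝓡 2) q)
    (u : Plane) : Plane :=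
  mfderiv (𝓡 2) (𝓡 2) e (e.symm u) (X (e.symm u))

theorem dd_dd_of_differentiableAt {F : Type*} [NormedAddCommGroup F] [NormedSpace ℝ F]
    {X Y : Plane → Plane} {f : Plane → F} {u : Plane}
    (hf : DifferentiableAt ℝ (fderiv ℝ f) u) (hY : DifferentiableAt ℝ Y u) :
    dd X (dd Y f) u = fderiv ℝ (fderiv ℝ f) u (X u) (Y u) + fderiv ℝ f u (dd X Y u) := by
  rw [dd, show dd Y f = fun w => fderiv ℝ f w (Y w) from rfl, fderiv_clm_apply hf hY]
  simp [dd, add_comm]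

variable (he : e ∈ IsManifold.maximalAtlas (𝓡 2) ∞ M)
include he

theorem contDiffAt_pullField {X : ∀ q : M, TangentSpace (𝓡 2) q} {u : Plane} (hu : u ∈ e.target)
    (hX : ContMDiffAt (𝓡 2) (𝓡 2).tangent ∞ (fun q => (⟨q, X q⟩ : TangentBundle (𝓡 2) M))
      (e.symm u)) : ContDiffAt ℝ ∞ (pullField e X) u := by
  have : IsManifold (𝓡 2) 1 M := IsManifold.of_le (n := ∞) (by simp)
  have h1 : ContMDiffOn (𝓡 2).tangent (𝓡 2).tangent ∞
      (tangentMapWithin (𝓡 2) (𝓡 2) e e.source) (TotalSpace.proj ⁻¹' e.source) :=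
    (contMDiffOn_of_mem_maximalAtlas he).contMDiffOn_tangentMapWithin (by simp)
      e.open_source.uniqueMDiffOn
  have hq : e.symm u ∈ e.source := e.map_target hu
  have hopen : IsOpen ((TotalSpace.proj : TangentBundle (𝓡 2) M → M) ⁻¹' e.source) :=
    e.open_source.preimage (FiberBundle.continuous_proj _ _)
  have h2 := h1.contMDiffAt (x := (⟨e.symm u, X (e.symm u)⟩ : TangentBundle (𝓡 2) M))
    (hopen.mem_nhds hq)
  have h3 := h2.comp (e.symm u) hX
  have h4 := (contMDiff_snd_tangentBundle_modelSpace (n := ∞) Plane (𝓡 2)).contMDiffAt.comp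
    (e.symm u) h3
  have h5 := h4.comp u (contMDiffAt_symm_of_mem_maximalAtlas he hu)
  refine h5.contDiffAt.congr_of_eventuallyEq ?_
  filter_upwards [e.open_target.mem_nhds hu] with w hw
  have : mfderivWithin (𝓡 2) (𝓡 2) e e.source (e.symm w) = mfderiv (𝓡 2) (𝓡 2) e (e.symm w) :=
    mfderivWithin_of_isOpen e.open_source (e.map_target hw)
  exact (congrArg (fun T => T (X (e.symm w))) this).symm

omit [IsManifold (𝓡 2) ∞ M] in
-- Stated for a general G because it is applied both to L and to the function q ↦ dL(Y q) occurring
-- in `sff`.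
theorem dL_eq_fderiv {G : M → H2} {u : Plane} (hu : u ∈ e.target)
    (hG : DifferentiableAt ℝ (G ∘ e.symm) u) (v : TangentSpace (𝓡 2) (e.symm u)) :
    dL G (e.symm u) v = fderiv ℝ (G ∘ e.symm) u (mfderiv (𝓡 2) (𝓡 2) e (e.symm u) v) := by
  have hm := mdifferentiable_of_mem_maximalAtlas he
  have hq : e.symm u ∈ e.source := e.map_target hu
  have h1 : HasMFDerivAt (𝓡 2) (𝓡 2) e (e.symm u) (mfderiv (𝓡 2) (𝓡 2) e (e.symm u)) :=
    (hm.mdifferentiableAt hq).hasMFDerivAt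
  have h2 : HasMFDerivAt (𝓡 2) 𝓘(ℝ, H2) (G ∘ e.symm) (e (e.symm u))
      (fderiv ℝ (G ∘ e.symm) u) := by
    rw [e.right_inv hu]
    exact hG.hasFDerivAt.hasMFDerivAt
  have h3 := h2.comp (e.symm u) h1
  have h4 : G =ᶠ[𝓝 (e.symm u)] (G ∘ e.symm) ∘ e := by
    filter_upwards [e.open_source.mem_nhds hq] with q hq
    simp [e.left_inv hq]
  have h5 := (h3.congr_of_eventuallyEq h4).mfderiv
  rw [dL, h5]
  rfl

variable (hL : ContMDiff (𝓡 2) 𝓘(ℝ, H2) ∞ L)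
include hL

omit [IsManifold (𝓡 2) ∞ M] in
theorem dL_eq_dd {u : Plane} (hu : u ∈ e.target) (Y : ∀ q : M, TangentSpace (𝓡 2) q) :
    dL L (e.symm u) (Y (e.symm u)) = dd (pullField e Y) (L ∘ e.symm) u :=
  dL_eq_fderiv he hu (ContDiffOn.diffAt (contDiffOn_comp_symm he hL) e.open_target hu) _

omit [IsManifold (𝓡 2) ∞ M] in
theorem range_dL {u : Plane} (hu : u ∈ e.target) :
    LinearMap.range (dL L (e.symm u)).toLinearMap =
      LinearMap.range (fderiv ℝ (L ∘ e.symm) u).toLinearMap := by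
  apply le_antisymm
  · rintro _ ⟨v, rfl⟩
    exact ⟨_, (dL_eq_fderiv he hu
      (ContDiffOn.diffAt (contDiffOn_comp_symm he hL) e.open_target hu) v).symm⟩
  · rintro _ ⟨v, rfl⟩
    exact ⟨_, dL_mfderiv_symm he hL hu v⟩

omit [IsManifold (𝓡 2) ∞ M] in
theorem sff_eq {u : Plane} (hu : u ∈ e.target) (X Y : ∀ q : M, TangentSpace (𝓡 2) q)
    (hY : DifferentiableAt ℝ (pullField e Y) u) :
    sff L X Y (e.symm u) = (LinearMap.range (fderiv ℝ (L ∘ e.symm) u).toLinearMap)ᗮ.starProjection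
      (dd (pullField e X) (dd (pullField e Y) (L ∘ e.symm)) u) := by
  have sL := contDiffOn_comp_symm he hL
  have h1 : ((fun q => dL L q (Y q)) ∘ e.symm) =ᶠ[𝓝 u] dd (pullField e Y) (L ∘ e.symm) := by
    filter_upwards [e.open_target.mem_nhds hu] with w hw
    exact dL_eq_dd he hL hw Y
  have h2 : DifferentiableAt ℝ (dd (pullField e Y) (L ∘ e.symm)) u :=
    (ContDiffOn.diffAt (sL.fderiv_of_isOpen e.open_target (by simp)) e.open_target hu).clm_apply hY
  have h3 := dL_eq_fderiv he hu (G := fun q => dL L q (Y q)) (h2.congr_of_eventuallyEq h1)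
    (X (e.symm u))
  rw [h1.fderiv_eq] at h3
  have h4 := range_dL he hL hu
  rw [sff, h3]
  simp only [h4]
  rfl

omit [IsManifold (𝓡 2) ∞ M] he hL in
theorem exists_sub_eq_of_starProjection_eq {T : Plane →L[ℝ] H2} {z n : H2}
    (h : (LinearMap.range T.toLinearMap)ᗮ.starProjection z = n) : ∃ t, z - n = T t := by
  have h1 := Submodule.sub_starProjection_mem_orthogonal
    (K := (LinearMap.range T.toLinearMap)ᗮ) z
  rw [Submodule.orthogonal_orthogonal, h] at h1
  obtain ⟨t, ht⟩ := h1
  exact ⟨t, ht.symm⟩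

omit [IsManifold (𝓡 2) ∞ M] he hL in
theorem starProjection_eq_of_orthogonal {T : Plane →L[ℝ] H2} {z n : H2}
    (hn : ∀ v, inner ℝ n (T v) = (0 : ℝ)) (h : ∃ t, z - n = T t) :
    (LinearMap.range T.toLinearMap)ᗮ.starProjection z = n := by
  obtain ⟨t, ht⟩ := h
  refine Submodule.eq_starProjection_of_mem_orthogonal' (z := T t) ?_ ?_ ?_
  · rw [Submodule.mem_orthogonal']
    rintro _ ⟨v, rfl⟩
    exact hn v
  · exact Submodule.le_orthogonal_orthogonal _ ⟨t, rfl⟩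
  · rw [← ht]; abel

end Transfer

theorem differentiableAt_fderiv {F : Type*} [NormedAddCommGroup F] [NormedSpace ℝ F]
    {f : Plane → F} {V : Set Plane} (hV : IsOpen V) (hf : ContDiffOn ℝ ∞ f V) {u : Plane}
    (hu : u ∈ V) : DifferentiableAt ℝ (fderiv ℝ f) u :=
  ContDiffOn.diffAt (hf.fderiv_of_isOpen hV (by simp)) hV hu

/-- If lam and mu vanish at u, all second derivatives of L along the frame are tangent, and
bilinearity extends this to all fields; this is used to exclude lam = 0 when mu = 0. -/
theorem UmbFrame.exists_dd_dd_eq {L : Plane → H2} {X₁ X₂ : Plane → Plane} {V : Set Plane}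
    {lam mu : Plane → ℍ[ℝ]} {w₁ w₂ : Plane → ℝ} (h : UmbFrame L X₁ X₂ V lam mu w₁ w₂)
    {u : Plane} (hu : u ∈ V) (hl : lam u = 0) (hm : mu u = 0) (X : Plane → Plane)
    {Y : Plane → Plane} (dY : DifferentiableAt ℝ Y u) :
    ∃ t, dd X (dd Y L) u = fderiv ℝ L u t := by
  set R := LinearMap.range (fderiv ℝ L u).toLinearMap with hR
  have hmem : ∀ v, fderiv ℝ L u v ∈ R := fun v => ⟨v, rfl⟩
  have dF : DifferentiableAt ℝ (fderiv ℝ L) u :=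
    differentiableAt_fderiv h.isOpen h.smooth hu
  have d₁ := ContDiffOn.diffAt h.smooth₁ h.isOpen hu
  have d₂ := ContDiffOn.diffAt h.smooth₂ h.isOpen hu
  have k₁₁ := h.dd₁₁ u hu
  have k₁₂ := h.dd₁₂ u hu
  have k₂₁ := h.dd₂₁ u hu
  have k₂₂ := h.dd₂₂ u hu
  rw [hl, zero_smul, zero_add] at k₁₁
  rw [hm, zero_smul, zero_add] at k₂₁
  rw [hm, zero_smul, zero_sub] at k₁₂ k₂₂
  rw [dd_dd_of_differentiableAt dF d₁, ← eq_sub_iff_add_eq] at k₁₁ k₂₁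
  rw [dd_dd_of_differentiableAt dF d₂, ← eq_sub_iff_add_eq] at k₁₂ k₂₂
  suffices hs : dd X (dd Y L) u ∈ R by
    obtain ⟨t, ht⟩ := hs
    exact ⟨t, ht.symm⟩
  obtain ⟨a, b, hab⟩ := h.span u hu (X u)
  obtain ⟨c, d, hcd⟩ := h.span u hu (Y u)
  rw [dd_dd_of_differentiableAt dF dY, hab, hcd, bilin_combination, k₁₁, k₁₂, k₂₁, k₂₂]
  have s1 : ∀ (r : ℝ) v, r • fderiv ℝ L u v ∈ R := fun r v => R.smul_mem r (hmem v)
  refine R.add_mem (R.add_mem (R.add_mem (R.add_mem ?_ ?_) ?_) ?_) (hmem _)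
  · exact R.smul_mem _ (R.sub_mem (s1 _ _) (hmem _))
  · exact R.smul_mem _ (R.sub_mem (R.neg_mem (s1 _ _)) (hmem _))
  · exact R.smul_mem _ (R.sub_mem (s1 _ _) (hmem _))
  · exact R.smul_mem _ (R.sub_mem (R.neg_mem (s1 _ _)) (hmem _))

/-! ### Umbilical frames on the surface, and transport of the local forms back to it. -/

section Frames

variable {M : Type*} [TopologicalSpace M] [ChartedSpace Plane M] [IsManifold (𝓡 2) ∞ M]
  {g : SmoothMetric M} {L : M → H2}

/-- A smooth orthonormal frame over the open set `U` in which the second fundamental form of `L`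
has the H-umbilical shape. -/
structure IsUmbilicalFrame (g : SmoothMetric M) (L : M → H2) (U : Set M)
    (e₁ e₂ : ∀ q : M, TangentSpace (𝓡 2) q) : Prop where
  isOpen : IsOpen U
  smooth₁ : ContMDiffOn (𝓡 2) (𝓡 2).tangent ∞ (fun q => (⟨q, e₁ q⟩ : TangentBundle (𝓡 2) M)) U
  smooth₂ : ContMDiffOn (𝓡 2) (𝓡 2).tangent ∞ (fun q => (⟨q, e₂ q⟩ : TangentBundle (𝓡 2) M)) U
  orthonormal : ∀ q ∈ U, g.inner q (e₁ q) (e₁ q) = 1 ∧ g.inner q (e₂ q) (e₂ q) = 1 ∧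
    g.inner q (e₁ q) (e₂ q) = 0
  umbilical : ∀ q ∈ U, ∃ l m : ℍ[ℝ], l.re = 0 ∧ m.re = 0 ∧
    sff L e₁ e₁ q = l • dL L q (e₁ q) ∧ sff L e₁ e₂ q = m • dL L q (e₂ q) ∧
    sff L e₂ e₂ q = m • dL L q (e₁ q)

theorem IsUmbilicalFrame.mono {U U' : Set M} {e₁ e₂ : ∀ q : M, TangentSpace (𝓡 2) q}
    (hF : IsUmbilicalFrame g L U e₁ e₂) (hU' : IsOpen U') (hsub : U' ⊆ U) :
    IsUmbilicalFrame g L U' e₁ e₂ where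
  isOpen := hU'
  smooth₁ := hF.smooth₁.mono hsub
  smooth₂ := hF.smooth₂.mono hsub
  orthonormal q hq := hF.orthonormal q (hsub hq)
  umbilical q hq := hF.umbilical q (hsub hq)

theorem im_smul_eq (a b c : ℝ) (z : H2) :
    a • qi • z + b • qj • z + c • qk • z = im a b c • z := by
  rw [← smul_assoc, ← smul_assoc, ← smul_assoc, ← add_smul, ← add_smul]
  congr 1
  apply QuaternionAlgebra.ext
  · change a * 0 + b * 0 + c * 0 = 0
    ring
  · change a * 1 + b * 0 + c * 0 = a
    ring
  · change a * 0 + b * 1 + c * 0 = b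
    ring
  · change a * 0 + b * 0 + c * 1 = c
    ring

theorem IsHUmbilical.exists_frame (humb : IsHUmbilical g L) (p : M) :
    ∃ (U : Set M) (e₁ e₂ : ∀ q : M, TangentSpace (𝓡 2) q),
      p ∈ U ∧ IsUmbilicalFrame g L U e₁ e₂ := by
  obtain ⟨U, hU, hp, e₁, e₂, s₁, s₂, ho, l₁, l₂, l₃, m₁, m₂, m₃, hs⟩ := humb p
  refine ⟨U, e₁, e₂, hp, hU, s₁, s₂, ho, fun q hq => ?_⟩
  obtain ⟨h1, h2, h3⟩ := hs q hq
  rw [im_smul_eq] at h1 h2 h3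
  exact ⟨_, _, rfl, rfl, h1, h2, h3⟩

theorem exists_chart (p : M) : ∃ e ∈ IsManifold.maximalAtlas (𝓡 2) ∞ M, ∃ u ∈ e.target,
    e.symm u = p :=
  ⟨chartAt Plane p, IsManifold.chart_mem_maximalAtlas p, chartAt Plane p p,
    mem_chart_target Plane p, (chartAt Plane p).left_inv (mem_chart_source Plane p)⟩

section Chart

variable {e : OpenPartialHomeomorph M Plane} {U : Set M}
  {e₁ e₂ : ∀ q : M, TangentSpace (𝓡 2) q} {V : Set Plane}
  {lam mu : Plane → ℍ[ℝ]} {w₁ w₂ : Plane → ℝ} {u : Plane}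

omit [ChartedSpace Plane M] [IsManifold (𝓡 2) ∞ M] in
theorem eventually_of_chart {Q : M → Prop} (hu : u ∈ e.target)
    (h : ∀ᶠ w in 𝓝 u, Q (e.symm w)) : ∀ᶠ q in 𝓝 (e.symm u), Q q := by
  have hq : e.symm u ∈ e.source := e.map_target hu
  have h1 : Tendsto e (𝓝 (e.symm u)) (𝓝 u) := by
    have := e.continuousAt hq
    rwa [ContinuousAt, e.right_inv hu] at this
  filter_upwards [h1.eventually h, e.open_source.mem_nhds hq] with q h2 h3
  rwa [e.left_inv h3] at h2

variable (he : e ∈ IsManifold.maximalAtlas (𝓡 2) ∞ M)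
include he

theorem isCoordRect_trans {φ : OpenPartialHomeomorph Plane Plane} {a b c d : ℝ}
    (hV : V ⊆ e.target) (hu : u ∈ φ.source) (hsub : φ.source ⊆ V)
    (hφ : ContDiffOn ℝ ∞ φ φ.source) (hφ' : ContDiffOn ℝ ∞ φ.symm φ.target)
    (ht : φ.target = {u : Plane | u 0 ∈ Ioo a b ∧ u 1 ∈ Ioo c d}) :
    IsCoordRect (e ≫ₕ φ) (e.symm u) a b c d where
  mem_atlas := by
    apply OpenPartialHomeomorph.mem_maximalAtlas_of_contMDiffOn
    · rw [OpenPartialHomeomorph.coe_trans]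
      refine hφ.contMDiffOn.comp ((contMDiffOn_of_mem_maximalAtlas he).mono ?_) ?_
      · exact fun q hq => hq.1
      · exact fun q hq => hq.2
    · rw [OpenPartialHomeomorph.coe_trans_symm]
      refine (contMDiffOn_symm_of_mem_maximalAtlas he).comp
        (hφ'.contMDiffOn.mono fun q hq => hq.1) fun q hq => hq.2
  mem_source := by
    refine ⟨e.map_target (hV (hsub hu)), ?_⟩
    change e (e.symm u) ∈ φ.source
    rwa [e.right_inv (hV (hsub hu))]
  target_eq := by
    rw [← ht, OpenPartialHomeomorph.trans_target]
    exact inter_eq_left.2 fun w hw => hV (hsub (φ.map_target hw))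

theorem RuledForm.exists_coordRect {Q : (ℝ → H2) → Set ℝ → Prop}
    (h : RuledForm (L ∘ e.symm) V u Q) (hV : V ⊆ e.target) :
    ∃ (e' : OpenPartialHomeomorph M Plane) (a b c d : ℝ) (D P : ℝ → H2),
      IsCoordRect e' (e.symm u) a b c d ∧ ContDiffOn ℝ ∞ D (Ioo a b) ∧ Q P (Ioo a b) ∧
      ∀ q ∈ e'.source, L q = D (e' q 0) + (e' q 1) • P (e' q 0) := by
  obtain ⟨φ, a, b, c, d, D, P, hu, hsub, hφ, hφ', ht, hD, hP, hf⟩ := h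
  refine ⟨e ≫ₕ φ, a, b, c, d, D, P, isCoordRect_trans he hV hu hsub hφ hφ' ht, hD, hP,
    fun q hq => ?_⟩
  have h1 := hf (e q) hq.2
  rwa [Function.comp_apply, e.left_inv hq.1] at h1

theorem RuledForm.isRuledNear (h : RuledForm (L ∘ e.symm) V u IsLegendre) (hV : V ⊆ e.target) :
    IsRuledNear L (e.symm u) :=
  h.exists_coordRect he hV

theorem RuledForm.isSpecialRuledNear (h : RuledForm (L ∘ e.symm) V u IsSpecialLegendre)
    (hV : V ⊆ e.target) : IsSpecialRuledNear L (e.symm u) :=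
  h.exists_coordRect he hV

theorem RuledForm.isCylinderNear
    (h : RuledForm (L ∘ e.symm) V u (fun P S => ∃ c, ∀ t ∈ S, P t = c)) (hV : V ⊆ e.target) :
    IsCylinderNear L (e.symm u) := by
  obtain ⟨e', a, b, c, d, D, P, hc, hD, ⟨k, hk⟩, hf⟩ := h.exists_coordRect he hV
  refine ⟨e', a, b, c, d, D, k, hc, hD, fun q hq => ?_⟩
  have h1 := e'.map_source hq
  rw [hc.target_eq] at h1
  rw [hf q hq, hk _ h1.1]

theorem ConeForm.isConeNear {v : H2} (h : ConeForm (L ∘ e.symm) V u v) (hV : V ⊆ e.target) :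
    IsConeNear L v (e.symm u) := by
  obtain ⟨φ, a, b, c, d, f, A, hu, hsub, hφ, hφ', ht, hf, hA, hfA⟩ := h
  refine ⟨e ≫ₕ φ, a, b, c, d, f, A, isCoordRect_trans he hV hu hsub hφ hφ' ht, hf, hA,
    fun q hq => ?_⟩
  have h1 := hfA (e q) hq.2
  rwa [Function.comp_apply, e.left_inv hq.1] at h1

omit [IsManifold (𝓡 2) ∞ M] in
theorem perpIJK_fderiv (hL : ContMDiff (𝓡 2) 𝓘(ℝ, H2) ∞ L) (hlag : IsLagrangian L)
    (hu : u ∈ e.target) (v w : Plane) :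
    PerpIJK (fderiv ℝ (L ∘ e.symm) u v) (fderiv ℝ (L ∘ e.symm) u w) := by
  rw [← dL_mfderiv_symm he hL hu v, ← dL_mfderiv_symm he hL hu w]
  exact hlag _ _ _

theorem IsUmbilicalFrame.exists_umbFrame (hflat : IsFlat g) (hiso : IsIsometricImmersion g L)
    (hlag : IsLagrangian L) (hF : IsUmbilicalFrame g L U e₁ e₂) :
    ∃ (lam mu : Plane → ℍ[ℝ]) (w₁ w₂ : Plane → ℝ), UmbFrame (L ∘ e.symm) (pullField e e₁)
      (pullField e e₂) (e.target ∩ e.symm ⁻¹' U) lam mu w₁ w₂ := by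
  have hL := hiso.1
  have s₁ : ∀ u ∈ e.target ∩ e.symm ⁻¹' U, ContDiffAt ℝ ∞ (pullField e e₁) u := fun u hu =>
    contDiffAt_pullField he hu.1 (hF.smooth₁.contMDiffAt (hF.isOpen.mem_nhds hu.2))
  have s₂ : ∀ u ∈ e.target ∩ e.symm ⁻¹' U, ContDiffAt ℝ ∞ (pullField e e₂) u := fun u hu =>
    contDiffAt_pullField he hu.1 (hF.smooth₂.contMDiffAt (hF.isOpen.mem_nhds hu.2))
  refine QLag.exists_umbFrame (e.isOpen_inter_preimage_symm hF.isOpen)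
    ((contDiffOn_comp_symm he hL).mono inter_subset_left)
    (fun u hu => (s₁ u hu).contDiffWithinAt) (fun u hu => (s₂ u hu).contDiffWithinAt)
    (fun u hu v w => perpIJK_fderiv he hL hlag hu.1 v w)
    (fun u hu => ?_) (fun u hu => ?_) (fun u hu => ?_)
    (fun u hu => flatGaussAt he hL hiso hflat hu.1) (fun u hu => ?_)
  · rw [← dL_eq_dd he hL hu.1, hiso.2, (hF.orthonormal _ hu.2).1]
  · rw [← dL_eq_dd he hL hu.1, hiso.2, (hF.orthonormal _ hu.2).2.1]
  · rw [← dL_eq_dd he hL hu.1, ← dL_eq_dd he hL hu.1, hiso.2, (hF.orthonormal _ hu.2).2.2]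
  · obtain ⟨l, m, hl, hm, h₁₁, h₁₂, h₂₂⟩ := hF.umbilical _ hu.2
    have d₁ := (s₁ u hu).differentiableAt (by simp)
    have d₂ := (s₂ u hu).differentiableAt (by simp)
    rw [sff_eq he hL hu.1 _ _ d₁, dL_eq_dd he hL hu.1] at h₁₁
    rw [sff_eq he hL hu.1 _ _ d₂, dL_eq_dd he hL hu.1] at h₁₂ h₂₂
    exact ⟨l, m, hl, hm, exists_sub_eq_of_starProjection_eq h₁₁,
      exists_sub_eq_of_starProjection_eq h₁₂, exists_sub_eq_of_starProjection_eq h₂₂⟩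

omit [IsManifold (𝓡 2) ∞ M] in
-- This lets the vanishing of mu be stated on M as h(e₂, e₂) = 0, independently of the chart.
theorem UmbFrame.sff_eq_smul (hL : ContMDiff (𝓡 2) 𝓘(ℝ, H2) ∞ L) (hlag : IsLagrangian L)
    (h : UmbFrame (L ∘ e.symm) (pullField e e₁) (pullField e e₂) V lam mu w₁ w₂)
    (hV : V ⊆ e.target) (hu : u ∈ V) :
    sff L e₂ e₂ (e.symm u) = mu u • dd (pullField e e₁) (L ∘ e.symm) u := by
  rw [sff_eq he hL (hV hu) _ _ (ContDiffOn.diffAt h.smooth₂ h.isOpen hu)]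
  refine starProjection_eq_of_orthogonal (fun v => ?_) ⟨-(w₂ u • pullField e e₁ u), ?_⟩
  · exact inner_smul_fderiv_eq_zero (perpIJK_fderiv he hL hlag (hV hu) _ _) (h.mu_re u hu)
  · rw [h.dd₂₂ u hu, map_neg, map_smul, ← dd]
    abel

omit [IsManifold (𝓡 2) ∞ M] in
theorem UmbFrame.sff_eq_zero_iff (hL : ContMDiff (𝓡 2) 𝓘(ℝ, H2) ∞ L) (hlag : IsLagrangian L)
    (h : UmbFrame (L ∘ e.symm) (pullField e e₁) (pullField e e₂) V lam mu w₁ w₂)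
    (hV : V ⊆ e.target) (hu : u ∈ V) : sff L e₂ e₂ (e.symm u) = 0 ↔ mu u = 0 := by
  rw [h.sff_eq_smul he hL hlag hV hu, smul_eq_zero, or_iff_left]
  intro h0
  have := h.inner₁₁ hu
  rw [h0, inner_zero_left] at this
  exact zero_ne_one this

theorem UmbFrame.isTotallyGeodesicAt (hL : ContMDiff (𝓡 2) 𝓘(ℝ, H2) ∞ L)
    (h : UmbFrame (L ∘ e.symm) (pullField e e₁) (pullField e e₂) V lam mu w₁ w₂)
    (hV : V ⊆ e.target) (hu : u ∈ V) (hl : lam u = 0) (hm : mu u = 0) :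
    IsTotallyGeodesicAt L (e.symm u) := by
  intro X Y hX hY
  have dY := (contDiffAt_pullField he (hV hu) hY).differentiableAt (by simp)
  rw [sff_eq he hL (hV hu) _ _ dY]
  refine starProjection_eq_of_orthogonal (fun v => inner_zero_left _) ?_
  obtain ⟨t, ht⟩ := h.exists_dd_dd_eq hu hl hm (pullField e X) dY
  exact ⟨t, by rw [ht, sub_zero]⟩

end Chart

end Frames

/-! ### Globalization by connectedness and density. -/

section Global

variable {M : Type*} [TopologicalSpace M] [ChartedSpace Plane M] [IsManifold (𝓡 2) ∞ M]
  {g : SmoothMetric M} {L : M → H2} {U U' : Set M} {e₁ e₂ e₁' e₂' : ∀ q : M, TangentSpace (𝓡 2) q}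

/-- Near `p` the position vector relative to `v` is a quaternionic multiple of the first vector of
an umbilical frame. -/
def IsVertexNear (g : SmoothMetric M) (L : M → H2) (p : M) (v : H2) : Prop :=
  ∃ (U : Set M) (e₁ e₂ : ∀ q : M, TangentSpace (𝓡 2) q), IsUmbilicalFrame g L U e₁ e₂ ∧ p ∈ U ∧
    ∀ q ∈ U, ∃ s : ℍ[ℝ], L q - v = s • dL L q (e₁ q)

variable (hflat : IsFlat g) (hiso : IsIsometricImmersion g L) (hlag : IsLagrangian L)
include hflat hiso hlag

theorem IsUmbilicalFrame.sff_eq_zero_of_sff_eq_zero (hF : IsUmbilicalFrame g L U e₁ e₂)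
    (hF' : IsUmbilicalFrame g L U' e₁' e₂') {p : M} (hp : p ∈ U) (hp' : p ∈ U')
    (h0 : sff L e₂ e₂ p = 0) : sff L e₂' e₂' p = 0 := by
  obtain ⟨e, he, u, hu, rfl⟩ := exists_chart p
  obtain ⟨lam, mu, w₁, w₂, h⟩ := hF.exists_umbFrame he hflat hiso hlag
  obtain ⟨lam', mu', w₁', w₂', h'⟩ := hF'.exists_umbFrame he hflat hiso hlag
  rw [h.sff_eq_zero_iff he hiso.1 hlag inter_subset_left ⟨hu, hp⟩] at h0
  rw [h'.sff_eq_zero_iff he hiso.1 hlag inter_subset_left ⟨hu, hp'⟩]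
  exact h.mu_eq_zero_of_mu_eq_zero h' ⟨hu, hp⟩ ⟨hu, hp'⟩ h0

theorem IsUmbilicalFrame.eventually_sff_eq_zero (hF : IsUmbilicalFrame g L U e₁ e₂) {p : M}
    (hp : p ∈ U) (h0 : sff L e₂ e₂ p = 0) : ∀ᶠ q in 𝓝 p, sff L e₂ e₂ q = 0 := by
  obtain ⟨e, he, u, hu, rfl⟩ := exists_chart p
  obtain ⟨lam, mu, w₁, w₂, h⟩ := hF.exists_umbFrame he hflat hiso hlag
  have hz := fun w hw => h.sff_eq_zero_iff he hiso.1 hlag inter_subset_left (u := w) hw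
  refine eventually_of_chart hu ?_
  filter_upwards [h.eventually_mu_eq_zero ⟨hu, hp⟩ ((hz u ⟨hu, hp⟩).1 h0),
    h.isOpen.mem_nhds ⟨hu, hp⟩] with w h1 h2
  exact (hz w h2).2 h1

theorem IsUmbilicalFrame.eventually_sff_ne_zero (hF : IsUmbilicalFrame g L U e₁ e₂) {p : M}
    (hp : p ∈ U) (h0 : sff L e₂ e₂ p ≠ 0) : ∀ᶠ q in 𝓝 p, sff L e₂ e₂ q ≠ 0 := by
  obtain ⟨e, he, u, hu, rfl⟩ := exists_chart p
  obtain ⟨lam, mu, w₁, w₂, h⟩ := hF.exists_umbFrame he hflat hiso hlag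
  have hz := fun w hw => (h.sff_eq_zero_iff he hiso.1 hlag inter_subset_left (u := w) hw).not
  refine eventually_of_chart hu ?_
  have hc : ContinuousAt mu u := (ContDiffOn.diffAt h.smooth_mu h.isOpen ⟨hu, hp⟩).continuousAt
  filter_upwards [hc.eventually_ne ((hz u ⟨hu, hp⟩).1 h0), h.isOpen.mem_nhds ⟨hu, hp⟩] with w h1 h2
  exact (hz w h2).2 h1

/-- By connectedness the second fundamental form either vanishes or does not vanish on the second
vector of every umbilical frame. -/
theorem sff_eq_zero_or_ne_zero [PreconnectedSpace M] (humb : IsHUmbilical g L) :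
    (∀ (U : Set M) (e₁ e₂ : ∀ q : M, TangentSpace (𝓡 2) q), IsUmbilicalFrame g L U e₁ e₂ →
      ∀ q ∈ U, sff L e₂ e₂ q = 0) ∨
    (∀ (U : Set M) (e₁ e₂ : ∀ q : M, TangentSpace (𝓡 2) q), IsUmbilicalFrame g L U e₁ e₂ →
      ∀ q ∈ U, sff L e₂ e₂ q ≠ 0) := by
  -- Quantifying over all frames costs nothing, since vanishing in one frame implies vanishing in
  -- every other. Openness of A comes from the linear system for |mu|², closedness from continuity
  -- of mu.
  set A : Set M := {p | ∀ (U : Set M) (e₁ e₂ : ∀ q : M, TangentSpace (𝓡 2) q),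
    IsUmbilicalFrame g L U e₁ e₂ → p ∈ U → sff L e₂ e₂ p = 0} with hA
  have hclopen : IsClopen A := by
    constructor
    · rw [← isOpen_compl_iff, isOpen_iff_eventually]
      intro p hp
      simp only [hA, mem_compl_iff, mem_ofPred_eq, not_forall] at hp
      obtain ⟨U, e₁, e₂, hF, hpU, h0⟩ := hp
      filter_upwards [hF.eventually_sff_ne_zero hflat hiso hlag hpU h0,
        hF.isOpen.mem_nhds hpU] with q h1 h2 h3
      exact h1 (h3 U e₁ e₂ hF h2)
    · rw [isOpen_iff_eventually]
      intro p hp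
      obtain ⟨U, e₁, e₂, hpU, hF⟩ := humb.exists_frame p
      filter_upwards [hF.eventually_sff_eq_zero hflat hiso hlag hpU (hp U e₁ e₂ hF hpU),
        hF.isOpen.mem_nhds hpU] with q h1 h2 U' e₁' e₂' hF' h3
      exact hF.sff_eq_zero_of_sff_eq_zero hflat hiso hlag hF' h2 h3 h1
  rcases isClopen_iff.1 hclopen with hempty | huniv
  · refine Or.inr fun U e₁ e₂ hF q hq h0 => ?_
    have : q ∈ A := fun U' e₁' e₂' hF' hq' =>
      hF.sff_eq_zero_of_sff_eq_zero hflat hiso hlag hF' hq hq' h0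
    rw [hempty] at this
    exact this
  · refine Or.inl fun U e₁ e₂ hF q hq => ?_
    have : q ∈ A := huniv ▸ mem_univ q
    exact this U e₁ e₂ hF hq

theorem IsUmbilicalFrame.exists_vertex (hF : IsUmbilicalFrame g L U e₁ e₂)
    (hne : ∀ q ∈ U, sff L e₂ e₂ q ≠ 0) {p : M} (hp : p ∈ U) :
    ∃ v, IsVertexNear g L p v ∧ IsConeNear L v p := by
  obtain ⟨e, he, u, hu, rfl⟩ := exists_chart p
  obtain ⟨lam, mu, w₁, w₂, h⟩ := hF.exists_umbFrame he hflat hiso hlag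
  have h0 : ∀ w ∈ e.target ∩ e.symm ⁻¹' U, mu w ≠ 0 := fun w hw =>
    (h.sff_eq_zero_iff he hiso.1 hlag inter_subset_left hw).not.1 (hne _ hw.2)
  obtain ⟨v, hv⟩ := h.eventually_eq_vertex h0 ⟨hu, hp⟩
  obtain ⟨V', hV', hV'o, huV'⟩ := eventually_nhds_iff.1 (hv.and (h.isOpen.mem_nhds ⟨hu, hp⟩))
  have hsub : V' ⊆ e.target ∩ e.symm ⁻¹' U := fun w hw => (hV' w hw).2
  have hcone := (h.mono hV'o hsub).coneForm (fun w hw => h0 w (hsub hw))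
    (fun w hw => (hV' w hw).1) huV'
  refine ⟨v, ⟨e.source ∩ e ⁻¹' V', e₁, e₂,
    hF.mono (e.isOpen_inter_preimage hV'o) fun q hq => ?_, ?_, fun q hq => ?_⟩,
    hcone.isConeNear he (hsub.trans inter_subset_left)⟩
  · have := (hsub hq.2).2
    rwa [mem_preimage, e.left_inv hq.1] at this
  · refine ⟨e.map_target hu, ?_⟩
    rwa [mem_preimage, e.right_inv hu]
  · have h1 := (hV' _ hq.2).1
    rw [← dL_eq_dd he hiso.1 (e.map_source hq.1), Function.comp_apply, e.left_inv hq.1] at h1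
    exact ⟨_, h1⟩

/-- The first vectors of the two frames are real multiples of each other, so v − v' is near p a
quaternionic multiple of E₁, and such a constant is zero. -/
theorem IsVertexNear.eq (hne : ∀ (U : Set M) (e₁ e₂ : ∀ q : M, TangentSpace (𝓡 2) q),
    IsUmbilicalFrame g L U e₁ e₂ → ∀ q ∈ U, sff L e₂ e₂ q ≠ 0) {p : M} {v v' : H2}
    (hv : IsVertexNear g L p v) (hv' : IsVertexNear g L p v') : v = v' := by
  obtain ⟨U, e₁, e₂, hF, hp, hU⟩ := hv
  obtain ⟨U', e₁', e₂', hF', hp', hU'⟩ := hv'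
  obtain ⟨e, he, u, hu, rfl⟩ := exists_chart p
  obtain ⟨lam, mu, w₁, w₂, h⟩ := hF.exists_umbFrame he hflat hiso hlag
  obtain ⟨lam', mu', w₁', w₂', h'⟩ := hF'.exists_umbFrame he hflat hiso hlag
  have h0 : ∀ w ∈ e.target ∩ e.symm ⁻¹' U, mu w ≠ 0 := fun w hw =>
    (h.sff_eq_zero_iff he hiso.1 hlag inter_subset_left hw).not.1 (hne U e₁ e₂ hF _ hw.2)
  have key : v - v' = 0 := by
    refine h.eq_zero_of_eventually_smul_dd₁ h0 ⟨hu, hp⟩ ?_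
    filter_upwards [h.isOpen.mem_nhds ⟨hu, hp⟩, h'.isOpen.mem_nhds ⟨hu, hp'⟩] with w hw hw'
    obtain ⟨s, hs⟩ := hU _ hw.2
    obtain ⟨s', hs'⟩ := hU' _ hw'.2
    obtain ⟨a, ha⟩ := h.exists_dd₁_eq_smul h' hw hw' (h0 w hw)
    rw [dL_eq_dd he hiso.1 hw.1] at hs hs'
    rw [ha, ← coe_smul_H2, smul_smul] at hs'
    exact ⟨s' * a - s, by rw [sub_smul, ← hs, ← hs']; abel⟩
  exact sub_eq_zero.1 key

/-- A frame witnessing a vertex at p witnesses the same vertex at all nearby points, so by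
uniqueness the vertex is locally constant. -/
theorem exists_cone_vertex [ConnectedSpace M] (humb : IsHUmbilical g L)
    (hne : ∀ (U : Set M) (e₁ e₂ : ∀ q : M, TangentSpace (𝓡 2) q),
      IsUmbilicalFrame g L U e₁ e₂ → ∀ q ∈ U, sff L e₂ e₂ q ≠ 0) :
    ∃ v, ∀ p, IsConeNear L v p := by
  have hex : ∀ p, ∃ v, IsVertexNear g L p v ∧ IsConeNear L v p := fun p => by
    obtain ⟨U, e₁, e₂, hp, hF⟩ := humb.exists_frame p
    exact hF.exists_vertex hflat hiso hlag (hne U e₁ e₂ hF) hp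
  choose v hv hcone using hex
  have hloc : IsLocallyConstant v := by
    rw [IsLocallyConstant.iff_exists_open]
    intro p
    obtain ⟨U, e₁, e₂, hF, hp, hU⟩ := hv p
    exact ⟨U, hF.isOpen, hp, fun q hq => IsVertexNear.eq hflat hiso hlag hne (hv q)
      ⟨U, e₁, e₂, hF, hq, hU⟩⟩
  obtain ⟨p₀⟩ := (inferInstance : Nonempty M)
  refine ⟨v p₀, fun p => ?_⟩
  rw [hloc.apply_eq_of_preconnectedSpace p₀ p]
  exact hcone p

theorem IsUmbilicalFrame.exists_umbFrame_ruled (hF : IsUmbilicalFrame g L U e₁ e₂)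
    (hntg : ∀ p : M, ¬ IsTotallyGeodesicAt L p) (hz : ∀ q ∈ U, sff L e₂ e₂ q = 0)
    {e : OpenPartialHomeomorph M Plane} (he : e ∈ IsManifold.maximalAtlas (𝓡 2) ∞ M) :
    ∃ (lam mu : Plane → ℍ[ℝ]) (w₁ w₂ : Plane → ℝ), UmbFrame (L ∘ e.symm) (pullField e e₁)
      (pullField e e₂) (e.target ∩ e.symm ⁻¹' U) lam mu w₁ w₂ ∧
      (∀ w ∈ e.target ∩ e.symm ⁻¹' U, mu w = 0) ∧
      ∀ w ∈ e.target ∩ e.symm ⁻¹' U, lam w ≠ 0 := by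
  obtain ⟨lam, mu, w₁, w₂, h⟩ := hF.exists_umbFrame he hflat hiso hlag
  have h0 : ∀ w ∈ e.target ∩ e.symm ⁻¹' U, mu w = 0 := fun w hw =>
    (h.sff_eq_zero_iff he hiso.1 hlag inter_subset_left hw).1 (hz _ hw.2)
  exact ⟨lam, mu, w₁, w₂, h, h0, fun w hw hl =>
    hntg _ (h.isTotallyGeodesicAt he hiso.1 inter_subset_left hw hl (h0 w hw))⟩

/-- Either w₁ vanishes on the whole patch, or it is nonzero at some point and then on a
neighbourhood of it. Applied to arbitrarily small U this gives density. -/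
theorem IsUmbilicalFrame.exists_mem_cylinder_or_special (hF : IsUmbilicalFrame g L U e₁ e₂)
    (hntg : ∀ p : M, ¬ IsTotallyGeodesicAt L p) (hz : ∀ q ∈ U, sff L e₂ e₂ q = 0)
    (hU : U.Nonempty) : ∃ q ∈ U, IsCylinderNear L q ∨ IsSpecialRuledNear L q := by
  obtain ⟨p, hp⟩ := hU
  obtain ⟨e, he, u, hu, rfl⟩ := exists_chart p
  obtain ⟨lam, mu, w₁, w₂, h, h0, hl⟩ := hF.exists_umbFrame_ruled hflat hiso hlag hntg hz he
  by_cases hw : ∀ w ∈ e.target ∩ e.symm ⁻¹' U, w₁ w = 0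
  · exact ⟨_, hp, Or.inl ((h.ruledForm_const h0 hl hw ⟨hu, hp⟩).isCylinderNear he
      inter_subset_left)⟩
  · push Not at hw
    obtain ⟨w, hwV, hw0⟩ := hw
    have hopen : IsOpen ((e.target ∩ e.symm ⁻¹' U) ∩ w₁ ⁻¹' {0}ᶜ) :=
      h.smooth_w₁.continuousOn.isOpen_inter_preimage h.isOpen isOpen_compl_singleton
    exact ⟨e.symm w, hwV.2, Or.inr (((h.mono hopen inter_subset_left).ruledForm_isSpecialLegendre
      (fun x hx => h0 x hx.1) (fun x hx => hl x hx.1) (fun x hx => hx.2)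
      ⟨hwV, hw0⟩).isSpecialRuledNear he (inter_subset_left.trans inter_subset_left))⟩

theorem isRuledNear_of_sff_eq_zero (humb : IsHUmbilical g L)
    (hntg : ∀ p : M, ¬ IsTotallyGeodesicAt L p)
    (hz : ∀ (U : Set M) (e₁ e₂ : ∀ q : M, TangentSpace (𝓡 2) q), IsUmbilicalFrame g L U e₁ e₂ →
      ∀ q ∈ U, sff L e₂ e₂ q = 0) (p : M) : IsRuledNear L p := by
  obtain ⟨U, e₁, e₂, hp, hF⟩ := humb.exists_frame p
  obtain ⟨e, he, u, hu, rfl⟩ := exists_chart p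
  obtain ⟨lam, mu, w₁, w₂, h, h0, hl⟩ :=
    hF.exists_umbFrame_ruled hflat hiso hlag hntg (hz U e₁ e₂ hF) he
  exact (h.ruledForm_isLegendre h0 hl ⟨hu, hp⟩).isRuledNear he inter_subset_left

theorem dense_cylinder_or_special (humb : IsHUmbilical g L)
    (hntg : ∀ p : M, ¬ IsTotallyGeodesicAt L p)
    (hz : ∀ (U : Set M) (e₁ e₂ : ∀ q : M, TangentSpace (𝓡 2) q), IsUmbilicalFrame g L U e₁ e₂ →
      ∀ q ∈ U, sff L e₂ e₂ q = 0) :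
    Dense {p | IsCylinderNear L p ∨ IsSpecialRuledNear L p} := by
  rw [dense_iff_inter_open]
  rintro O hO ⟨p, hp⟩
  obtain ⟨U, e₁, e₂, hpU, hF⟩ := humb.exists_frame p
  have hF' := hF.mono (hF.isOpen.inter hO) inter_subset_left
  obtain ⟨q, hq, hq'⟩ := hF'.exists_mem_cylinder_or_special hflat hiso hlag hntg
    (hz _ e₁ e₂ hF') ⟨p, hpU, hp⟩
  exact ⟨q, hq.2, hq'⟩

omit hflat hiso hlag in
-- The coordinates around one point serve every point of their domain.
theorem isOpen_cylinder_or_special (L : M → H2) :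
    IsOpen {p | IsCylinderNear L p ∨ IsSpecialRuledNear L p} := by
  rw [isOpen_iff_eventually]
  rintro p (⟨e, a, b, c, d, D, k, hc, hr⟩ | ⟨e, a, b, c, d, D, P, hc, hr⟩)
  · filter_upwards [e.open_source.mem_nhds hc.mem_source] with q hq
    exact Or.inl ⟨e, a, b, c, d, D, k, ⟨hc.mem_atlas, hq, hc.target_eq⟩, hr⟩
  · filter_upwards [e.open_source.mem_nhds hc.mem_source] with q hq
    exact Or.inr ⟨e, a, b, c, d, D, P, ⟨hc.mem_atlas, hq, hc.target_eq⟩, hr⟩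

end Global

end QLag

end

theorem theorem3p2 {M : Type*} [TopologicalSpace M] [ConnectedSpace M]
    [ChartedSpace QLag.Plane M] [IsManifold (𝓡 2) ∞ M]
    (g : QLag.SmoothMetric M) (L : M → QLag.H2)
    (hflat : QLag.IsFlat g)
    (hiso : QLag.IsIsometricImmersion g L)
    (hlag : QLag.IsLagrangian L)
    (humb : QLag.IsHUmbilical g L)
    (hntg : ∀ p : M, ¬ QLag.IsTotallyGeodesicAt L p) :
    ((∀ p : M, QLag.IsRuledNear L p) ∧
      ∃ W : Set M, IsOpen W ∧ Dense W ∧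
        ∀ p ∈ W, QLag.IsCylinderNear L p ∨ QLag.IsSpecialRuledNear L p) ∨
    (∃ v : QLag.H2, ∀ p : M, QLag.IsConeNear L v p) := by
  have hzero := QLag.sff_eq_zero_or_ne_zero hflat hiso hlag humb
  rcases hzero with hz | hne
  · exact Or.inl ⟨QLag.isRuledNear_of_sff_eq_zero hflat hiso hlag humb hntg hz, _,
      QLag.isOpen_cylinder_or_special L,
      QLag.dense_cylinder_or_special hflat hiso hlag humb hntg hz, fun _ hp => hp⟩
  · exact Or.inr (QLag.exists_cone_vertex hflat hiso hlag humb hne)
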